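/- Let $\mathbb{R}_+=[0,\infty)$ and let $\mathbb{R}_+^2$ be regarded as an additive topological semigroup. For $a<0$ put $A_a=[1,\infty)\times[a,0)\,\cup\,[0,\infty)\times[0,\infty)\subseteq\mathbb{R}^2$, and for a nonzero separable complex Hilbert space $k$ let $V^{(A_a,k)}=\{V_x\}_{x\in\mathbb{R}_+^2}$ be the strongly continuous semigroup of isometries on $L^2(A_a,k)$ given by $(V_xf)(y)=f(y-x)$ if $y-x\in A_a$ and $(V_xf)(y)=0$ otherwise. Its adjoints $V_x^*$ are strongly continuous in $x$ as well. An $E_0$-semigroup over $\mathbb{R}_+^2$ on $B(H)$ is a family $\{\alpha_x\}_{x\in\mathbb{R}_+^2}$ of unital normal $*$-endomorphisms of $B(H)$ with $\alpha_0=\mathrm{id}$, $\alpha_x\circ\alpha_y=\alpha_{x+y}$, and $x\mapsto\rho(\alpha_x(T))$ continuous for all $T\in B(H)$ and all $\rho$ in the predual of $B(H)$. Let $\Gamma(K)$ be the symmetric Fock space over $K$, with exponential vectors $e(u)=\sum_n u^{\otimes n}/\sqrt{n!}$. The CCR flow of $V=V^{(A_a,k)}$ is the $E_0$-semigroup $\alpha^{(A_a,k)}$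 over $\mathbb{R}_+^2$ on $B(\Gamma(L^2(A_a,k)))$ given by $\alpha_x(T)=1_{\Gamma(\ker V_x^*)}\otimes\Gamma(V_x)T\Gamma(V_x)^*$, where $\Gamma(V_x)e(u)=e(V_xu)$ and $\Gamma(\ker V_x^*)\otimes\Gamma(\operatorname{ran}V_x)$ is identified with $\Gamma(L^2(A_a,k))$ through $e(u)\otimes e(v)\mapsto e(u+v)$. Two such isometric representations $V$ on $K$ and $V'$ on $K'$ are conjugate if $UV_x=V'_xU$ for all $x$, for some unitary $U:K\to K'$. $E_0$-semigroups $\alpha$ on $B(H)$ and $\beta$ on $B(H')$ are conjugate if $\beta_x=\mathrm{Ad}(U)\circ\alpha_x\circ\mathrm{Ad}(U^*)$ for all $x$, for some unitary $U:H\to H'$; they are cocycle conjugate if $\mathrm{Ad}(U)\circ\alpha_x\circ\mathrm{Ad}(U^*)=\mathrm{Ad}(W_x)\circ\beta_x$ for all $x$, for some unitary $U:H\to H'$ and some strongly continuous family $\{W_x\}$ of unitaries in $B(H')$ with $W_x\beta_x(W_y)=W_{x+y}$ for all $x,y$. **Theorem.** Let $a_1,a_2<0$ and let $k_1,k_2$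 be nonzero separable complex Hilbert spaces. The following statements are equivalent: (i) the isometric representations $V^{(A_{a_1},k_1)}$ and $V^{(A_{a_2},k_2)}$ are conjugate; (ii) the CCR flows $\alpha^{(A_{a_1},k_1)}$ and $\alpha^{(A_{a_2},k_2)}$ are conjugate; (iii) the CCR flows $\alpha^{(A_{a_1},k_1)}$ and $\alpha^{(A_{a_2},k_2)}$ are cocycle conjugate; (iv) $\dim k_1=\dim k_2$ (in $\mathbb{N}\cup\{\infty\}$) and $a_1=a_2$. In particular, for every nonzero separable $k$ the family $\{\alpha^{(A_a,k)}\}_{a<0}$ is an uncountable family of mutually non-cocycle-conjugate $E_0$-semigroups over $\mathbb{R}_+^2$. -/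

import Mathlib

open scoped InnerProductSpace NNReal ENNReal TensorProduct
open MeasureTheory

set_option linter.unusedSectionVars false

noncomputable section

universe u v

/-- A bundled complex inner product space. -/
structure InnerSpaceCat : Type (u + 1) where
  carrier : Type u
  [grp : NormedAddCommGroup carrier]
  [ips : InnerProductSpace ℂ carrier]

attribute [instance] InnerSpaceCat.grp InnerSpaceCat.ips

section Fock

variable (K : Type u) [NormedAddCommGroup K] [InnerProductSpace ℂ K]

/-- The algebraic tensor power `K ⊗ (K ⊗ (⋯ ⊗ ℂ))`, with `n` factors `K`, as an inner product
space. Here `ℂ` is realized as `EuclideanSpace ℂ PUnit`, for universe reasons. -/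
def tensorPow : ℕ → InnerSpaceCat.{u}
  | 0 => ⟨EuclideanSpace ℂ PUnit.{u + 1}⟩
  | n + 1 => ⟨K ⊗[ℂ] (tensorPow n).carrier⟩

variable {K}

/-- The elementary tensor `u ⊗ u ⊗ ⋯ ⊗ u`, with `n` factors. -/
def tpow (u : K) : (n : ℕ) → (tensorPow K n).carrier
  | 0 => EuclideanSpace.single PUnit.unit (1 : ℂ)
  | n + 1 => u ⊗ₜ[ℂ] tpow u n

theorem inner_tpow (u v : K) (n : ℕ) : ⟪tpow u n, tpow v n⟫_ℂ = ⟪u, v⟫_ℂ ^ n := by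
  induction n with
  | zero =>
    change ⟪(EuclideanSpace.single PUnit.unit (1 : ℂ) : EuclideanSpace ℂ PUnit.{u + 1}),
      EuclideanSpace.single PUnit.unit (1 : ℂ)⟫_ℂ = _
    simp
  | succ n ih =>
    change ⟪u ⊗ₜ[ℂ] tpow u n, v ⊗ₜ[ℂ] tpow v n⟫_ℂ = _
    rw [TensorProduct.inner_tmul, ih, pow_succ, mul_comm]

theorem tpow_smul (c : ℂ) (u : K) (n : ℕ) : tpow (c • u) n = c ^ n • tpow u n := by
  induction n with
  | zero => rw [pow_zero, one_smul]; rfl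
  | succ n ih =>
    change (c • u) ⊗ₜ[ℂ] tpow (c • u) n = c ^ (n + 1) • (u ⊗ₜ[ℂ] tpow u n)
    rw [ih, TensorProduct.smul_tmul_smul, pow_succ, mul_comm]

variable (K)

/-- The symmetric `n`-fold Hilbert space tensor power of `K`: the closed linear span of the
vectors `u ⊗ ⋯ ⊗ u` in the completed `n`-fold tensor power (by polarization, this is the space of
all symmetric tensors). -/
def SymPow (n : ℕ) : Submodule ℂ (UniformSpace.Completion (tensorPow K n).carrier) :=
  (Submodule.span ℂ (Set.range fun u : K =>
    (tpow u n : UniformSpace.Completion (tensorPow K n).carrier))).topologicalClosure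

instance (n : ℕ) : CompleteSpace (SymPow K n) :=
  (Submodule.isClosed_topologicalClosure _).completeSpace_coe

/-- The symmetric Fock space `Γ(K) = ⨁ₙ K^{⊗ₛ n}` (Hilbert space direct sum). -/
def Fock : Type u := lp (fun n => SymPow K n) 2

instance : NormedAddCommGroup (Fock K) :=
  inferInstanceAs (NormedAddCommGroup (lp (fun n => SymPow K n) 2))

instance : InnerProductSpace ℂ (Fock K) :=
  inferInstanceAs (InnerProductSpace ℂ (lp (fun n => SymPow K n) 2))

instance : CompleteSpace (Fock K) :=
  inferInstanceAs (CompleteSpace (lp (fun n => SymPow K n) 2))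

variable {K}

/-- `u ⊗ ⋯ ⊗ u` as a vector of the symmetric tensor power. -/
def symTpow (u : K) (n : ℕ) : SymPow K n :=
  ⟨(tpow u n : UniformSpace.Completion (tensorPow K n).carrier),
    Submodule.le_topologicalClosure _ (Submodule.subset_span ⟨u, rfl⟩)⟩

theorem inner_symTpow (u v : K) (n : ℕ) : ⟪symTpow u n, symTpow v n⟫_ℂ = ⟪u, v⟫_ℂ ^ n := by
  rw [Submodule.coe_inner]
  change ⟪((tpow u n : _) : UniformSpace.Completion (tensorPow K n).carrier), (tpow v n : _)⟫_ℂ = _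
  rw [UniformSpace.Completion.inner_coe, inner_tpow]

theorem symTpow_smul (c : ℂ) (u : K) (n : ℕ) : symTpow (c • u) n = c ^ n • symTpow u n := by
  apply Subtype.ext
  change ((tpow (c • u) n : _) : UniformSpace.Completion (tensorPow K n).carrier)
    = c ^ n • ((tpow u n : _) : UniformSpace.Completion (tensorPow K n).carrier)
  rw [tpow_smul, UniformSpace.Completion.coe_smul]

theorem norm_symTpow (u : K) (n : ℕ) : ‖symTpow u n‖ = ‖u‖ ^ n := by
  have h := inner_symTpow u u n
  rw [inner_self_eq_norm_sq_to_K (𝕜 := ℂ) (symTpow u n), inner_self_eq_norm_sq_to_K] at h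
  have h' : ‖symTpow u n‖ ^ 2 = (‖u‖ ^ n) ^ 2 := by
    rw [← pow_mul, mul_comm n 2, pow_mul]
    exact_mod_cast h
  exact (pow_left_inj₀ (norm_nonneg _) (by positivity) two_ne_zero).1 h'

/-- The exponential vector `e(u) = ∑ₙ u^{⊗n} / √(n!)`. -/
def expVec (u : K) : Fock K :=
  show lp (fun n => SymPow K n) 2 from ⟨fun n => ((√(n.factorial : ℝ) : ℝ) : ℂ)⁻¹ • symTpow u n, by
    refine memℓp_gen ?_
    refine (Real.summable_pow_div_factorial (‖u‖ ^ 2)).congr fun n => ?_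
    simp only [norm_smul, norm_inv, Complex.norm_real, norm_symTpow, ENNReal.toReal_ofNat,
      Real.rpow_ofNat, mul_pow, inv_pow, Real.norm_eq_abs, sq_abs]
    rw [Real.sq_sqrt (by positivity), ← pow_mul, ← pow_mul, mul_comm n 2, div_eq_inv_mul]⟩

theorem inner_expVec (u v : K) : ⟪expVec u, expVec v⟫_ℂ = Complex.exp ⟪u, v⟫_ℂ := by
  have h := lp.hasSum_inner (𝕜 := ℂ) (G := fun n => SymPow K n) (expVec u) (expVec v)
  have h2 := NormedSpace.expSeries_div_hasSum_exp (𝔸 := ℂ) ⟪u, v⟫_ℂ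
  rw [← Complex.exp_eq_exp_ℂ] at h2
  refine h.unique (h2.congr_fun ?_)
  intro n
  change ⟪((√(n.factorial : ℝ) : ℝ) : ℂ)⁻¹ • symTpow u n,
    ((√(n.factorial : ℝ) : ℝ) : ℂ)⁻¹ • symTpow v n⟫_ℂ = _
  rw [inner_smul_left (symTpow u n), inner_smul_right (symTpow u n), inner_symTpow, map_inv₀, Complex.conj_ofReal, ← mul_assoc,
    ← mul_inv, ← Complex.ofReal_mul, Real.mul_self_sqrt (by positivity), div_eq_inv_mul]
  simp

theorem continuous_expVec : Continuous (expVec : K → Fock K) := by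
  rw [continuous_iff_continuousAt]
  intro u
  rw [ContinuousAt, tendsto_iff_norm_sub_tendsto_zero]
  have h : Filter.Tendsto (fun v : K => RCLike.re (Complex.exp ⟪v, v⟫_ℂ - Complex.exp ⟪v, u⟫_ℂ
      - Complex.exp ⟪u, v⟫_ℂ + Complex.exp ⟪u, u⟫_ℂ)) (nhds u) (nhds 0) := by
    have : Continuous (fun v : K => RCLike.re (Complex.exp ⟪v, v⟫_ℂ - Complex.exp ⟪v, u⟫_ℂ
      - Complex.exp ⟪u, v⟫_ℂ + Complex.exp ⟪u, u⟫_ℂ)) := by fun_prop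
    simpa using this.tendsto u
  have h2 := (Real.continuous_sqrt.tendsto 0).comp h
  rw [Real.sqrt_zero] at h2
  refine h2.congr fun v => ?_
  rw [Function.comp, ← inner_expVec, ← inner_expVec, ← inner_expVec, ← inner_expVec,
    ← inner_sub_sub_self (𝕜 := ℂ), inner_self_eq_norm_sq, Real.sqrt_sq (norm_nonneg _)]

theorem expVec_total :
    (Submodule.span ℂ (Set.range (expVec : K → Fock K))).topologicalClosure = ⊤ := by
  rw [Submodule.topologicalClosure_eq_top_iff, Submodule.eq_bot_iff]
  intro x' hx
  let x : lp (fun n => SymPow K n) 2 := x'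
  change x = 0
  have key : ∀ (u : K) (n : ℕ), ⟪x n, symTpow u n⟫_ℂ = 0 := by
    intro u
    set a : ℕ → ℂ := fun n => ((√(n.factorial : ℝ) : ℝ) : ℂ)⁻¹ * ⟪x n, symTpow u n⟫_ℂ with ha
    have hs : ∀ t : ℂ, HasSum (fun n => t ^ n * a n) 0 := by
      intro t
      have h : HasSum _ ⟪x', expVec (t • u)⟫_ℂ :=
        lp.hasSum_inner (𝕜 := ℂ) (G := fun n => SymPow K n) x (expVec (t • u))
      rw [(Submodule.mem_orthogonal' _ _).1 hx _ (Submodule.subset_span ⟨_, rfl⟩)] at h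
      refine h.congr_fun fun n => ?_
      change _ = ⟪x n, ((√(n.factorial : ℝ) : ℝ) : ℂ)⁻¹ • symTpow (t • u) n⟫_ℂ
      rw [symTpow_smul, inner_smul_right (x n), inner_smul_right (x n), ha]
      ring
    have hp : HasFPowerSeriesAt (fun _ : ℂ => (0 : ℂ))
        (FormalMultilinearSeries.ofScalars ℂ a) 0 :=
      hasFPowerSeriesAt_iff.2 (Filter.Eventually.of_forall fun t => by
        simpa only [FormalMultilinearSeries.coeff_ofScalars, smul_eq_mul] using hs t)
    have h0 := (FormalMultilinearSeries.ofScalars_series_eq_zero ℂ).1 hp.eq_zero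
    intro n
    have h1 : a n = 0 := congrFun h0 n
    rw [ha] at h1
    refine (mul_eq_zero.1 h1).resolve_left (inv_ne_zero ?_)
    rw [Complex.ofReal_ne_zero]
    positivity
  ext n : 2
  have h1 : (x n : UniformSpace.Completion (tensorPow K n).carrier) = 0 := by
    have h2 : SymPow K n ≤ (ℂ ∙ (x n : UniformSpace.Completion (tensorPow K n).carrier))ᗮ := by
      refine Submodule.topologicalClosure_minimal _ (Submodule.span_le.2 ?_)
        (Submodule.isClosed_orthogonal _)
      rintro _ ⟨u, rfl⟩
      exact Submodule.mem_orthogonal_singleton_iff_inner_right.2 (key u n)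
    exact inner_self_eq_zero.1 (Submodule.mem_orthogonal_singleton_iff_inner_right.1 (h2 (x n).2))
  exact Subtype.ext h1

end Fock

section General

variable {H : Type u} {H' : Type v} [NormedAddCommGroup H] [InnerProductSpace ℂ H]
  [CompleteSpace H] [NormedAddCommGroup H'] [InnerProductSpace ℂ H'] [CompleteSpace H']

theorem denseRange_linearCombination {ι : Type*} {x : ι → H}
    (hx : (Submodule.span ℂ (Set.range x)).topologicalClosure = ⊤) :
    DenseRange (Finsupp.linearCombination ℂ x) := by
  have h := Submodule.dense_iff_topologicalClosure_eq_top.2 hx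
  rw [← Finsupp.range_linearCombination] at h
  exact h

theorem inner_linearCombination {ι : Type*} {x : ι → H} {y : ι → H'}
    (h : ∀ i j, ⟪x i, x j⟫_ℂ = ⟪y i, y j⟫_ℂ) (f : ι →₀ ℂ) :
    ‖Finsupp.linearCombination ℂ y f‖ = ‖Finsupp.linearCombination ℂ x f‖ := by
  rw [@norm_eq_sqrt_re_inner ℂ, @norm_eq_sqrt_re_inner ℂ]
  simp only [Finsupp.linearCombination_apply, Finsupp.sum, sum_inner, inner_sum, inner_smul_left,
    inner_smul_right, h]

/-- The unitary operator that carries one total family to another one with the same Gram matrix. -/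
def gramUnitary {ι : Type*} (x : ι → H) (y : ι → H')
    (hx : (Submodule.span ℂ (Set.range x)).topologicalClosure = ⊤)
    (hy : (Submodule.span ℂ (Set.range y)).topologicalClosure = ⊤)
    (h : ∀ i j, ⟪x i, x j⟫_ℂ = ⟪y i, y j⟫_ℂ) : H ≃ₗᵢ[ℂ] H' :=
  (LinearEquiv.refl ℂ (ι →₀ ℂ)).extendOfIsometry (Finsupp.linearCombination ℂ x)
    (Finsupp.linearCombination ℂ y) (denseRange_linearCombination hx)
    (denseRange_linearCombination hy) (inner_linearCombination h)

theorem gramUnitary_apply {ι : Type*} (x : ι → H) (y : ι → H')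
    (hx : (Submodule.span ℂ (Set.range x)).topologicalClosure = ⊤)
    (hy : (Submodule.span ℂ (Set.range y)).topologicalClosure = ⊤)
    (h : ∀ i j, ⟪x i, x j⟫_ℂ = ⟪y i, y j⟫_ℂ) (i : ι) :
    gramUnitary x y hx hy h (x i) = y i := by
  have h1 := LinearEquiv.extendOfIsometry_eq (f := LinearEquiv.refl ℂ (ι →₀ ℂ))
    (e₁ := Finsupp.linearCombination ℂ x) (e₂ := Finsupp.linearCombination ℂ y)
    (denseRange_linearCombination hx)
    (denseRange_linearCombination hy) (inner_linearCombination h) (Finsupp.single i 1)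
  simpa [gramUnitary] using h1

/-- The Hilbert space tensor product. -/
abbrev HTensor (A : Type u) (B : Type v) [NormedAddCommGroup A] [InnerProductSpace ℂ A]
    [NormedAddCommGroup B] [InnerProductSpace ℂ B] : Type (max u v) :=
  UniformSpace.Completion (A ⊗[ℂ] B)

/-- The elementary tensor `a ⊗ b`. -/
def htmul (a : H) (b : H') : HTensor H H' := ((a ⊗ₜ[ℂ] b : H ⊗[ℂ] H') : HTensor H H')

theorem inner_htmul (a c : H) (b d : H') :
    ⟪htmul a b, htmul c d⟫_ℂ = ⟪a, c⟫_ℂ * ⟪b, d⟫_ℂ := by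
  rw [htmul, htmul, UniformSpace.Completion.inner_coe, TensorProduct.inner_tmul]

/-- `b ↦ a ⊗ b` as a bounded operator. -/
def htmulLeft (a : H) : H' →L[ℂ] HTensor H H' :=
  UniformSpace.Completion.toComplL ∘L (TensorProduct.mkL ℂ H H' a)

theorem htmulLeft_apply (a : H) (b : H') : htmulLeft a b = htmul a b := rfl

theorem htmul_smul (c : ℂ) (a : H) (b : H') : htmul a (c • b) = c • htmul a b := by
  rw [← htmulLeft_apply, ContinuousLinearMap.map_smul, htmulLeft_apply]

/-- `a ↦ a ⊗ b` as a bounded operator. -/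
def htmulRight (b : H') : H →L[ℂ] HTensor H H' :=
  UniformSpace.Completion.toComplL ∘L ((TensorProduct.mkL ℂ H H').flip b)

theorem htmulRight_apply (a : H) (b : H') : htmulRight b a = htmul a b := rfl

theorem htensor_hom_ext {E : Type*} [NormedAddCommGroup E] [NormedSpace ℂ E]
    {f g : HTensor H H' →L[ℂ] E} (h : ∀ a b, f (htmul a b) = g (htmul a b)) : f = g := by
  have h1 : ∀ z : H ⊗[ℂ] H', f (z : HTensor H H') = g (z : HTensor H H') := by
    intro z
    have h2 : (f ∘L UniformSpace.Completion.toComplL).toLinearMap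
        = (g ∘L UniformSpace.Completion.toComplL).toLinearMap :=
      TensorProduct.ext' h
    exact LinearMap.congr_fun h2 z
  ext z
  induction z using UniformSpace.Completion.induction_on with
  | hp => exact isClosed_eq f.continuous g.continuous
  | ih z => exact h1 z

theorem htmul_total {ι κ : Type*} {x : ι → H} {y : κ → H'}
    (hx : (Submodule.span ℂ (Set.range x)).topologicalClosure = ⊤)
    (hy : (Submodule.span ℂ (Set.range y)).topologicalClosure = ⊤) :
    (Submodule.span ℂ (Set.range fun p : ι × κ => htmul (x p.1) (y p.2))).topologicalClosure
      = ⊤ := by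
  rw [Submodule.topologicalClosure_eq_top_iff, Submodule.eq_bot_iff]
  intro z hz
  have hx' := Submodule.dense_iff_topologicalClosure_eq_top.2 hx
  have hy' := Submodule.dense_iff_topologicalClosure_eq_top.2 hy
  have h0 : ∀ i k, ⟪z, htmul (x i) (y k)⟫_ℂ = 0 := fun i k =>
    (Submodule.mem_orthogonal' _ _).1 hz _ (Submodule.subset_span ⟨(i, k), rfl⟩)
  have h1 : ∀ a k, ⟪z, htmul a (y k)⟫_ℂ = 0 := by
    intro a k
    have : innerSL ℂ z ∘L htmulRight (H := H) (y k) = 0 :=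
      ContinuousLinearMap.ext_on hx' (by rintro _ ⟨i, rfl⟩; exact h0 i k)
    exact congrArg (fun f => f a) this
  have h2 : ∀ a b, ⟪z, htmul a b⟫_ℂ = 0 := by
    intro a b
    have : innerSL ℂ z ∘L htmulLeft (H' := H') a = 0 :=
      ContinuousLinearMap.ext_on hy' (by rintro _ ⟨k, rfl⟩; exact h1 a k)
    exact congrArg (fun f => f b) this
  have h3 : innerSL ℂ z = 0 := htensor_hom_ext (fun a b => h2 a b)
  exact inner_self_eq_zero.1 (congrArg (fun f => f z) h3)

variable (H) in
/-- The operator `1 ⊗ T`. -/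
def oneTensor (T : H' →L[ℂ] H') : HTensor H H' →L[ℂ] HTensor H H' :=
  (UniformSpace.Completion.toComplL ∘L T.lTensor H).extend UniformSpace.Completion.toComplL

theorem oneTensor_htmul (T : H' →L[ℂ] H') (a : H) (b : H') :
    oneTensor H T (htmul a b) = htmul a (T b) :=
  ContinuousLinearMap.extend_eq _ UniformSpace.Completion.denseRange_coe
    (UniformSpace.Completion.isUniformInducing_coe _) (a ⊗ₜ[ℂ] b)

theorem oneTensor_eq {T : H' →L[ℂ] H'} {S : HTensor H H' →L[ℂ] HTensor H H'}
    (h : ∀ a b, S (htmul a b) = htmul a (T b)) : S = oneTensor H T :=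
  htensor_hom_ext fun a b => by rw [h, oneTensor_htmul]

theorem inner_oneTensor (T : H' →L[ℂ] H') (z w : HTensor H H') :
    ⟪oneTensor H (ContinuousLinearMap.adjoint T) z, w⟫_ℂ = ⟪z, oneTensor H T w⟫_ℂ := by
  have : ContinuousLinearMap.adjoint (oneTensor H T)
      = oneTensor H (ContinuousLinearMap.adjoint T) := by
    refine oneTensor_eq fun a b => ?_
    refine ext_inner_right ℂ fun w => ?_
    rw [ContinuousLinearMap.adjoint_inner_left]
    have : innerSL ℂ (htmul a b) ∘L oneTensor H T
        = innerSL ℂ (htmul a (ContinuousLinearMap.adjoint T b)) :=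
      htensor_hom_ext fun c d => by
        simp [oneTensor_htmul, inner_htmul, ContinuousLinearMap.adjoint_inner_left]
    exact congrArg (fun f => f w) this
  rw [← this, ContinuousLinearMap.adjoint_inner_left]

variable (H) in
/-- The ampliation `T ↦ 1 ⊗ T` as a unital `*`-homomorphism. -/
def ampliation : (H' →L[ℂ] H') →⋆ₐ[ℂ] (HTensor H H' →L[ℂ] HTensor H H') where
  toFun := oneTensor H
  map_one' := (oneTensor_eq fun a b => rfl).symm
  map_mul' S T := (oneTensor_eq fun a b => by
    rw [mul_apply_eq_comp, oneTensor_htmul, oneTensor_htmul]; rfl).symm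
  map_zero' := (oneTensor_eq fun a b => by
    rw [zero_apply, ← htmulLeft_apply]
    simp).symm
  map_add' S T := (oneTensor_eq fun a b => by
    rw [add_apply, oneTensor_htmul, oneTensor_htmul, ← htmulLeft_apply,
      ← htmulLeft_apply, ← htmulLeft_apply]
    simp).symm
  commutes' c := (oneTensor_eq fun a b => by
    rw [← htmulLeft_apply, ← htmulLeft_apply]
    simp [Algebra.algebraMap_eq_smul_one]).symm
  map_star' T := by
    rw [ContinuousLinearMap.star_eq_adjoint, ContinuousLinearMap.star_eq_adjoint]
    refine ContinuousLinearMap.ext fun z => ext_inner_right ℂ fun w => ?_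
    rw [inner_oneTensor, ContinuousLinearMap.adjoint_inner_left]

end General

section Semigroups

variable {P : Type*} [AddMonoid P] [TopologicalSpace P]
variable {H : Type u} {H' : Type v} [NormedAddCommGroup H] [InnerProductSpace ℂ H]
  [CompleteSpace H] [NormedAddCommGroup H'] [InnerProductSpace ℂ H'] [CompleteSpace H']

/-- Elements of the predual of `B(H)`, i.e. the functionals `T ↦ ∑ₙ ⟨ξₙ, T ηₙ⟩` with
`∑ₙ ‖ξₙ‖² < ∞` and `∑ₙ ‖ηₙ‖² < ∞`. -/
def IsNormalFunctional (φ : (H →L[ℂ] H) → ℂ) : Prop :=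
  ∃ ξ η : ℕ → H, (Summable fun n => ‖ξ n‖ ^ 2) ∧ (Summable fun n => ‖η n‖ ^ 2) ∧
    ∀ T : H →L[ℂ] H, φ T = ∑' n, ⟪ξ n, T (η n)⟫_ℂ

variable (P H) in
/-- An `E₀`-semigroup over `P` on `B(H)`: a semigroup of unital normal `*`-endomorphisms of `B(H)`
such that `x ↦ φ (α x T)` is continuous on `P` for every `T` in `B(H)` and every `φ` in the
predual of `B(H)`. A map is normal if it pulls back the predual into the predual. -/
structure E0Semigroup where
  toFun : P → (H →L[ℂ] H) →⋆ₐ[ℂ] (H →L[ℂ] H)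
  normal : ∀ x φ, IsNormalFunctional φ → IsNormalFunctional fun T => φ (toFun x T)
  map_zero : ∀ T, toFun 0 T = T
  map_add : ∀ x y T, toFun (x + y) T = toFun x (toFun y T)
  continuous : ∀ φ, IsNormalFunctional φ → ∀ T, Continuous fun x => φ (toFun x T)

instance : CoeFun (E0Semigroup P H) fun _ => P → (H →L[ℂ] H) →⋆ₐ[ℂ] (H →L[ℂ] H) :=
  ⟨E0Semigroup.toFun⟩

/-- A (unitary) cocycle of `α`: a strongly continuous family of unitaries `W x` in `B(H)` with
`W x * α x (W y) = W (x + y)`. -/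
structure E0Semigroup.IsCocycle (α : E0Semigroup P H) (W : P → H →L[ℂ] H) : Prop where
  mem_unitary : ∀ x, W x ∈ unitary (H →L[ℂ] H)
  continuous : ∀ ξ, Continuous fun x => W x ξ
  mul : ∀ x y, W x * α x (W y) = W (x + y)

/-- `β` is conjugate to `α`: `β x = Ad(U) ∘ α x ∘ Ad(U*)` for some unitary `U : H → H'`.
Here `U.conjStarAlgEquiv` is `Ad(U)`. -/
def E0Semigroup.Conjugate (α : E0Semigroup P H) (β : E0Semigroup P H') : Prop :=
  ∃ U : H ≃ₗᵢ[ℂ] H', ∀ x T, β x T = U.conjStarAlgEquiv (α x (U.symm.conjStarAlgEquiv T))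

/-- `α` is cocycle conjugate to `β`: for some unitary `U : H → H'`, the semigroup
`Ad(U) ∘ α x ∘ Ad(U)*` is of the form `Ad(W x) ∘ β x` for a cocycle `W` of `β`. -/
def E0Semigroup.CocycleConjugate (α : E0Semigroup P H) (β : E0Semigroup P H') : Prop :=
  ∃ U : H ≃ₗᵢ[ℂ] H', ∃ W : P → H' →L[ℂ] H', β.IsCocycle W ∧
    ∀ x T, U.conjStarAlgEquiv (α x (U.symm.conjStarAlgEquiv T)) = W x * β x T * star (W x)

variable (P H) in
/-- An isometric representation of `P` on `H`. -/
structure IsometricRep where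
  toFun : P → H →ₗᵢ[ℂ] H
  map_add : ∀ x y ξ, toFun (x + y) ξ = toFun x (toFun y ξ)
  continuous : ∀ ξ, Continuous fun x => toFun x ξ

instance : CoeFun (IsometricRep P H) fun _ => P → H →ₗᵢ[ℂ] H := ⟨IsometricRep.toFun⟩

/-- The representation is strictly continuous: the adjoints are strongly continuous, too. -/
def IsometricRep.StrictlyContinuous (V : IsometricRep P H) : Prop :=
  ∀ ξ, Continuous fun x => ContinuousLinearMap.adjoint (V x).toContinuousLinearMap ξ

/-- Two isometric representations are conjugate if a unitary operator intertwines them. -/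
def IsometricRep.Conjugate (V : IsometricRep P H) (V' : IsometricRep P H') : Prop :=
  ∃ U : H ≃ₗᵢ[ℂ] H', ∀ x ξ, U (V x ξ) = V' x (U ξ)

theorem isNormalFunctional_of_index {ι : Type*} (ξ η : ι → H) (hξ : Summable fun i => ‖ξ i‖ ^ 2)
    (hη : Summable fun i => ‖η i‖ ^ 2) :
    IsNormalFunctional fun T : H →L[ℂ] H => ∑' i, ⟪ξ i, T (η i)⟫_ℂ := by
  have hc : (Function.support fun i => ‖ξ i‖ ^ 2).Countable := hξ.countable_support
  have : Countable (Function.support fun i => ‖ξ i‖ ^ 2) := hc.to_subtype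
  obtain ⟨g, hg⟩ := Countable.exists_injective_nat (Function.support fun i => ‖ξ i‖ ^ 2)
  refine ⟨Function.extend g (fun s => ξ s) 0, Function.extend g (fun s => η s) 0, ?_, ?_, ?_⟩
  · rw [← hg.summable_iff]
    · refine (hξ.comp_injective Subtype.val_injective).congr fun s => ?_
      simp [hg.extend_apply]
    · intro n hn
      simp [Function.extend_apply' _ _ _ hn]
  · rw [← hg.summable_iff]
    · refine (hη.comp_injective Subtype.val_injective).congr fun s => ?_
      simp [hg.extend_apply]
    · intro n hn
      simp [Function.extend_apply' _ _ _ hn]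
  · intro T
    rw [← hg.tsum_eq (f := fun n => ⟪Function.extend g (fun s => ξ s) 0 n,
      T (Function.extend g (fun s => η s) 0 n)⟫_ℂ)]
    · simp only [hg.extend_apply]
      rw [← Subtype.val_injective.tsum_eq (f := fun i => ⟪ξ i, T (η i)⟫_ℂ)]
      intro i hi
      refine ⟨⟨i, fun h => hi ?_⟩, rfl⟩
      have : ξ i = 0 := by simpa using h
      simp [this]
    · intro n hn
      by_contra h
      exact hn (by simp [Function.extend_apply' _ _ _ h])

theorem summable_norm_inner {ι : Type*} {ξ η : ι → H} (hξ : Summable fun i => ‖ξ i‖ ^ 2)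
    (hη : Summable fun i => ‖η i‖ ^ 2) (C : ℝ) : Summable fun i => C * (‖ξ i‖ * ‖η i‖) := by
  refine Summable.mul_left C (Summable.of_nonneg_of_le (fun i => by positivity) (fun i => ?_)
    (hξ.add hη))
  nlinarith [sq_nonneg (‖ξ i‖ - ‖η i‖), sq_nonneg (‖ξ i‖), sq_nonneg (‖η i‖)]

theorem summable_inner_apply {ι : Type*} {ξ η : ι → H} (hξ : Summable fun i => ‖ξ i‖ ^ 2)
    (hη : Summable fun i => ‖η i‖ ^ 2) (T : H →L[ℂ] H) :
    Summable fun i => ⟪ξ i, T (η i)⟫_ℂ := by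
  refine Summable.of_norm_bounded (summable_norm_inner hξ hη ‖T‖) fun i => ?_
  calc ‖⟪ξ i, T (η i)⟫_ℂ‖ ≤ ‖ξ i‖ * ‖T (η i)‖ := norm_inner_le_norm _ _
    _ ≤ ‖ξ i‖ * (‖T‖ * ‖η i‖) := by gcongr; exact T.le_opNorm _
    _ = ‖T‖ * (‖ξ i‖ * ‖η i‖) := by ring

/-- The component of a vector of `H ⊗ H'` along `a` in `H`. -/
def slice (a : H) : HTensor H H' →L[ℂ] H' := ContinuousLinearMap.adjoint (htmulLeft a)

theorem slice_htmul (a c : H) (d : H') : slice a (htmul c d) = ⟪a, c⟫_ℂ • d := by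
  refine ext_inner_left ℂ fun w => ?_
  rw [slice, ContinuousLinearMap.adjoint_inner_right, htmulLeft_apply, inner_htmul,
    inner_smul_right]

theorem slice_oneTensor (a : H) (T : H' →L[ℂ] H') (z : HTensor H H') :
    slice a (oneTensor H T z) = T (slice a z) := by
  have : slice a ∘L oneTensor H T = T ∘L slice a :=
    htensor_hom_ext fun c d => by simp [oneTensor_htmul, slice_htmul]
  exact congrArg (fun f => f z) this

theorem hasSum_slice {ι : Type*} (b : HilbertBasis ι ℂ H) (z w : HTensor H H') :
    HasSum (fun i => ⟪slice (b i) z, slice (b i) w⟫_ℂ) ⟪z, w⟫_ℂ := by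
  classical
  have hn : ∀ i (d : H'), ‖htmulLeft (b i) d‖ = ‖d‖ := fun i d => by
    rw [htmulLeft_apply, htmul, UniformSpace.Completion.norm_coe, TensorProduct.norm_tmul,
      b.orthonormal.1 i, one_mul]
  let V : ι → H' →ₗᵢ[ℂ] HTensor H H' := fun i => ⟨(htmulLeft (b i)).toLinearMap, hn i⟩
  have hV : IsHilbertSum ℂ (fun _ : ι => H') V := by
    refine IsHilbertSum.mk ?_ ?_
    · intro i j hij c d
      change ⟪htmul (b i) c, htmul (b j) d⟫_ℂ = 0
      rw [inner_htmul, b.orthonormal.2 hij, zero_mul]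
    · rw [← htmul_total b.dense_span (y := (id : H' → H')) (by
        rw [Set.range_id, Submodule.span_univ]
        exact top_le_iff.1 (Submodule.le_topologicalClosure _))]
      refine Submodule.topologicalClosure_mono (Submodule.span_le.2 ?_)
      rintro _ ⟨⟨i, d⟩, rfl⟩
      exact Submodule.mem_iSup_of_mem i ⟨d, rfl⟩
  have hs : ∀ z i, hV.linearIsometryEquiv z i = slice (b i) z := by
    intro z i
    refine ext_inner_left ℂ fun d => ?_
    rw [slice, ContinuousLinearMap.adjoint_inner_right,
      ← lp.inner_single_left (𝕜 := ℂ) (G := fun _ : ι => H') i d (hV.linearIsometryEquiv z),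
      ← hV.linearIsometryEquiv.symm.inner_map_map, hV.linearIsometryEquiv_symm_apply_single,
      LinearIsometryEquiv.symm_apply_apply]
    rfl
  have h := lp.hasSum_inner (𝕜 := ℂ) (hV.linearIsometryEquiv z) (hV.linearIsometryEquiv w)
  rw [LinearIsometryEquiv.inner_map_map] at h
  simpa only [hs] using h

theorem summable_slice {ι : Type*} (b : HilbertBasis ι ℂ H) {ξ : ℕ → HTensor H H'}
    (hξ : Summable fun n => ‖ξ n‖ ^ 2) :
    Summable fun p : ℕ × ι => ‖slice (b p.2) (ξ p.1)‖ ^ 2 := by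
  have h : ∀ n, HasSum (fun i => ‖slice (b i) (ξ n)‖ ^ 2) (‖ξ n‖ ^ 2) := by
    intro n
    have h1 := hasSum_slice b (ξ n) (ξ n)
    simp only [inner_self_eq_norm_sq_to_K] at h1
    exact_mod_cast h1
  rw [summable_prod_of_nonneg (fun p => by positivity)]
  exact ⟨fun n => (h n).summable, hξ.congr fun n => (h n).tsum_eq.symm⟩

/-- The unital `*`-homomorphism `T ↦ U (1 ⊗ T) U*`. -/
def ampliationConj {H'' : Type*} [NormedAddCommGroup H''] [InnerProductSpace ℂ H'']
    [CompleteSpace H''] (U : HTensor H H' ≃ₗᵢ[ℂ] H'') :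
    (H' →L[ℂ] H') →⋆ₐ[ℂ] (H'' →L[ℂ] H'') :=
  U.conjStarAlgEquiv.toStarAlgHom.comp (ampliation H)

/-- The ampliation is normal. -/
theorem isNormalFunctional_ampliation {φ : (HTensor H H' →L[ℂ] HTensor H H') → ℂ}
    (hφ : IsNormalFunctional φ) : IsNormalFunctional fun T => φ (ampliation H T) := by
  obtain ⟨ξ, η, hξ, hη, h⟩ := hφ
  obtain ⟨w, b, -⟩ := exists_hilbertBasis ℂ H
  have h1 := summable_slice b hξ
  have h2 := summable_slice b hη
  have key := isNormalFunctional_of_index _ _ h1 h2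
  convert key using 2 with T
  rw [h, (summable_inner_apply h1 h2 T).tsum_prod]
  refine tsum_congr fun n => ?_
  rw [← (hasSum_slice b _ _).tsum_eq]
  exact tsum_congr fun i => by rw [← slice_oneTensor]; rfl

theorem isNormalFunctional_conj {φ : (H' →L[ℂ] H') → ℂ} (hφ : IsNormalFunctional φ)
    (U : H ≃ₗᵢ[ℂ] H') : IsNormalFunctional fun T => φ (U.conjStarAlgEquiv T) := by
  obtain ⟨ξ, η, hξ, hη, h⟩ := hφ
  refine ⟨fun n => U.symm (ξ n), fun n => U.symm (η n), by simpa using hξ, by simpa using hη,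
    fun T => ?_⟩
  change φ (U.conjStarAlgEquiv T) = _
  rw [h]
  refine tsum_congr fun n => ?_
  rw [LinearIsometryEquiv.conjStarAlgEquiv_apply_apply, ← U.symm.inner_map_map,
    LinearIsometryEquiv.symm_apply_apply]

theorem continuous_inner_of_total {X ι : Type*} [TopologicalSpace X] {s : ι → H}
    (hs : (Submodule.span ℂ (Set.range s)).topologicalClosure = ⊤) {F : X → H} {C : ℝ}
    (hF : ∀ x, ‖F x‖ ≤ C) (h : ∀ i, Continuous fun x => ⟪s i, F x⟫_ℂ) (ξ : H) :
    Continuous fun x => ⟪ξ, F x⟫_ℂ := by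
  let M : Submodule ℂ H :=
    { carrier := {ξ | Continuous fun x => ⟪ξ, F x⟫_ℂ}
      add_mem' := fun {a b} ha hb => by
        simp only [Set.mem_ofPred_eq, inner_add_left]
        exact Continuous.add ha hb
      zero_mem' := by simpa using continuous_const
      smul_mem' := fun c a ha => by
        simp only [Set.mem_ofPred_eq, inner_smul_left]
        exact continuous_const.mul ha }
  have hM : IsClosed (M : Set H) := by
    refine isClosed_of_closure_subset fun ξ hξ => ?_
    refine continuous_of_uniform_approx_of_continuous fun u hu => ?_
    obtain ⟨ε, hε, hu⟩ := Metric.mem_uniformity_dist.1 hu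
    obtain ⟨η, hη, hd⟩ := Metric.mem_closure_iff.1 hξ (ε / (|C| + 1)) (by positivity)
    refine ⟨_, hη, fun x => hu ?_⟩
    rw [dist_eq_norm, ← inner_sub_left]
    rw [dist_eq_norm] at hd
    calc ‖⟪ξ - η, F x⟫_ℂ‖ ≤ ‖ξ - η‖ * ‖F x‖ := norm_inner_le_norm _ _
      _ ≤ ‖ξ - η‖ * (|C| + 1) := by
        gcongr
        exact (hF x).trans ((le_abs_self C).trans (by linarith))
      _ < ε / (|C| + 1) * (|C| + 1) := by gcongr
      _ = ε := by field_simp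
  have : (⊤ : Submodule ℂ H) ≤ M := by
    rw [← hs]
    refine Submodule.topologicalClosure_minimal _ (Submodule.span_le.2 ?_) hM
    rintro _ ⟨i, rfl⟩
    exact h i
  exact this (Submodule.mem_top (x := ξ))

end Semigroups

section CCR

variable {P : Type*} [AddMonoid P] [TopologicalSpace P]
variable {K : Type u} [NormedAddCommGroup K] [InnerProductSpace ℂ K] [CompleteSpace K]

/-- The kernel of the adjoint of an isometry `V`. -/
abbrev kerAdj (V : K →ₗᵢ[ℂ] K) : Submodule ℂ K :=
  (ContinuousLinearMap.adjoint V.toContinuousLinearMap).ker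

theorem adjoint_apply_self (V : K →ₗᵢ[ℂ] K) (v : K) :
    ContinuousLinearMap.adjoint V.toContinuousLinearMap (V v) = v := by
  refine ext_inner_left ℂ fun w => ?_
  rw [ContinuousLinearMap.adjoint_inner_right]
  exact V.inner_map_map w v

theorem inner_kerAdj_add (V : K →ₗᵢ[ℂ] K) (a b : kerAdj V) (v w : K) :
    ⟪(a : K) + V v, b + V w⟫_ℂ = ⟪a, b⟫_ℂ + ⟪v, w⟫_ℂ := by
  have h1 : ⟪(a : K), V w⟫_ℂ = 0 := by
    rw [← V.coe_toContinuousLinearMap, ← ContinuousLinearMap.adjoint_inner_left,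
      show ContinuousLinearMap.adjoint V.toContinuousLinearMap (a : K) = 0 from a.2,
      inner_zero_left]
  have h2 : ⟪V v, (b : K)⟫_ℂ = 0 := by
    rw [← V.coe_toContinuousLinearMap, ← ContinuousLinearMap.adjoint_inner_right,
      show ContinuousLinearMap.adjoint V.toContinuousLinearMap (b : K) = 0 from b.2,
      inner_zero_right]
  rw [inner_add_left, inner_add_right, inner_add_right, h1, h2, V.inner_map_map]
  simp

/-- The component of `u` in `ker V*`, in the decomposition `K = ker V* ⊕ V K`. -/
def kerPart (V : K →ₗᵢ[ℂ] K) (u : K) : kerAdj V :=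
  ⟨u - V (ContinuousLinearMap.adjoint V.toContinuousLinearMap u), by
    rw [LinearMap.mem_ker, map_sub]
    exact sub_eq_zero.2 (adjoint_apply_self V _).symm⟩

theorem kerPart_add (V : K →ₗᵢ[ℂ] K) (u : K) :
    (kerPart V u : K) + V (ContinuousLinearMap.adjoint V.toContinuousLinearMap u) = u :=
  sub_add_cancel _ _

/-- The unitary operator `Γ(ker V*) ⊗ Γ(K) → Γ(K)` with `e(a) ⊗ e(v) ↦ e(a + V v)`. It is the
composition of `1 ⊗ Γ(V)`, where `V` is regarded as a unitary operator from `K` onto `V K`, with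
the canonical identification of `Γ(ker V*) ⊗ Γ(V K)` with `Γ(ker V* ⊕ V K) = Γ(K)`. -/
def ccrUnitary (V : K →ₗᵢ[ℂ] K) : HTensor (Fock (kerAdj V)) (Fock K) ≃ₗᵢ[ℂ] Fock K :=
  gramUnitary (fun p : kerAdj V × K => htmul (expVec p.1) (expVec p.2))
    (fun p => expVec ((p.1 : K) + V p.2)) (htmul_total expVec_total expVec_total)
    (by
      have h : Set.range (fun p : kerAdj V × K => expVec ((p.1 : K) + V p.2))
          = Set.range expVec := by
        refine Set.Subset.antisymm (Set.range_subset_iff.2 fun p => ⟨_, rfl⟩) ?_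
        rintro _ ⟨u, rfl⟩
        exact ⟨(kerPart V u, _), congrArg expVec (kerPart_add V u)⟩
      rw [h, expVec_total])
    (fun p q => by
      rw [inner_htmul, inner_expVec, inner_expVec, inner_expVec, inner_kerAdj_add, Complex.exp_add])

theorem ccrUnitary_apply (V : K →ₗᵢ[ℂ] K) (a : kerAdj V) (v : K) :
    ccrUnitary V (htmul (expVec a) (expVec v)) = expVec ((a : K) + V v) :=
  gramUnitary_apply _ _ _ _ _ (a, v)

/-- The endomorphism `T ↦ 1_{Γ(ker V*)} ⊗ Γ(V) T Γ(V)*` of `B(Γ(K))`. -/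
def ccrEnd (V : K →ₗᵢ[ℂ] K) : (Fock K →L[ℂ] Fock K) →⋆ₐ[ℂ] (Fock K →L[ℂ] Fock K) :=
  ampliationConj (ccrUnitary V)

theorem ccrEnd_apply (V : K →ₗᵢ[ℂ] K) (T : Fock K →L[ℂ] Fock K) (a : kerAdj V) (v : K) :
    ccrEnd V T (expVec ((a : K) + V v)) = ccrUnitary V (htmul (expVec a) (T (expVec v))) := by
  rw [← ccrUnitary_apply]
  change ccrUnitary V (oneTensor _ T ((ccrUnitary V).symm _)) = _
  rw [LinearIsometryEquiv.symm_apply_apply, oneTensor_htmul]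

theorem inner_ccrEnd (V : K →ₗᵢ[ℂ] K) (T : Fock K →L[ℂ] Fock K) (u w : K) :
    ⟪expVec u, ccrEnd V T (expVec w)⟫_ℂ =
      Complex.exp (⟪u, w⟫_ℂ - ⟪ContinuousLinearMap.adjoint V.toContinuousLinearMap u,
        ContinuousLinearMap.adjoint V.toContinuousLinearMap w⟫_ℂ) *
      ⟪expVec (ContinuousLinearMap.adjoint V.toContinuousLinearMap u),
        T (expVec (ContinuousLinearMap.adjoint V.toContinuousLinearMap w))⟫_ℂ := by
  conv_lhs => rw [← kerPart_add V u, ← kerPart_add V w]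
  rw [ccrEnd_apply, ← ccrUnitary_apply, (ccrUnitary V).inner_map_map, inner_htmul,
    inner_expVec]
  congr 2
  rw [eq_sub_iff_add_eq, ← inner_kerAdj_add, kerPart_add, kerPart_add]

theorem fock_op_ext {S T : Fock K →L[ℂ] Fock K}
    (h : ∀ u w : K, ⟪expVec u, S (expVec w)⟫_ℂ = ⟪expVec u, T (expVec w)⟫_ℂ) : S = T := by
  have hd : Dense (Submodule.span ℂ (Set.range (expVec : K → Fock K)) : Set (Fock K)) :=
    Submodule.dense_iff_topologicalClosure_eq_top.2 expVec_total
  refine ContinuousLinearMap.ext_on hd ?_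
  rintro _ ⟨w, rfl⟩
  refine ext_inner_left ℂ fun z => ?_
  have : (innerSL ℂ (S (expVec w)) : Fock K →L[ℂ] ℂ) = innerSL ℂ (T (expVec w)) := by
    refine ContinuousLinearMap.ext_on hd ?_
    rintro _ ⟨u, rfl⟩
    simp only [innerSL_apply_apply]
    rw [← inner_conj_symm, h, inner_conj_symm]
  rw [← inner_conj_symm, ← innerSL_apply_apply, this, innerSL_apply_apply, inner_conj_symm]

theorem isNormalFunctional_ccrEnd (V : K →ₗᵢ[ℂ] K) {φ : (Fock K →L[ℂ] Fock K) → ℂ}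
    (hφ : IsNormalFunctional φ) : IsNormalFunctional fun T => φ (ccrEnd V T) :=
  isNormalFunctional_ampliation (isNormalFunctional_conj hφ (ccrUnitary V))

theorem ccrEnd_comp {V V' V'' : K →ₗᵢ[ℂ] K} (h : ∀ ξ, V'' ξ = V (V' ξ))
    (T : Fock K →L[ℂ] Fock K) : ccrEnd V'' T = ccrEnd V (ccrEnd V' T) := by
  have hadj : ∀ ξ, ContinuousLinearMap.adjoint V''.toContinuousLinearMap ξ
      = ContinuousLinearMap.adjoint V'.toContinuousLinearMap
        (ContinuousLinearMap.adjoint V.toContinuousLinearMap ξ) := by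
    intro ξ
    refine ext_inner_left ℂ fun w => ?_
    rw [ContinuousLinearMap.adjoint_inner_right, ContinuousLinearMap.adjoint_inner_right,
      ContinuousLinearMap.adjoint_inner_right]
    exact congrArg (fun z => ⟪z, ξ⟫_ℂ) (h w)
  refine fock_op_ext fun u w => ?_
  rw [inner_ccrEnd, inner_ccrEnd, inner_ccrEnd, ← mul_assoc, ← Complex.exp_add, hadj, hadj]
  congr 2
  ring

theorem ccrEnd_id {V : K →ₗᵢ[ℂ] K} (h : ∀ ξ, V ξ = ξ)
    (T : Fock K →L[ℂ] Fock K) : ccrEnd V T = T := by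
  have hadj : ∀ ξ, ContinuousLinearMap.adjoint V.toContinuousLinearMap ξ = ξ := by
    intro ξ
    conv_lhs => rw [← h ξ]
    exact adjoint_apply_self V ξ
  refine fock_op_ext fun u w => ?_
  rw [inner_ccrEnd, hadj, hadj, sub_self, Complex.exp_zero, one_mul]

theorem IsometricRep.zero_apply (V : IsometricRep P K) (ξ : K) : V 0 ξ = ξ :=
  (V 0).injective (by rw [← V.map_add, add_zero])

theorem continuous_inner_ccrEnd (V : IsometricRep P K) (hV : V.StrictlyContinuous)
    (T : Fock K →L[ℂ] Fock K) (ξ η : Fock K) :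
    Continuous fun x => ⟪ξ, ccrEnd (V x) T η⟫_ℂ := by
  have hb : ∀ (S : Fock K →L[ℂ] Fock K) (η : Fock K) (x : P),
      ‖ccrEnd (V x) S η‖ ≤ ‖S‖ * ‖η‖ := fun S η x =>
    ((ccrEnd (V x) S).le_opNorm η).trans (by
      gcongr
      exact NonUnitalStarAlgHom.norm_apply_le (ccrEnd (V x)) S)
  have h0 : ∀ (S : Fock K →L[ℂ] Fock K) (u w : K),
      Continuous fun x => ⟪expVec u, ccrEnd (V x) S (expVec w)⟫_ℂ := by
    intro S u w
    simp only [inner_ccrEnd]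
    have h1 := hV u
    have h2 := hV w
    have h3 := continuous_expVec.comp h1
    have h4 := continuous_expVec.comp h2
    simp only [Function.comp_def] at h3 h4
    fun_prop
  have h1 : ∀ (S : Fock K →L[ℂ] Fock K) (ξ : Fock K) (w : K),
      Continuous fun x => ⟪ξ, ccrEnd (V x) S (expVec w)⟫_ℂ := fun S ξ w =>
    continuous_inner_of_total expVec_total (hb S (expVec w)) (fun u => h0 S u w) ξ
  have h2 : ∀ w : K, Continuous fun x => ⟪expVec w, ccrEnd (V x) T η⟫_ℂ := by
    intro w
    have h3 := Complex.continuous_conj.comp (h1 (star T) η w)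
    refine h3.congr fun x => ?_
    rw [Function.comp, inner_conj_symm, map_star, ContinuousLinearMap.star_eq_adjoint,
      ContinuousLinearMap.adjoint_inner_left]
  exact continuous_inner_of_total expVec_total (hb T η) h2 ξ

/-- The CCR flow `α^V` of a strictly continuous isometric representation `V`, where
`α^V x (T) = 1_{Γ(ker (V x)*)} ⊗ Γ(V x) T Γ(V x)*`. -/
def ccrFlow (V : IsometricRep P K) (hV : V.StrictlyContinuous) : E0Semigroup P (Fock K) where
  toFun x := ccrEnd (V x)
  normal x _ hφ := isNormalFunctional_ccrEnd (V x) hφ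
  map_zero := ccrEnd_id V.zero_apply
  map_add x y := ccrEnd_comp (V.map_add x y)
  continuous φ hφ T := by
    obtain ⟨ξ, η, hξ, hη, h⟩ := hφ
    simp only [h]
    refine continuous_tsum (fun n => continuous_inner_ccrEnd V hV T (ξ n) (η n))
      (summable_norm_inner hξ hη ‖T‖) fun n x => ?_
    calc ‖⟪ξ n, ccrEnd (V x) T (η n)⟫_ℂ‖ ≤ ‖ξ n‖ * ‖ccrEnd (V x) T (η n)‖ :=
          norm_inner_le_norm _ _
      _ ≤ ‖ξ n‖ * (‖T‖ * ‖η n‖) := by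
        gcongr
        refine ((ccrEnd (V x) T).le_opNorm _).trans ?_
        gcongr
        exact NonUnitalStarAlgHom.norm_apply_le (ccrEnd (V x)) T
      _ = ‖T‖ * (‖ξ n‖ * ‖η n‖) := by ring

/-- `W` is the Weyl operator `W(u)`. -/
def IsWeyl (u : K) (W : Fock K →L[ℂ] Fock K) : Prop :=
  ∀ v : K, W (expVec v) = Complex.exp (-((‖u‖ : ℂ) ^ 2 / 2) - ⟪u, v⟫_ℂ) • expVec (u + v)

/-- The CCR flow satisfies `α^V x (W(u)) = W(V x u)`. -/
theorem ccrFlow_weyl (V : IsometricRep P K) (hV : V.StrictlyContinuous) (x : P) {u : K}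
    {W : Fock K →L[ℂ] Fock K} (hW : IsWeyl u W) : IsWeyl (V x u) (ccrFlow V hV x W) := by
  intro v
  change ccrEnd (V x) W (expVec v) = _
  conv_lhs => rw [← kerPart_add (V x) v]
  rw [ccrEnd_apply, hW, htmul_smul, (ccrUnitary (V x)).map_smul, ccrUnitary_apply,
    (V x).norm_map, (V x).map_add, add_left_comm, kerPart_add,
    ContinuousLinearMap.adjoint_inner_right]
  rfl

end CCR

section Shift

/-- The point of the plane given by an element of the cone `ℝ₊²`. -/
def toPlane (x : ℝ≥0 × ℝ≥0) : ℝ × ℝ := (x.1, x.2)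

theorem toPlane_add (x y : ℝ≥0 × ℝ≥0) : toPlane (x + y) = toPlane x + toPlane y := by
  simp [toPlane]

theorem continuous_toPlane : Continuous toPlane := by
  unfold toPlane
  fun_prop

/-- An `ℝ₊²`-module: a nonempty closed subset `A` of the plane with `A + ℝ₊² ⊆ A`. -/
structure PlaneModule where
  carrier : Set (ℝ × ℝ)
  nonempty : carrier.Nonempty
  isClosed : IsClosed carrier
  add_mem : ∀ y ∈ carrier, ∀ x : ℝ≥0 × ℝ≥0, y + toPlane x ∈ carrier

variable (A : PlaneModule) (k : Type u) [NormedAddCommGroup k] [InnerProductSpace ℂ k]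

/-- The Hilbert space `L²(A, k)`, with respect to the Lebesgue measure. -/
abbrev PlaneModule.L2 : Type u := Lp k 2 (volume.restrict A.carrier)

variable {A k}

/-- The function `y ↦ f (y - x)` if `y - x ∈ A`, and `0` otherwise. -/
def shiftFun (A : PlaneModule) (x : ℝ≥0 × ℝ≥0) (f : ℝ × ℝ → k) (y : ℝ × ℝ) : k :=
  open scoped Classical in if y - toPlane x ∈ A.carrier then f (y - toPlane x) else 0

theorem shiftFun_eq (x : ℝ≥0 × ℝ≥0) (f : ℝ × ℝ → k) :
    shiftFun A x f = (A.carrier.indicator f) ∘ fun y => y - toPlane x := by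
  classical
  ext y
  simp [shiftFun, Set.indicator_apply]

theorem indicator_shiftFun (x : ℝ≥0 × ℝ≥0) (f : ℝ × ℝ → k) :
    A.carrier.indicator (shiftFun A x f) = shiftFun A x f := by
  refine Set.indicator_eq_self.2 fun y hy => ?_
  by_contra h
  refine hy ?_
  rw [shiftFun, if_neg]
  intro h2
  exact h (by simpa using A.add_mem _ h2 x)

theorem measurePreserving_sub (x : ℝ × ℝ) :
    MeasurePreserving (fun y : ℝ × ℝ => y - x) volume volume :=
  measurePreserving_sub_right volume x

/-- Extension by zero from `L²(A, k)` to `L²(ℝ², k)`. -/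
def extendZero (A : PlaneModule) (f : A.L2 k) : Lp k 2 (volume : Measure (ℝ × ℝ)) :=
  ((memLp_indicator_iff_restrict A.isClosed.measurableSet).2 (Lp.memLp f)).toLp _

theorem coeFn_extendZero (f : A.L2 k) : extendZero A f =ᵐ[volume] A.carrier.indicator f :=
  MemLp.coeFn_toLp _

theorem norm_extendZero (f : A.L2 k) : ‖extendZero A f‖ = ‖f‖ := by
  rw [extendZero, Lp.norm_toLp, Lp.norm_def,
    eLpNorm_indicator_eq_eLpNorm_restrict A.isClosed.measurableSet]

theorem memLp_shiftFun (x : ℝ≥0 × ℝ≥0) (f : A.L2 k) :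
    MemLp (shiftFun A x f) 2 (volume.restrict A.carrier) := by
  rw [← memLp_indicator_iff_restrict A.isClosed.measurableSet, indicator_shiftFun, shiftFun_eq]
  exact ((memLp_indicator_iff_restrict A.isClosed.measurableSet).2
    (Lp.memLp f)).comp_measurePreserving (measurePreserving_sub _)

theorem extendZero_shift (x : ℝ≥0 × ℝ≥0) (f : A.L2 k) :
    extendZero A ((memLp_shiftFun x f).toLp _) =
      Lp.compMeasurePreserving (fun y => y - toPlane x) (measurePreserving_sub _)
        (extendZero A f) := by
  apply Lp.ext
  have h1 : A.carrier.indicator ((memLp_shiftFun x f).toLp _) =ᵐ[volume]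
      A.carrier.indicator (shiftFun A x f) :=
    (ae_eq_restrict_iff_indicator_ae_eq A.isClosed.measurableSet).1 (MemLp.coeFn_toLp _)
  have h2 := (measurePreserving_sub (toPlane x)).quasiMeasurePreserving.ae_eq_comp
    (coeFn_extendZero f)
  refine (coeFn_extendZero _).trans (h1.trans ?_)
  rw [indicator_shiftFun, shiftFun_eq]
  exact h2.symm.trans (Lp.coeFn_compMeasurePreserving _ _).symm

theorem extendZero_add (f g : A.L2 k) : extendZero A (f + g) = extendZero A f + extendZero A g := by
  apply Lp.ext
  have h1 : A.carrier.indicator (f + g : A.L2 k) =ᵐ[volume] A.carrier.indicator (f + g) :=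
    (ae_eq_restrict_iff_indicator_ae_eq A.isClosed.measurableSet).1 (Lp.coeFn_add f g)
  refine (coeFn_extendZero _).trans (h1.trans ?_)
  rw [Set.indicator_add']
  exact (((coeFn_extendZero f).add (coeFn_extendZero g)).symm).trans (Lp.coeFn_add _ _).symm

theorem extendZero_smul (c : ℂ) (f : A.L2 k) : extendZero A (c • f) = c • extendZero A f := by
  apply Lp.ext
  have h1 : A.carrier.indicator (c • f : A.L2 k) =ᵐ[volume] A.carrier.indicator (c • ⇑f) :=
    (ae_eq_restrict_iff_indicator_ae_eq A.isClosed.measurableSet).1 (Lp.coeFn_smul c f)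
  refine (coeFn_extendZero _).trans (h1.trans ?_)
  refine Filter.EventuallyEq.trans ?_ (Lp.coeFn_smul _ _).symm
  filter_upwards [coeFn_extendZero f] with y hy
  rw [Pi.smul_apply, hy]
  exact Set.indicator_const_smul_apply A.carrier c f y

variable (A k) in
/-- Extension by zero as a linear isometry. -/
def extendZeroₗᵢ : A.L2 k →ₗᵢ[ℂ] Lp k 2 (volume : Measure (ℝ × ℝ)) where
  toFun := extendZero A
  map_add' := extendZero_add
  map_smul' := extendZero_smul
  norm_map' := norm_extendZero

variable (k) in
/-- Translation by `x` on `L²(ℝ², k)`. -/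
def planeTranslate (x : ℝ × ℝ) :
    Lp k 2 (volume : Measure (ℝ × ℝ)) →ₗᵢ[ℂ] Lp k 2 (volume : Measure (ℝ × ℝ)) :=
  Lp.compMeasurePreservingₗᵢ ℂ (fun y => y - x) (measurePreserving_sub x)

theorem continuous_planeTranslate (f : Lp k 2 (volume : Measure (ℝ × ℝ))) :
    Continuous fun x => planeTranslate k x f := by
  have hg : Continuous fun x : ℝ × ℝ => (⟨fun y => y - x, by fun_prop⟩ : C(ℝ × ℝ, ℝ × ℝ)) :=
    ContinuousMap.continuous_of_continuous_uncurry _ (by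
      change Continuous fun p : (ℝ × ℝ) × (ℝ × ℝ) => p.2 - p.1
      fun_prop)
  exact Continuous.compMeasurePreservingLp (continuous_const (y := f)) hg
    (fun x => measurePreserving_sub x) (by simp)

theorem planeTranslate_add (x y : ℝ × ℝ) (f : Lp k 2 (volume : Measure (ℝ × ℝ))) :
    planeTranslate k (x + y) f = planeTranslate k x (planeTranslate k y f) := by
  apply Lp.ext
  have h1 := (measurePreserving_sub x).quasiMeasurePreserving.ae_eq_comp
    (Lp.coeFn_compMeasurePreserving f (measurePreserving_sub y))
  refine (Lp.coeFn_compMeasurePreserving f (measurePreserving_sub (x + y))).trans ?_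
  refine Filter.EventuallyEq.trans ?_ (h1.symm.trans
    (Lp.coeFn_compMeasurePreserving _ (measurePreserving_sub x)).symm)
  refine Filter.Eventually.of_forall fun z => ?_
  simp [sub_sub]

theorem planeTranslate_zero (f : Lp k 2 (volume : Measure (ℝ × ℝ))) : planeTranslate k 0 f = f := by
  apply Lp.ext
  refine (Lp.coeFn_compMeasurePreserving f (measurePreserving_sub 0)).trans ?_
  refine Filter.Eventually.of_forall fun z => ?_
  simp

variable (A k) in
/-- The shift operator on `L²(A, k)`, with `(S f)(y) = f (y - x)` if `y - x ∈ A`, and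
`(S f)(y) = 0` otherwise. -/
def shift (x : ℝ≥0 × ℝ≥0) : A.L2 k →ₗᵢ[ℂ] A.L2 k where
  toFun f := (memLp_shiftFun x f).toLp _
  map_add' f g := (extendZeroₗᵢ A k).injective (by
    rw [map_add]
    change extendZero A _ = extendZero A _ + extendZero A _
    rw [extendZero_shift, extendZero_shift, extendZero_shift, extendZero_add, map_add])
  map_smul' c f := (extendZeroₗᵢ A k).injective (by
    rw [map_smul]
    change extendZero A _ = c • extendZero A _
    rw [extendZero_shift, extendZero_shift, extendZero_smul]
    exact (planeTranslate k (toPlane x)).map_smul c _)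
  norm_map' f := by
    change ‖(memLp_shiftFun x f).toLp _‖ = ‖f‖
    rw [← norm_extendZero, extendZero_shift, Lp.norm_compMeasurePreserving, norm_extendZero]

theorem extendZeroₗᵢ_shift (x : ℝ≥0 × ℝ≥0) (f : A.L2 k) :
    extendZeroₗᵢ A k (shift A k x f) = planeTranslate k (toPlane x) (extendZeroₗᵢ A k f) :=
  extendZero_shift x f

variable (A k) in
/-- The isometric representation of `ℝ₊²` on `L²(A, k)` associated to the `ℝ₊²`-module `A`. -/
def shiftRep : IsometricRep (ℝ≥0 × ℝ≥0) (A.L2 k) where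
  toFun := shift A k
  map_add x y f := (extendZeroₗᵢ A k).injective (by
    rw [extendZeroₗᵢ_shift, extendZeroₗᵢ_shift, extendZeroₗᵢ_shift, toPlane_add, planeTranslate_add])
  continuous f := by
    rw [(extendZeroₗᵢ A k).isometry.isEmbedding.isInducing.continuous_iff]
    refine ((continuous_planeTranslate (extendZeroₗᵢ A k f)).comp continuous_toPlane).congr fun x => ?_
    exact (extendZeroₗᵢ_shift x f).symm

theorem inner_planeTranslate (x : ℝ × ℝ) (f g : Lp k 2 (volume : Measure (ℝ × ℝ))) :
    ⟪planeTranslate k x f, g⟫_ℂ = ⟪f, planeTranslate k (-x) g⟫_ℂ := by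
  rw [← (planeTranslate k (-x)).inner_map_map, ← planeTranslate_add, neg_add_cancel, planeTranslate_zero]

theorem shiftRep_strictlyContinuous [CompleteSpace k] :
    (shiftRep A k).StrictlyContinuous := by
  intro f
  have h : ∀ x, ContinuousLinearMap.adjoint (shiftRep A k x).toContinuousLinearMap f =
      ContinuousLinearMap.adjoint (extendZeroₗᵢ A k).toContinuousLinearMap
        (planeTranslate k (-toPlane x) (extendZeroₗᵢ A k f)) := by
    intro x
    refine ext_inner_left ℂ fun g => ?_
    rw [ContinuousLinearMap.adjoint_inner_right, ContinuousLinearMap.adjoint_inner_right]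
    change ⟪shift A k x g, f⟫_ℂ = ⟪extendZeroₗᵢ A k g, _⟫_ℂ
    rw [← inner_planeTranslate, ← extendZeroₗᵢ_shift, (extendZeroₗᵢ A k).inner_map_map]
  simp only [h]
  exact (ContinuousLinearMap.continuous _).comp
    ((continuous_planeTranslate _).comp continuous_toPlane.neg)

/-- The `ℝ₊²`-module `[1, ∞) × [a, 0) ∪ [0, ∞) × [0, ∞)`. -/
def stepModule (a : ℝ) : PlaneModule where
  carrier := Set.Ici 1 ×ˢ Set.Ico a 0 ∪ Set.Ici 0 ×ˢ Set.Ici 0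
  nonempty := ⟨(0, 0), Or.inr (by simp)⟩
  isClosed := by
    have h : (Set.Ici (1 : ℝ) ×ˢ Set.Ico a 0 ∪ Set.Ici (0 : ℝ) ×ˢ Set.Ici (0 : ℝ))
        = Set.Ici (1 : ℝ) ×ˢ Set.Ici a ∪ Set.Ici (0 : ℝ) ×ˢ Set.Ici (0 : ℝ) := by
      ext ⟨p, q⟩
      simp only [Set.mem_union, Set.mem_prod, Set.mem_Ici, Set.mem_Ico]
      constructor
      · rintro (h | h)
        · exact Or.inl ⟨h.1, h.2.1⟩
        · exact Or.inr h
      · rintro (h | h)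
        · by_cases hq : q < 0
          · exact Or.inl ⟨h.1, h.2, hq⟩
          · exact Or.inr ⟨by linarith [h.1], by linarith⟩
        · exact Or.inr h
    rw [h]
    exact (isClosed_Ici.prod isClosed_Ici).union (isClosed_Ici.prod isClosed_Ici)
  add_mem := by
    rintro ⟨p, q⟩ h ⟨x, y⟩
    have hx := x.2
    have hy := y.2
    simp only [toPlane, Prod.mk_add_mk, Set.mem_union, Set.mem_prod, Set.mem_Ici, Set.mem_Ico] at h ⊢
    by_cases hq : q + y < 0
    · rcases h with h | h
      · exact Or.inl ⟨by linarith [h.1, x.coe_nonneg], by linarith [h.2.1, y.coe_nonneg], hq⟩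
      · exact absurd hq (by linarith [h.2, y.coe_nonneg])
    · rcases h with h | h
      · exact Or.inr ⟨by linarith [h.1, x.coe_nonneg], by linarith⟩
      · exact Or.inr ⟨by linarith [h.1, x.coe_nonneg], by linarith⟩

variable (k) in
/-- The dimension of a separable Hilbert space, in `ℕ ∪ {∞}`. -/
def hilbertDim : ℕ∞ := Cardinal.toENat (Module.rank ℂ k)

variable (k) in
/-- The isometric representation of `ℝ₊²` on `L²(A, k)` for
`A = [1, ∞) × [a, 0) ∪ [0, ∞) × [0, ∞)`, of multiplicity `dim k`. -/
def stepRep (a : ℝ) : IsometricRep (ℝ≥0 × ℝ≥0) ((stepModule a).L2 k) :=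
  shiftRep (stepModule a) k

variable (k) in
/-- The CCR flow of the representation `stepRep k a`. -/
def stepFlow [CompleteSpace k] (a : ℝ) :
    E0Semigroup (ℝ≥0 × ℝ≥0) (Fock ((stepModule a).L2 k)) :=
  ccrFlow (stepRep k a) shiftRep_strictlyContinuous

end Shift

end

/-!
The hard implication is that cocycle conjugate flows have the same depth `a` and the same
multiplicity. It goes through the product system of the flow, whose fibre at `x` consists of the
intertwiners `S` with `α x (T) S = S T`. By `IsIntertwiner.inner_expVec`, this fibre is
`Γ(ker (V x)*)`, realized as the operators `ψ ⊗ Γ(V x)`. A cocycle conjugacy `(U, W)` induces the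
isomorphism of product systems `S ↦ (W x)* U S U*` (`exists_isProductSystemMap`).

Such an isomorphism carries the vacuum unit `x ↦ Γ(V x)` to a unit of the second flow. The degree
one components of a unit form an additive cocycle of the representation, and the representations in
question have no additive cocycle but `0` (`stepRep_noAdditiveCocycle`). Now divide the segment from
`0` to `x` into `m` equal parts. The expectation of a unit in an exponential vector is a product of
`m` terms; without components of degree one, these terms differ from one by quantities of the second
order, and their product tends to one. Hence the vacuum unit is, up to a character, the only unit,
and is preserved (`IsCCRUnit.eq_smul_secondQuant`). Consequently the image of a vector of degree one
is, after division by the character, additive along such a partition, and the same estimate shows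
that it has degree one again (`IsProductSystemMap.inner_expRem_oneImage`). The one-particle spaces
`ker (V x)*` are therefore mapped isometrically and compatibly in `x`. As `V` is pure, the limit for
large `x` is an isometry of `L²(A, k₁)` into `L²(A', k₂)`, which intertwines the shifts and their
adjoints (`exists_intertwining_isometry`).

It remains to recognize `a` and `dim k` in the representation. A vector of `ker V(1,0)*` which some
vertical shift moves into the range of `V(1,0)` is supported in `[1, 2) × [a, 0)`, and the shift by
`-a` is the least one that suffices for all of them; this determines `a` (`not_lt_of_intertwining`).
The range projections of the shifts are the multiplications by the indicator functions of the sets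
`A + x`. An isometry that intertwines them preserves inner products in `k` pointwise, since
translated quadrants are intersections of such sets (`inner_ae_eq_of_intertwining`), so that an
orthonormal family in `k₁` yields one of the same size in `k₂`, and conversely by symmetry.

The other implications are formal: a unitary operator `k₁ → k₂` acts on the values of functions, and
a conjugacy `U` of representations induces the conjugacy `Γ(U)` of flows.
-/

/-! ### One-particle vectors and exponential vectors -/

local notation "adj(" V ")" => ContinuousLinearMap.adjoint (LinearIsometry.toContinuousLinearMap V)

section FockVectors

variable {K : Type u} [NormedAddCommGroup K] [InnerProductSpace ℂ K]

theorem fock_ext {x y : Fock K} (h : ∀ u : K, ⟪expVec u, x⟫_ℂ = ⟪expVec u, y⟫_ℂ) : x = y := by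
  have hd : Dense (Submodule.span ℂ (Set.range (expVec : K → Fock K)) : Set (Fock K)) :=
    Submodule.dense_iff_topologicalClosure_eq_top.2 expVec_total
  have : (innerSL ℂ x : Fock K →L[ℂ] ℂ) = innerSL ℂ y := by
    refine ContinuousLinearMap.ext_on hd ?_
    rintro _ ⟨u, rfl⟩
    simp only [innerSL_apply_apply]
    rw [← inner_conj_symm, h, inner_conj_symm]
  refine ext_inner_right ℂ fun z => ?_
  exact congrArg (fun f : Fock K →L[ℂ] ℂ => f z) this

/-- Two bounded linear functionals on Fock space that agree on exponential vectors are equal. -/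
theorem fock_functional_ext {E : Type*} [NormedAddCommGroup E] [NormedSpace ℂ E]
    {f g : Fock K →L[ℂ] E} (h : ∀ u : K, f (expVec u) = g (expVec u)) : f = g := by
  have hd : Dense (Submodule.span ℂ (Set.range (expVec : K → Fock K)) : Set (Fock K)) :=
    Submodule.dense_iff_topologicalClosure_eq_top.2 expVec_total
  refine ContinuousLinearMap.ext_on hd ?_
  rintro _ ⟨u, rfl⟩
  exact h u

/-- The vector `u`, regarded as an element of the summand of degree one of `Γ(K)`. -/
noncomputable def oneParticleVec (u : K) : Fock K :=
  show lp (fun n => SymPow K n) 2 from lp.single 2 1 (symTpow u 1)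

theorem inner_oneParticleVec_expVec (u v : K) : ⟪oneParticleVec u, expVec v⟫_ℂ = ⟪u, v⟫_ℂ := by
  have h := lp.inner_single_left (𝕜 := ℂ) (G := fun n => SymPow K n) 1 (symTpow u 1) (expVec v)
  refine h.trans ?_
  change ⟪symTpow u 1, ((√((1 : ℕ).factorial : ℝ) : ℝ) : ℂ)⁻¹ • symTpow v 1⟫_ℂ = _
  rw [inner_smul_right (symTpow u 1), inner_symTpow]
  simp

theorem inner_oneParticleVec (u v : K) : ⟪oneParticleVec u, oneParticleVec v⟫_ℂ = ⟪u, v⟫_ℂ := by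
  have h := lp.inner_single_left (𝕜 := ℂ) (G := fun n => SymPow K n) 1 (symTpow u 1)
    (oneParticleVec v)
  refine h.trans ?_
  have h2 : (lp.single (E := fun n => SymPow K n) 2 1 (symTpow v 1)) 1 = symTpow v 1 :=
    lp.single_apply_self (E := fun n => SymPow K n) 2 1 (symTpow v 1)
  change ⟪symTpow u 1, (lp.single (E := fun n => SymPow K n) 2 1 (symTpow v 1)) 1⟫_ℂ = _
  rw [h2, inner_symTpow, pow_one]

theorem inner_expVec_oneParticleVec (u v : K) : ⟪expVec u, oneParticleVec v⟫_ℂ = ⟪u, v⟫_ℂ := by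
  rw [← inner_conj_symm, inner_oneParticleVec_expVec, inner_conj_symm]

variable (K) in
/-- The embedding of `K` into `Γ(K)` as the summand of degree one. -/
noncomputable def oneParticle : K →ₗᵢ[ℂ] Fock K where
  toFun := oneParticleVec
  map_add' u v := fock_ext fun w => by
    simp only [inner_add_right, inner_expVec_oneParticleVec]
  map_smul' c u := fock_ext fun w => by
    simp only [inner_smul_right, inner_expVec_oneParticleVec, RingHom.id_apply]
  norm_map' u := by
    change ‖oneParticleVec u‖ = ‖u‖
    rw [@norm_eq_sqrt_re_inner ℂ, inner_oneParticleVec, ← @norm_eq_sqrt_re_inner ℂ]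

theorem inner_expVec_oneParticle (u v : K) : ⟪expVec u, oneParticle K v⟫_ℂ = ⟪u, v⟫_ℂ :=
  inner_expVec_oneParticleVec u v

theorem inner_oneParticle_expVec (u v : K) : ⟪oneParticle K u, expVec v⟫_ℂ = ⟪u, v⟫_ℂ :=
  inner_oneParticleVec_expVec u v

/-- The part of degree at least two of the exponential vector `e(u)`. -/
noncomputable def expRem (u : K) : Fock K := expVec u - expVec 0 - oneParticle K u

theorem inner_expVec_zero_left (u : K) : ⟪expVec 0, expVec u⟫_ℂ = 1 := by
  rw [inner_expVec, inner_zero_left, Complex.exp_zero]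

theorem inner_expVec_zero_right (u : K) : ⟪expVec u, expVec 0⟫_ℂ = 1 := by
  rw [inner_expVec, inner_zero_right, Complex.exp_zero]

theorem norm_expVec_zero : ‖expVec (0 : K)‖ = 1 := by
  rw [@norm_eq_sqrt_re_inner ℂ, inner_expVec_zero_left]
  simp

theorem inner_expRem_expVec_zero (u : K) : ⟪expRem u, expVec 0⟫_ℂ = 0 := by
  rw [expRem, inner_sub_left, inner_sub_left, inner_expVec_zero_right, inner_expVec_zero_right,
    inner_oneParticle_expVec, inner_zero_right, sub_self, sub_zero]

theorem inner_expRem_oneParticle (u v : K) : ⟪expRem u, oneParticle K v⟫_ℂ = 0 := by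
  rw [expRem, inner_sub_left, inner_sub_left, inner_expVec_oneParticle, inner_expVec_oneParticle,
    inner_zero_left, sub_zero, LinearIsometry.inner_map_map, sub_self]

theorem norm_expRem_sq (u : K) : ‖expRem u‖ ^ 2 = Real.exp (‖u‖ ^ 2) - 1 - ‖u‖ ^ 2 := by
  have h : ⟪expRem u, expRem u⟫_ℂ = Complex.exp (‖u‖ ^ 2 : ℝ) - 1 - (‖u‖ ^ 2 : ℝ) := by
    change ⟪expRem u, expVec u - expVec 0 - oneParticle K u⟫_ℂ = _
    rw [inner_sub_right, inner_sub_right, inner_expRem_expVec_zero, inner_expRem_oneParticle,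
      sub_zero, sub_zero, expRem, inner_sub_left, inner_sub_left, inner_expVec, inner_expVec_zero_left,
      inner_oneParticle_expVec, inner_self_eq_norm_sq_to_K]
    push_cast
    rfl
  rw [inner_self_eq_norm_sq_to_K] at h
  refine Complex.ofReal_injective ?_
  push_cast at h ⊢
  exact h

theorem norm_expRem_le {u : K} {C : ℝ} (hu : ‖u‖ ≤ C) :
    ‖expRem u‖ ≤ Real.exp (C ^ 2) * ‖u‖ ^ 2 := by
  have h0 : ∀ s : ℝ, 0 ≤ s → Real.exp s - 1 - s ≤ (Real.exp s * s) ^ 2 := by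
    intro s hs
    have h1 : 1 - s ≤ Real.exp (-s) := by linarith [Real.add_one_le_exp (-s)]
    have h2 : Real.exp s * Real.exp (-s) = 1 := by rw [← Real.exp_add]; simp
    have h3 : 1 ≤ Real.exp s := Real.one_le_exp hs
    have h4 : Real.exp s * (1 - s) ≤ 1 :=
      (mul_le_mul_of_nonneg_left h1 (by positivity)).trans_eq h2
    have h5 : Real.exp s * s ^ 2 ≤ (Real.exp s) ^ 2 * s ^ 2 := by
      gcongr
      nlinarith
    nlinarith
  have h1 : ‖expRem u‖ ≤ Real.exp (‖u‖ ^ 2) * ‖u‖ ^ 2 := by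
    refine le_of_sq_le_sq ?_ (by positivity)
    rw [norm_expRem_sq]
    exact h0 _ (by positivity)
  refine h1.trans ?_
  gcongr

end FockVectors

/-! ### Intertwiners of the endomorphisms of a CCR flow -/

section Intertwiner

variable {K : Type u} [NormedAddCommGroup K] [InnerProductSpace ℂ K] [CompleteSpace K]

theorem inner_kerPart (V : K →ₗᵢ[ℂ] K) (u w : K) :
    ⟪(kerPart V u : K), w⟫_ℂ = ⟪u, w⟫_ℂ - ⟪adj(V) u, adj(V) w⟫_ℂ := by
  change ⟪u - V (adj(V) u), w⟫_ℂ = _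
  rw [inner_sub_left, ContinuousLinearMap.adjoint_inner_right]
  rfl

theorem inner_kerPart_right (V : K →ₗᵢ[ℂ] K) (u w : K) :
    ⟪u, (kerPart V w : K)⟫_ℂ = ⟪u, w⟫_ℂ - ⟪adj(V) u, adj(V) w⟫_ℂ := by
  rw [← inner_conj_symm, inner_kerPart, map_sub, inner_conj_symm, inner_conj_symm]

theorem adj_kerAdj {V : K →ₗᵢ[ℂ] K} (u : kerAdj V) : adj(V) (u : K) = 0 := u.2

theorem kerPart_coe {V : K →ₗᵢ[ℂ] K} (u : kerAdj V) : kerPart V (u : K) = u := by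
  apply Subtype.ext
  change (u : K) - V (adj(V) u) = u
  rw [adj_kerAdj, map_zero, sub_zero]

theorem norm_kerPart_sq (V : K →ₗᵢ[ℂ] K) (u : K) :
    ‖kerPart V u‖ ^ 2 = ‖u‖ ^ 2 - ‖adj(V) u‖ ^ 2 := by
  have h : ⟪(kerPart V u : K), (kerPart V u : K)⟫_ℂ = ⟪u, u⟫_ℂ - ⟪adj(V) u, adj(V) u⟫_ℂ := by
    rw [inner_kerPart_right V _ u, adj_kerAdj, inner_zero_left, sub_zero, inner_kerPart]
  rw [inner_self_eq_norm_sq_to_K, inner_self_eq_norm_sq_to_K, inner_self_eq_norm_sq_to_K] at h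
  rw [Submodule.coe_norm]
  exact_mod_cast h

theorem norm_kerPart_le (V : K →ₗᵢ[ℂ] K) (u : K) : ‖(kerPart V u : K)‖ ≤ ‖u‖ := by
  refine le_of_sq_le_sq ?_ (norm_nonneg _)
  have := norm_kerPart_sq V u
  rw [Submodule.coe_norm] at this
  rw [this]
  linarith [sq_nonneg ‖adj(V) u‖]

/-- Left multiplication by a vector `ψ` of `Γ(ker V*)`: the operator
`η ↦ ψ ⊗ Γ(V) η` on `Γ(K) = Γ(ker V*) ⊗ Γ(V K)`. -/
noncomputable def fockMul (V : K →ₗᵢ[ℂ] K) (ψ : Fock (kerAdj V)) : Fock K →L[ℂ] Fock K :=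
  (ccrUnitary V).toContinuousLinearEquiv.toContinuousLinearMap ∘L htmulLeft ψ

theorem fockMul_apply (V : K →ₗᵢ[ℂ] K) (ψ : Fock (kerAdj V)) (η : Fock K) :
    fockMul V ψ η = ccrUnitary V (htmul ψ η) := rfl

theorem inner_expVec_fockMul (V : K →ₗᵢ[ℂ] K) (ψ : Fock (kerAdj V)) (η : Fock K) (w : K) :
    ⟪expVec w, fockMul V ψ η⟫_ℂ = ⟪expVec (kerPart V w), ψ⟫_ℂ * ⟪expVec (adj(V) w), η⟫_ℂ := by
  conv_lhs => rw [← kerPart_add V w, ← ccrUnitary_apply]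
  rw [fockMul_apply, (ccrUnitary V).inner_map_map, inner_htmul]

theorem inner_fockMul (V : K →ₗᵢ[ℂ] K) (ψ φ : Fock (kerAdj V)) (η ζ : Fock K) :
    ⟪fockMul V ψ η, fockMul V φ ζ⟫_ℂ = ⟪ψ, φ⟫_ℂ * ⟪η, ζ⟫_ℂ := by
  rw [fockMul_apply, fockMul_apply, (ccrUnitary V).inner_map_map, inner_htmul]

/-- The isometry `Γ(V)` with `Γ(V) e(u) = e(V u)`. -/
noncomputable def secondQuant (V : K →ₗᵢ[ℂ] K) : Fock K →L[ℂ] Fock K := fockMul V (expVec 0)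

theorem inner_expVec_secondQuant (V : K →ₗᵢ[ℂ] K) (η : Fock K) (w : K) :
    ⟪expVec w, secondQuant V η⟫_ℂ = ⟪expVec (adj(V) w), η⟫_ℂ := by
  rw [secondQuant, inner_expVec_fockMul, inner_expVec_zero_right, one_mul]

theorem inner_secondQuant (V : K →ₗᵢ[ℂ] K) (η ζ : Fock K) :
    ⟪secondQuant V η, secondQuant V ζ⟫_ℂ = ⟪η, ζ⟫_ℂ := by
  rw [secondQuant, inner_fockMul, inner_expVec_zero_right, one_mul]

theorem norm_secondQuant (V : K →ₗᵢ[ℂ] K) (η : Fock K) : ‖secondQuant V η‖ = ‖η‖ := by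
  rw [@norm_eq_sqrt_re_inner ℂ, inner_secondQuant, ← @norm_eq_sqrt_re_inner ℂ]

theorem secondQuant_expVec (V : K →ₗᵢ[ℂ] K) (u : K) : secondQuant V (expVec u) = expVec (V u) :=
  fock_ext fun w => by
    rw [inner_expVec_secondQuant, inner_expVec, inner_expVec,
      ContinuousLinearMap.adjoint_inner_left]
    rfl

/-- `S` intertwines the identity representation of `B(Γ(K))` with the endomorphism induced by `V`;
the intertwiners are the fibre at `V` of the product system of a CCR flow. -/
def IsIntertwiner (V : K →ₗᵢ[ℂ] K) (S : Fock K →L[ℂ] Fock K) : Prop :=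
  ∀ T η, ccrEnd V T (S η) = S (T η)

theorem isIntertwiner_fockMul (V : K →ₗᵢ[ℂ] K) (ψ : Fock (kerAdj V)) :
    IsIntertwiner V (fockMul V ψ) := by
  intro T η
  change ccrUnitary V (oneTensor _ T ((ccrUnitary V).symm (ccrUnitary V (htmul ψ η)))) = _
  rw [LinearIsometryEquiv.symm_apply_apply, oneTensor_htmul]
  rfl

/-- An intertwiner is determined by the image of the vacuum vector, which is a vector of
`Γ(ker V*)`. -/
theorem IsIntertwiner.inner_expVec {V : K →ₗᵢ[ℂ] K} {S : Fock K →L[ℂ] Fock K}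
    (hS : IsIntertwiner V S) (u : K) (η : Fock K) :
    ⟪expVec u, S η⟫_ℂ = ⟪expVec (kerPart V u : K), S (expVec 0)⟫_ℂ * ⟪expVec (adj(V) u), η⟫_ℂ := by
  -- The rank one operator that carries the vacuum vector to `η`.
  set T : Fock K →L[ℂ] Fock K := (innerSL ℂ (expVec (0 : K))).smulRight η with hT
  have hT' : ∀ ζ, T ζ = ⟪expVec (0 : K), ζ⟫_ℂ • η := fun ζ => rfl
  have h0 : T (expVec 0) = η := by rw [hT', inner_expVec_zero_left, one_smul]
  have key : innerSL ℂ (expVec u) ∘L ccrEnd V T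
      = ⟪expVec (adj(V) u), η⟫_ℂ • innerSL ℂ (expVec (kerPart V u : K)) := by
    refine fock_functional_ext fun w => ?_
    change ⟪expVec u, ccrEnd V T (expVec w)⟫_ℂ = ⟪expVec (adj(V) u), η⟫_ℂ * ⟪expVec _, expVec w⟫_ℂ
    rw [inner_ccrEnd, hT', inner_expVec_zero_left, one_smul, _root_.inner_expVec, inner_kerPart,
      mul_comm]
  have h1 := congrArg (fun f : Fock K →L[ℂ] ℂ => f (S (expVec 0))) key
  rw [← h0, ← hS T]
  refine h1.trans ?_
  rw [h0, mul_comm]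
  rfl

theorem IsIntertwiner.inner_expVec_vacuum {V : K →ₗᵢ[ℂ] K} {S : Fock K →L[ℂ] Fock K}
    (hS : IsIntertwiner V S) (u : K) :
    ⟪expVec u, S (expVec 0)⟫_ℂ = ⟪expVec (kerPart V u : K), S (expVec 0)⟫_ℂ := by
  rw [hS.inner_expVec, inner_expVec_zero_right, mul_one]

theorem IsIntertwiner.ext {V : K →ₗᵢ[ℂ] K} {S S' : Fock K →L[ℂ] Fock K}
    (hS : IsIntertwiner V S) (hS' : IsIntertwiner V S') (h : S (expVec 0) = S' (expVec 0)) :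
    S = S' :=
  ContinuousLinearMap.ext fun η => fock_ext fun u => by
    rw [hS.inner_expVec, hS'.inner_expVec, h]

end Intertwiner

/-! ### Components of degree one of intertwiners -/

section OneParticleIntertwiner

variable {K : Type u} [NormedAddCommGroup K] [InnerProductSpace ℂ K]

/-- The embedding of the one-particle space is the derivative of `u ↦ e(u)` at the origin. -/
theorem hasDerivAt_expVec (u : K) :
    HasDerivAt (fun r : ℝ => expVec ((r : ℂ) • u)) (oneParticle K u) 0 := by
  rw [hasDerivAt_iff_isLittleO]
  have h1 : (fun r : ℝ => expVec ((r : ℂ) • u) - expVec (((0 : ℝ) : ℂ) • u)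
      - (r - 0) • oneParticle K u) = fun r : ℝ => expRem ((r : ℂ) • u) := by
    funext r
    rw [expRem, (oneParticle K).map_smul, Complex.ofReal_zero, zero_smul, sub_zero,
      Complex.coe_smul r (oneParticle K u)]
  rw [h1]
  have h2 : (fun r : ℝ => expRem ((r : ℂ) • u)) =O[nhds 0] fun r : ℝ => r ^ 2 := by
    refine Asymptotics.IsBigO.of_bound (Real.exp (‖u‖ ^ 2) * ‖u‖ ^ 2) ?_
    filter_upwards [Metric.ball_mem_nhds (0 : ℝ) one_pos] with r hr
    have hr' : |r| ≤ 1 := by simpa using (Metric.mem_ball.1 hr).le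
    have h3 : ‖(r : ℂ) • u‖ = |r| * ‖u‖ := by rw [norm_smul, Complex.norm_real, Real.norm_eq_abs]
    refine (norm_expRem_le (C := ‖u‖) ?_).trans_eq ?_
    · rw [h3]
      exact mul_le_of_le_one_left (norm_nonneg _) hr'
    · rw [h3, mul_pow, Real.norm_eq_abs, abs_pow]
      ring
  refine h2.trans_isLittleO ?_
  simpa using Asymptotics.isLittleO_pow_id (𝕜 := ℝ) (n := 2) one_lt_two

theorem hasDerivAt_inner_expVec (u : K) (φ : Fock K) :
    HasDerivAt (fun r : ℝ => ⟪expVec ((r : ℂ) • u), φ⟫_ℂ) ⟪oneParticle K u, φ⟫_ℂ 0 := by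
  have h := (hasDerivAt_expVec u).inner ℂ (hasDerivAt_const (0 : ℝ) φ)
  simpa using h

variable [CompleteSpace K]

theorem kerPart_smul (V : K →ₗᵢ[ℂ] K) (c : ℂ) (u : K) :
    (kerPart V (c • u) : K) = c • (kerPart V u : K) := by
  change c • u - V (adj(V) (c • u)) = c • (u - V (adj(V) u))
  rw [map_smul, V.map_smul, smul_sub]

/-- The differential at the origin of `IsIntertwiner.inner_expVec`. -/
theorem IsIntertwiner.inner_oneParticle {V : K →ₗᵢ[ℂ] K} {S : Fock K →L[ℂ] Fock K}
    (hS : IsIntertwiner V S) (u : K) (η : Fock K) :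
    ⟪oneParticle K u, S η⟫_ℂ = ⟪oneParticle K (kerPart V u : K), S (expVec 0)⟫_ℂ * ⟪expVec 0, η⟫_ℂ
      + ⟪expVec 0, S (expVec 0)⟫_ℂ * ⟪oneParticle K (adj(V) u), η⟫_ℂ := by
  have h1 := hasDerivAt_inner_expVec u (S η)
  have h2 := (hasDerivAt_inner_expVec (kerPart V u : K) (S (expVec 0))).mul
    (hasDerivAt_inner_expVec (adj(V) u) η)
  have h3 : (fun r : ℝ => ⟪expVec ((r : ℂ) • u), S η⟫_ℂ)
      = (fun r : ℝ => ⟪expVec ((r : ℂ) • (kerPart V u : K)), S (expVec 0)⟫_ℂ)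
        * fun r : ℝ => ⟪expVec ((r : ℂ) • adj(V) u), η⟫_ℂ := by
    funext r
    rw [hS.inner_expVec, kerPart_smul, map_smul]
    rfl
  rw [h3] at h1
  have h4 := h1.unique h2
  simpa using h4

theorem IsIntertwiner.inner_oneParticle_vacuum {V : K →ₗᵢ[ℂ] K} {S : Fock K →L[ℂ] Fock K}
    (hS : IsIntertwiner V S) (u : K) :
    ⟪oneParticle K u, S (expVec 0)⟫_ℂ
      = ⟪oneParticle K (kerPart V u : K), S (expVec 0)⟫_ℂ := by
  rw [hS.inner_oneParticle, inner_oneParticle_expVec, inner_zero_right, mul_zero, add_zero,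
    inner_expVec_zero_right, mul_one]

theorem IsIntertwiner.inner_expRem_vacuum {V : K →ₗᵢ[ℂ] K} {S : Fock K →L[ℂ] Fock K}
    (hS : IsIntertwiner V S) (u : K) :
    ⟪expRem u, S (expVec 0)⟫_ℂ = ⟪expRem (kerPart V u : K), S (expVec 0)⟫_ℂ := by
  simp only [expRem, inner_sub_left]
  rw [hS.inner_expVec_vacuum u, hS.inner_oneParticle_vacuum u]

end OneParticleIntertwiner

/-! ### Partitions along a ray of the cone -/

section Partition

variable {P : Type*} [AddCommMonoid P] [TopologicalSpace P]
variable {K : Type u} [NormedAddCommGroup K] [InnerProductSpace ℂ K] [CompleteSpace K]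
variable (V : IsometricRep P K)

theorem IsometricRep.adj_add (x y : P) (ξ : K) : adj(V (x + y)) ξ = adj(V y) (adj(V x) ξ) := by
  refine ext_inner_left ℂ fun w => ?_
  rw [ContinuousLinearMap.adjoint_inner_right, ContinuousLinearMap.adjoint_inner_right,
    ContinuousLinearMap.adjoint_inner_right]
  exact congrArg (fun z => ⟪z, ξ⟫_ℂ) (V.map_add x y w)

theorem IsometricRep.adj_zero (ξ : K) : adj(V 0) ξ = ξ := by
  conv_lhs => rw [← V.zero_apply ξ]
  exact adjoint_apply_self (V 0) ξ

theorem norm_adj_le (T : K →ₗᵢ[ℂ] K) (u : K) : ‖adj(T) u‖ ≤ ‖u‖ := by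
  have := norm_kerPart_sq T u
  refine le_of_sq_le_sq ?_ (norm_nonneg _)
  nlinarith [sq_nonneg ‖kerPart T u‖]

/-- The `j`-th component of `u` in the decomposition
`K = ⨁ⱼ V (j • h) (ker (V h)*) ⊕ V (m • h) K`, moved to `ker (V h)*`. -/
noncomputable def IsometricRep.part (h : P) (j : ℕ) (u : K) : kerAdj (V h) :=
  kerPart (V h) (adj(V (j • h)) u)

theorem IsometricRep.norm_part_sq (h : P) (j : ℕ) (u : K) :
    ‖(V.part h j u : K)‖ ^ 2 = ‖adj(V (j • h)) u‖ ^ 2 - ‖adj(V ((j + 1) • h)) u‖ ^ 2 := by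
  rw [← Submodule.coe_norm, IsometricRep.part, norm_kerPart_sq, succ_nsmul, V.adj_add]

theorem IsometricRep.norm_part_le (h : P) (j : ℕ) (u : K) : ‖(V.part h j u : K)‖ ≤ ‖u‖ :=
  (norm_kerPart_le _ _).trans (norm_adj_le _ _)

theorem IsometricRep.sum_norm_part_sq_le (h : P) (m : ℕ) (u : K) :
    ∑ j ∈ Finset.range m, ‖(V.part h j u : K)‖ ^ 2 ≤ ‖u‖ ^ 2 := by
  simp only [V.norm_part_sq]
  rw [Finset.sum_range_sub', zero_nsmul, V.adj_zero]
  linarith [sq_nonneg ‖adj(V (m • h)) u‖]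

variable [Module ℝ≥0 P]

/-- The `m + 1`-st part of `x`. -/
noncomputable def mesh (x : P) (m : ℕ) : P := ((m + 1 : ℕ) : ℝ≥0)⁻¹ • x

theorem nsmul_mesh (x : P) (m j : ℕ) :
    j • mesh x m = ((j : ℝ≥0) * ((m + 1 : ℕ) : ℝ≥0)⁻¹) • x := by
  rw [mesh, ← Nat.cast_smul_eq_nsmul ℝ≥0, smul_smul]

theorem succ_nsmul_mesh (x : P) (m : ℕ) : (m + 1) • mesh x m = x := by
  rw [nsmul_mesh, mul_inv_cancel₀ (by positivity), one_smul]

variable [ContinuousSMul ℝ≥0 P]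

theorem tendsto_mesh (x : P) : Filter.Tendsto (mesh x) Filter.atTop (nhds 0) := by
  have h1 : Filter.Tendsto (fun m : ℕ => ((m + 1 : ℕ) : ℝ≥0)⁻¹) Filter.atTop (nhds 0) :=
    (tendsto_inv_atTop_nhds_zero_nat).comp (Filter.tendsto_add_atTop_nat 1)
  have h2 := h1.smul_const x
  rwa [zero_smul] at h2

/-- The components of a vector become uniformly small when the partition is refined. -/
theorem IsometricRep.StrictlyContinuous.eventually_norm_part_le {V : IsometricRep P K}
    (hV : V.StrictlyContinuous) (x : P) (u : K) {ε : ℝ} (hε : 0 < ε) :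
    ∀ᶠ m in Filter.atTop, ∀ j < m + 1, ‖(V.part (mesh x m) j u : K)‖ ≤ ε := by
  have hc : Continuous fun t : ℝ≥0 => ‖adj(V (t • x)) u‖ ^ 2 :=
    (((hV u).comp (continuous_id.smul continuous_const)).norm).pow 2
  have hu := (isCompact_Icc (a := (0 : ℝ≥0)) (b := 1)).uniformContinuousOn_of_continuous
    hc.continuousOn
  obtain ⟨δ, hδ, hu⟩ := Metric.uniformContinuousOn_iff.1 hu (ε ^ 2) (by positivity)
  have h1 : Filter.Tendsto (fun m : ℕ => ((m + 1 : ℕ) : ℝ≥0)⁻¹) Filter.atTop (nhds 0) :=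
    (tendsto_inv_atTop_nhds_zero_nat).comp (Filter.tendsto_add_atTop_nat 1)
  filter_upwards [h1.eventually (Metric.ball_mem_nhds 0 hδ)] with m hm j hj
  have hm0 : (0 : ℝ≥0) < ((m + 1 : ℕ) : ℝ≥0) := by positivity
  have hle : ∀ i : ℕ, i ≤ m + 1 → (i : ℝ≥0) * ((m + 1 : ℕ) : ℝ≥0)⁻¹ ∈ Set.Icc (0 : ℝ≥0) 1 := by
    intro i hi
    refine ⟨zero_le, ?_⟩
    rw [← div_eq_mul_inv, div_le_one hm0]
    exact_mod_cast hi
  have h2 := hu _ (hle j hj.le) _ (hle (j + 1) hj) (by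
    refine lt_of_le_of_lt (le_of_eq ?_) hm
    rw [NNReal.dist_eq, NNReal.dist_eq]
    push_cast
    rw [add_mul, one_mul, sub_add_cancel_left, abs_neg, sub_zero])
  rw [Real.dist_eq] at h2
  refine le_of_sq_le_sq ?_ hε.le
  rw [V.norm_part_sq, nsmul_mesh, nsmul_mesh]
  exact (le_abs_self _).trans h2.le

end Partition

/-! ### Units of a CCR flow -/

section Unit

variable {P : Type*} [AddCommMonoid P] [TopologicalSpace P]
variable {K : Type u} [NormedAddCommGroup K] [InnerProductSpace ℂ K] [CompleteSpace K]

/-- The representation has no additive cocycles other than `0`. -/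
def IsometricRep.NoAdditiveCocycle (V : IsometricRep P K) : Prop :=
  ∀ ξ : P → K, (∀ x, adj(V x) (ξ x) = 0) → (∀ x y, ξ (x + y) = ξ x + V x (ξ y)) → ∀ x, ξ x = 0

/-- A normalized unit of the CCR flow of `V`: a multiplicative family of intertwiners, with a
continuous vacuum expectation. -/
structure IsCCRUnit (V : IsometricRep P K) (Θ : P → Fock K →L[ℂ] Fock K) : Prop where
  intertwiner : ∀ x, IsIntertwiner (V x) (Θ x)
  map_add : ∀ x y η, Θ (x + y) η = Θ x (Θ y η)
  norm_vacuum : ∀ x, ‖Θ x (expVec 0)‖ = 1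
  continuous : Continuous fun x => ⟪expVec 0, Θ x (expVec 0)⟫_ℂ

variable {V : IsometricRep P K} {Θ : P → Fock K →L[ℂ] Fock K}

theorem IsCCRUnit.inner_expVec_add (h : IsCCRUnit V Θ) (x y : P) (u : K) :
    ⟪expVec u, Θ (x + y) (expVec 0)⟫_ℂ
      = ⟪expVec u, Θ x (expVec 0)⟫_ℂ * ⟪expVec (adj(V x) u), Θ y (expVec 0)⟫_ℂ := by
  rw [h.map_add, (h.intertwiner x).inner_expVec, ← (h.intertwiner x).inner_expVec_vacuum]

theorem IsCCRUnit.expectation_add (h : IsCCRUnit V Θ) (x y : P) :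
    ⟪expVec 0, Θ (x + y) (expVec 0)⟫_ℂ
      = ⟪expVec 0, Θ x (expVec 0)⟫_ℂ * ⟪expVec 0, Θ y (expVec 0)⟫_ℂ := by
  rw [h.inner_expVec_add, map_zero]

theorem IsCCRUnit.map_zero_vacuum (h : IsCCRUnit V Θ) : Θ 0 (expVec 0) = expVec 0 := by
  have h1 : Θ 0 (expVec 0) = ⟪expVec 0, Θ 0 (expVec 0)⟫_ℂ • expVec 0 := by
    refine fock_ext fun u => ?_
    have h2 : (kerPart (V 0) u : K) = 0 := by
      change u - V 0 (adj(V 0) u) = 0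
      rw [V.adj_zero, V.zero_apply, sub_self]
    rw [(h.intertwiner 0).inner_expVec_vacuum, h2, inner_smul_right, inner_expVec_zero_right,
      mul_one]
  have h2 : ⟪expVec 0, Θ 0 (expVec 0)⟫_ℂ ≠ 0 := by
    intro h3
    rw [h3, zero_smul] at h1
    have := h.norm_vacuum 0
    rw [h1, norm_zero] at this
    exact zero_ne_one this
  have h3 := h.expectation_add 0 0
  rw [add_zero] at h3
  rw [h1, mul_left_cancel₀ h2 (h3.symm.trans (mul_one _).symm), one_smul]

theorem IsCCRUnit.expectation_nsmul (h : IsCCRUnit V Θ) (x : P) (m : ℕ) :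
    ⟪expVec 0, Θ (m • x) (expVec 0)⟫_ℂ = ⟪expVec 0, Θ x (expVec 0)⟫_ℂ ^ m := by
  induction m with
  | zero => rw [zero_nsmul, h.map_zero_vacuum, inner_expVec_zero_right, pow_zero]
  | succ m ih => rw [succ_nsmul, h.expectation_add, ih, pow_succ]

theorem IsCCRUnit.inner_expVec_nsmul (h : IsCCRUnit V Θ) (x : P) (m : ℕ) (u : K) :
    ⟪expVec u, Θ (m • x) (expVec 0)⟫_ℂ
      = ∏ j ∈ Finset.range m, ⟪expVec (V.part x j u : K), Θ x (expVec 0)⟫_ℂ := by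
  induction m with
  | zero => rw [zero_nsmul, h.map_zero_vacuum, inner_expVec_zero_right, Finset.prod_range_zero]
  | succ m ih =>
    rw [succ_nsmul, h.inner_expVec_add, ih, Finset.prod_range_succ, IsometricRep.part,
      ← (h.intertwiner x).inner_expVec_vacuum]

variable [Module ℝ≥0 P] [ContinuousSMul ℝ≥0 P]

theorem IsCCRUnit.tendsto_expectation (h : IsCCRUnit V Θ) (x : P) :
    Filter.Tendsto (fun m => ⟪expVec 0, Θ (mesh x m) (expVec 0)⟫_ℂ) Filter.atTop (nhds 1) := by
  have h1 := (h.continuous.tendsto 0).comp (tendsto_mesh x)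
  rwa [h.map_zero_vacuum, inner_expVec_zero_right] at h1

theorem IsCCRUnit.expectation_ne_zero (h : IsCCRUnit V Θ) (x : P) :
    ⟪expVec 0, Θ x (expVec 0)⟫_ℂ ≠ 0 := by
  obtain ⟨m, hm⟩ := ((h.tendsto_expectation x).eventually_ne one_ne_zero).exists
  rw [← succ_nsmul_mesh x m, h.expectation_nsmul]
  exact pow_ne_zero _ hm

/-- The components of degree one of a unit, normalized to vacuum expectation one, form an additive
cocycle. If there are none but `0`, then the unit has no component of degree one. -/
theorem IsCCRUnit.inner_oneParticle_eq_zero (h : IsCCRUnit V Θ) (hV : V.NoAdditiveCocycle) (x : P)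
    (u : K) : ⟪oneParticle K u, Θ x (expVec 0)⟫_ℂ = 0 := by
  set χ : P → ℂ := fun x => ⟪expVec 0, Θ x (expVec 0)⟫_ℂ with hχ
  set ξ : P → K := fun x => (χ x)⁻¹ •
    ContinuousLinearMap.adjoint (oneParticle K).toContinuousLinearMap (Θ x (expVec 0)) with hξ
  have h0 : ∀ x, χ x ≠ 0 := h.expectation_ne_zero
  have h1 : ∀ x u, ⟪u, ξ x⟫_ℂ = (χ x)⁻¹ * ⟪oneParticle K u, Θ x (expVec 0)⟫_ℂ := by
    intro x u
    rw [hξ, inner_smul_right, ContinuousLinearMap.adjoint_inner_right]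
    rfl
  have h2 : ∀ x, adj(V x) (ξ x) = 0 := by
    intro x
    refine ext_inner_left ℂ fun w => ?_
    rw [ContinuousLinearMap.adjoint_inner_right, inner_zero_right, h1,
      (h.intertwiner x).inner_oneParticle_vacuum]
    have h3 : (kerPart (V x) (V x w) : K) = 0 := by
      change V x w - V x (adj(V x) (V x w)) = 0
      rw [adjoint_apply_self, sub_self]
    rw [LinearIsometry.coe_toContinuousLinearMap, h3, map_zero, inner_zero_left, mul_zero]
  have h3 : ∀ x y, ξ (x + y) = ξ x + V x (ξ y) := by
    intro x y
    refine ext_inner_left ℂ fun w => ?_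
    have h4 : ⟪w, V x (ξ y)⟫_ℂ = ⟪adj(V x) w, ξ y⟫_ℂ := by
      rw [ContinuousLinearMap.adjoint_inner_left]
      rfl
    have h5 : χ (x + y) = χ x * χ y := h.expectation_add x y
    rw [inner_add_right, h4, h1, h1, h1, h.map_add, (h.intertwiner x).inner_oneParticle,
      ← (h.intertwiner x).inner_oneParticle_vacuum, h5]
    change (χ x * χ y)⁻¹ * (_ * χ y + χ x * _) = _
    have := h0 x
    have := h0 y
    field_simp
  have h4 := h1 x u
  rw [hV ξ h2 h3 x, inner_zero_right] at h4
  exact (mul_eq_zero.1 h4.symm).resolve_left (inv_ne_zero (h0 x))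

theorem IsCCRUnit.norm_normalized_sub_sq (h : IsCCRUnit V Θ) (x : P) :
    ‖(⟪expVec 0, Θ x (expVec 0)⟫_ℂ)⁻¹ • Θ x (expVec 0) - expVec 0‖ ^ 2
      = (‖⟪expVec 0, Θ x (expVec 0)⟫_ℂ‖⁻¹) ^ 2 - 1 := by
  rw [@norm_sub_sq ℂ, inner_re_symm, inner_smul_right, inv_mul_cancel₀ (h.expectation_ne_zero x),
    norm_smul, norm_inv, h.norm_vacuum, norm_expVec_zero]
  simp
  ring

/-- If the representation has no additive cocycles, then the vacuum unit is the only unit of its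
CCR flow, up to a character. Since the expansion of a unit along a partition is a product, and its
terms of degree one vanish, the expectations in exponential vectors are controlled by the terms of
degree at least two, which are negligible for a fine partition. -/
theorem IsCCRUnit.eq_smul_secondQuant (h : IsCCRUnit V Θ) (hV : V.NoAdditiveCocycle) (x : P) :
    Θ x = ⟪expVec 0, Θ x (expVec 0)⟫_ℂ • secondQuant (V x) := by
  set χ : P → ℂ := fun x => ⟪expVec 0, Θ x (expVec 0)⟫_ℂ with hχ
  have h0 : ∀ x, χ x ≠ 0 := h.expectation_ne_zero
  have hsq : IsIntertwiner (V x) (χ x • secondQuant (V x)) := by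
    intro T η
    have := isIntertwiner_fockMul (V x) (expVec 0) T η
    change ccrEnd (V x) T (χ x • secondQuant (V x) η) = χ x • secondQuant (V x) (T η)
    rw [map_smul]
    exact congrArg _ this
  refine (h.intertwiner x).ext hsq ?_
  change _ = χ x • secondQuant (V x) (expVec 0)
  rw [secondQuant_expVec, map_zero]
  refine fock_ext fun u => ?_
  rw [inner_smul_right, inner_expVec_zero_right, mul_one]
  -- `δ m` is the distance from the normalized unit to the vacuum vector at the mesh of order `m`.
  set δ : ℕ → ℝ := fun m => ‖(χ (mesh x m))⁻¹ • Θ (mesh x m) (expVec 0) - expVec 0‖ with hδ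
  have hδ0 : Filter.Tendsto δ Filter.atTop (nhds 0) := by
    have h1 : Filter.Tendsto (fun m => (‖χ (mesh x m)‖⁻¹) ^ 2 - 1) Filter.atTop (nhds 0) := by
      have := ((((h.tendsto_expectation x).norm.inv₀ (by simp)).pow 2).sub_const 1)
      simpa using this
    have h2 := (Real.continuous_sqrt.tendsto 0).comp h1
    rw [Real.sqrt_zero] at h2
    refine h2.congr fun m => ?_
    rw [Function.comp_apply, hδ, ← h.norm_normalized_sub_sq, Real.sqrt_sq (norm_nonneg _)]
  have hfac : ∀ m j, ‖(χ (mesh x m))⁻¹ * ⟪expVec (V.part (mesh x m) j u : K),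
      Θ (mesh x m) (expVec 0)⟫_ℂ - 1‖
      ≤ Real.exp (‖u‖ ^ 2) * ‖(V.part (mesh x m) j u : K)‖ ^ 2 * δ m := by
    intro m j
    set w : K := (V.part (mesh x m) j u : K) with hw
    have h1 : expVec w = expVec 0 + oneParticle K w + expRem w := by
      rw [expRem]
      abel
    have h2 : (χ (mesh x m))⁻¹ * ⟪expVec w, Θ (mesh x m) (expVec 0)⟫_ℂ - 1
        = ⟪expRem w, (χ (mesh x m))⁻¹ • Θ (mesh x m) (expVec 0) - expVec 0⟫_ℂ := by
      rw [inner_sub_right, inner_expRem_expVec_zero, sub_zero, inner_smul_right, h1,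
        inner_add_left, inner_add_left, h.inner_oneParticle_eq_zero hV, add_zero, mul_add]
      change (χ (mesh x m))⁻¹ * χ (mesh x m) + _ - 1 = _
      rw [inv_mul_cancel₀ (h0 _)]
      ring
    rw [h2]
    refine (norm_inner_le_norm _ _).trans ?_
    gcongr
    exact norm_expRem_le (V.norm_part_le _ _ _)
  have hprod : ∀ m, ‖(χ x)⁻¹ * ⟪expVec u, Θ x (expVec 0)⟫_ℂ - 1‖
      ≤ Real.exp (Real.exp (‖u‖ ^ 2) * ‖u‖ ^ 2 * δ m) - 1 := by
    intro m
    have h1 : (χ x)⁻¹ * ⟪expVec u, Θ x (expVec 0)⟫_ℂ = ∏ j ∈ Finset.range (m + 1),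
        (1 + ((χ (mesh x m))⁻¹ * ⟪expVec (V.part (mesh x m) j u : K),
          Θ (mesh x m) (expVec 0)⟫_ℂ - 1)) := by
      simp only [add_sub_cancel]
      rw [Finset.prod_mul_distrib, ← h.inner_expVec_nsmul, succ_nsmul_mesh, Finset.prod_const,
        Finset.card_range, inv_pow]
      congr 2
      change χ x = χ (mesh x m) ^ (m + 1)
      rw [hχ, ← h.expectation_nsmul, succ_nsmul_mesh]
    rw [h1]
    refine (Finset.norm_prod_one_add_sub_one_le _ _).trans ?_
    gcongr
    refine (Finset.sum_le_sum fun j _ => hfac m j).trans ?_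
    rw [← Finset.sum_mul, ← Finset.mul_sum]
    gcongr
    exact V.sum_norm_part_sq_le _ _ _
  have hlim : Filter.Tendsto (fun m => Real.exp (Real.exp (‖u‖ ^ 2) * ‖u‖ ^ 2 * δ m) - 1)
      Filter.atTop (nhds 0) := by
    have := ((Real.continuous_exp.tendsto _).comp
      (hδ0.const_mul (Real.exp (‖u‖ ^ 2) * ‖u‖ ^ 2))).sub_const 1
    simpa using this
  have h3 : ‖(χ x)⁻¹ * ⟪expVec u, Θ x (expVec 0)⟫_ℂ - 1‖ ≤ 0 :=
    ge_of_tendsto' hlim hprod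
  have h4 := sub_eq_zero.1 (norm_le_zero_iff.1 h3)
  rwa [inv_mul_eq_one₀ (h0 x), eq_comm] at h4

end Unit

/-! ### Isomorphisms of product systems -/

section ProductSystem

variable {K : Type u} [NormedAddCommGroup K] [InnerProductSpace ℂ K] [CompleteSpace K]

theorem inner_oneParticle_secondQuant (V : K →ₗᵢ[ℂ] K) (η : Fock K) (w : K) :
    ⟪oneParticle K w, secondQuant V η⟫_ℂ = ⟪oneParticle K (adj(V) w), η⟫_ℂ := by
  have h := (isIntertwiner_fockMul V (expVec 0)).inner_oneParticle w η
  change ⟪oneParticle K w, secondQuant V η⟫_ℂ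
    = ⟪_, secondQuant V (expVec 0)⟫_ℂ * _ + ⟪_, secondQuant V (expVec 0)⟫_ℂ * _ at h
  rwa [secondQuant_expVec, map_zero, inner_oneParticle_expVec, inner_zero_right, zero_mul,
    zero_add, inner_expVec_zero_right, one_mul] at h

theorem inner_expRem_secondQuant (V : K →ₗᵢ[ℂ] K) (η : Fock K) (w : K) :
    ⟪expRem w, secondQuant V η⟫_ℂ = ⟪expRem (adj(V) w), η⟫_ℂ := by
  simp only [expRem, inner_sub_left]
  rw [inner_expVec_secondQuant, inner_expVec_secondQuant, inner_oneParticle_secondQuant, map_zero]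

theorem secondQuant_oneParticle (V : K →ₗᵢ[ℂ] K) (u : K) :
    secondQuant V (oneParticle K u) = oneParticle K (V u) :=
  fock_ext fun w => by
    rw [inner_expVec_secondQuant, inner_expVec_oneParticle, inner_expVec_oneParticle,
      ContinuousLinearMap.adjoint_inner_left]
    rfl

/-- Left multiplication by the component of `u` in `ker V*`, as a vector of degree one. -/
noncomputable def oneMul (V : K →ₗᵢ[ℂ] K) (u : K) : Fock K →L[ℂ] Fock K :=
  fockMul V (oneParticle (kerAdj V) (kerPart V u))

theorem inner_expVec_oneMul (V : K →ₗᵢ[ℂ] K) (u : K) (η : Fock K) (w : K) :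
    ⟪expVec w, oneMul V u η⟫_ℂ
      = (⟪w, u⟫_ℂ - ⟪adj(V) w, adj(V) u⟫_ℂ) * ⟪expVec (adj(V) w), η⟫_ℂ := by
  rw [oneMul, inner_expVec_fockMul, inner_expVec_oneParticle, Submodule.coe_inner, inner_kerPart,
    show adj(V) (kerPart V u : K) = 0 from adj_kerAdj _, inner_zero_right, sub_zero,
    inner_kerPart_right]

theorem isIntertwiner_secondQuant (V : K →ₗᵢ[ℂ] K) : IsIntertwiner V (secondQuant V) :=
  isIntertwiner_fockMul V _

theorem isIntertwiner_oneMul (V : K →ₗᵢ[ℂ] K) (u : K) : IsIntertwiner V (oneMul V u) :=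
  isIntertwiner_fockMul V _

theorem oneMul_add (V : K →ₗᵢ[ℂ] K) (u v : K) : oneMul V (u + v) = oneMul V u + oneMul V v :=
  ContinuousLinearMap.ext fun η => fock_ext fun w => by
    rw [add_apply, inner_add_right, inner_expVec_oneMul, inner_expVec_oneMul,
      inner_expVec_oneMul, map_add, inner_add_right, inner_add_right]
    ring

theorem oneMul_smul (V : K →ₗᵢ[ℂ] K) (c : ℂ) (u : K) : oneMul V (c • u) = c • oneMul V u :=
  ContinuousLinearMap.ext fun η => fock_ext fun w => by
    rw [smul_apply, inner_smul_right, inner_expVec_oneMul, inner_expVec_oneMul,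
      map_smul, inner_smul_right, inner_smul_right]
    ring

theorem oneMul_kerPart (V : K →ₗᵢ[ℂ] K) (u : K) : oneMul V (kerPart V u : K) = oneMul V u := by
  rw [oneMul, kerPart_coe, oneMul]

variable {P : Type*} [AddCommMonoid P] [TopologicalSpace P]

theorem IsometricRep.oneMul_add_eq (V : IsometricRep P K) (x y : P) (u : K) :
    oneMul (V (x + y)) u
      = oneMul (V x) u * secondQuant (V y) + secondQuant (V x) * oneMul (V y) (adj(V x) u) :=
  ContinuousLinearMap.ext fun η => fock_ext fun w => by
    rw [add_apply, inner_add_right, mul_apply_eq_comp, mul_apply_eq_comp, inner_expVec_oneMul,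
      inner_expVec_oneMul, inner_expVec_secondQuant, inner_expVec_secondQuant,
      inner_expVec_oneMul, V.adj_add, V.adj_add]
    ring

theorem IsometricRep.secondQuant_add (V : IsometricRep P K) (x y : P) :
    secondQuant (V (x + y)) = secondQuant (V x) * secondQuant (V y) :=
  ContinuousLinearMap.ext fun η => fock_ext fun w => by
    rw [mul_apply_eq_comp, inner_expVec_secondQuant, inner_expVec_secondQuant,
      inner_expVec_secondQuant, V.adj_add]

theorem IsometricRep.StrictlyContinuous.continuous_secondQuant {V : IsometricRep P K}
    (hV : V.StrictlyContinuous) (η : Fock K) : Continuous fun x => secondQuant (V x) η := by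
  -- A weakly continuous family of vectors of constant norm is norm continuous.
  have hw : ∀ ξ : Fock K, Continuous fun x => ⟪ξ, secondQuant (V x) η⟫_ℂ := by
    refine continuous_inner_of_total expVec_total (C := ‖η‖)
      (fun x => (norm_secondQuant _ _).le) fun w => ?_
    simp only [inner_expVec_secondQuant]
    have h1 := continuous_expVec.comp (hV w)
    exact h1.inner continuous_const
  rw [continuous_iff_continuousAt]
  intro y
  rw [ContinuousAt, tendsto_iff_norm_sub_tendsto_zero]
  have h1 : Filter.Tendsto (fun x => ‖η‖ ^ 2
      - 2 * RCLike.re ⟪secondQuant (V y) η, secondQuant (V x) η⟫_ℂ + ‖η‖ ^ 2) (nhds y)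
      (nhds 0) := by
    have h2 : Continuous fun x => ‖η‖ ^ 2
      - 2 * RCLike.re ⟪secondQuant (V y) η, secondQuant (V x) η⟫_ℂ + ‖η‖ ^ 2 := by
      have := hw (secondQuant (V y) η)
      fun_prop
    have h3 := h2.tendsto y
    rw [inner_self_eq_norm_sq, norm_secondQuant] at h3
    convert h3 using 2
    ring
  have h2 := (Real.continuous_sqrt.tendsto 0).comp h1
  rw [Real.sqrt_zero] at h2
  refine h2.congr fun x => ?_
  rw [Function.comp_apply, inner_re_symm, ← Real.sqrt_sq (norm_nonneg (_ - _)),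
    @norm_sub_sq ℂ, norm_secondQuant, norm_secondQuant]

variable {K' : Type v} [NormedAddCommGroup K'] [InnerProductSpace ℂ K'] [CompleteSpace K']

/-- A morphism from the product system of the CCR flow of `V` to that of `V'`: linear maps that
carry intertwiners to intertwiners, preserve products and inner products, and carry the vacuum
unit to a continuous unit. -/
structure IsProductSystemMap (V : IsometricRep P K) (V' : IsometricRep P K')
    (θ : P → (Fock K →L[ℂ] Fock K) →ₗ[ℂ] (Fock K' →L[ℂ] Fock K')) : Prop where
  intertwiner : ∀ x S, IsIntertwiner (V x) S → IsIntertwiner (V' x) (θ x S)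
  map_mul : ∀ x y S S', IsIntertwiner (V x) S → θ (x + y) (S * S') = θ x S * θ y S'
  inner_vacuum : ∃ η : Fock K, ‖η‖ = 1 ∧ ∀ x S S',
    ⟪θ x S (expVec 0), θ x S' (expVec 0)⟫_ℂ = ⟪S η, S' η⟫_ℂ
  continuous : Continuous fun x => ⟪expVec 0, θ x (secondQuant (V x)) (expVec 0)⟫_ℂ

/-- Cocycle conjugate CCR flows have isomorphic product systems. -/
theorem exists_isProductSystemMap {V : IsometricRep P K} {V' : IsometricRep P K'}
    {hV : V.StrictlyContinuous} {hV' : V'.StrictlyContinuous}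
    (h : (ccrFlow V hV).CocycleConjugate (ccrFlow V' hV')) :
    ∃ θ, IsProductSystemMap V V' θ := by
  obtain ⟨U, W, hW, hc⟩ := h
  have hUadd : ∀ S S', U.conjStarAlgEquiv (S + S')
      = U.conjStarAlgEquiv S + U.conjStarAlgEquiv S' := fun S S' =>
    ContinuousLinearMap.ext fun η => by
      rw [add_apply, LinearIsometryEquiv.conjStarAlgEquiv_apply_apply, add_apply, U.map_add,
        LinearIsometryEquiv.conjStarAlgEquiv_apply_apply,
        LinearIsometryEquiv.conjStarAlgEquiv_apply_apply]
  have hUsmul : ∀ (c : ℂ) S, U.conjStarAlgEquiv (c • S) = c • U.conjStarAlgEquiv S := fun c S =>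
    ContinuousLinearMap.ext fun η => by
      rw [smul_apply, LinearIsometryEquiv.conjStarAlgEquiv_apply_apply, smul_apply, U.map_smul,
        LinearIsometryEquiv.conjStarAlgEquiv_apply_apply]
  -- The map `S ↦ (W x)* U S U*`.
  let θ : P → (Fock K →L[ℂ] Fock K) →ₗ[ℂ] (Fock K' →L[ℂ] Fock K') := fun x =>
    { toFun := fun S => star (W x) * U.conjStarAlgEquiv S
      map_add' := fun S S' => by rw [hUadd, mul_add]
      map_smul' := fun c S => by rw [hUsmul, mul_smul_comm, RingHom.id_apply] }
  have hθ : ∀ x S, θ x S = star (W x) * U.conjStarAlgEquiv S := fun x S => rfl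
  have h1 : ∀ x, star (W x) * W x = 1 := fun x => Unitary.star_mul_self_of_mem (hW.mem_unitary x)
  have hint : ∀ x S, IsIntertwiner (V x) S → ∀ T, ccrEnd (V' x) T * θ x S = θ x S * T := by
    intro x S hS T
    have h2 : U.conjStarAlgEquiv (ccrEnd (V x) (U.symm.conjStarAlgEquiv T))
        = W x * ccrEnd (V' x) T * star (W x) := hc x T
    have h3 : ccrEnd (V x) (U.symm.conjStarAlgEquiv T) * S = S * U.symm.conjStarAlgEquiv T :=
      ContinuousLinearMap.ext fun η => hS _ η
    have h4 : U.conjStarAlgEquiv (U.symm.conjStarAlgEquiv T) = T := by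
      refine ContinuousLinearMap.ext fun η => ?_
      simp [LinearIsometryEquiv.conjStarAlgEquiv_apply_apply]
    calc ccrEnd (V' x) T * θ x S
        = (star (W x) * W x) * ccrEnd (V' x) T * star (W x) * U.conjStarAlgEquiv S := by
          rw [h1, hθ, one_mul, mul_assoc]
      _ = star (W x) * (W x * ccrEnd (V' x) T * star (W x)) * U.conjStarAlgEquiv S := by
          simp only [mul_assoc]
      _ = θ x S * T := by
          rw [← h2, mul_assoc, ← map_mul, h3, map_mul, h4, hθ, mul_assoc]
  refine ⟨θ, fun x S hS T η => ?_, fun x y S S' hS => ?_, ⟨U.symm (expVec 0), ?_, fun x S S' => ?_⟩,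
    ?_⟩
  · exact congrArg (fun A : Fock K' →L[ℂ] Fock K' => A η) (hint x S hS T)
  · have h2 : W x * ccrEnd (V' x) (W y) = W (x + y) := hW.mul x y
    rw [hθ, ← h2, star_mul, ← map_star, map_mul, mul_assoc, ← mul_assoc (star (W x)), ← hθ,
      ← mul_assoc, hint x S hS, mul_assoc, ← hθ]
  · rw [LinearIsometryEquiv.norm_map, norm_expVec_zero]
  · rw [hθ, hθ, mul_apply_eq_comp, mul_apply_eq_comp, ContinuousLinearMap.star_eq_adjoint,
      ContinuousLinearMap.adjoint_inner_left, ← mul_apply_eq_comp (W x),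
      ← ContinuousLinearMap.star_eq_adjoint, Unitary.mul_star_self_of_mem (hW.mem_unitary x)]
    rw [one_apply_eq_self, LinearIsometryEquiv.conjStarAlgEquiv_apply_apply,
      LinearIsometryEquiv.conjStarAlgEquiv_apply_apply, LinearIsometryEquiv.inner_map_map]
  · have h2 : ∀ x, ⟪expVec 0, θ x (secondQuant (V x)) (expVec 0)⟫_ℂ
        = ⟪W x (expVec 0), U (secondQuant (V x) (U.symm (expVec 0)))⟫_ℂ := fun x => by
      rw [hθ, mul_apply_eq_comp, ContinuousLinearMap.star_eq_adjoint,
        ContinuousLinearMap.adjoint_inner_right]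
      rfl
    simp only [h2]
    exact (hW.continuous _).inner (U.continuous.comp (hV.continuous_secondQuant _))

namespace IsProductSystemMap

variable {V : IsometricRep P K} {V' : IsometricRep P K'}
  {θ : P → (Fock K →L[ℂ] Fock K) →ₗ[ℂ] (Fock K' →L[ℂ] Fock K')}

theorem isCCRUnit (h : IsProductSystemMap V V' θ) :
    IsCCRUnit V' fun x => θ x (secondQuant (V x)) where
  intertwiner x := h.intertwiner x _ (isIntertwiner_secondQuant _)
  map_add x y η := by
    rw [V.secondQuant_add, h.map_mul x y _ _ (isIntertwiner_secondQuant _), mul_apply_eq_comp]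
  norm_vacuum x := by
    obtain ⟨η, hη, h1⟩ := h.inner_vacuum
    rw [@norm_eq_sqrt_re_inner ℂ, h1, inner_secondQuant, ← @norm_eq_sqrt_re_inner ℂ, hη]
  continuous := h.continuous

/-- The character by which a morphism of product systems rescales the vacuum unit. -/
noncomputable def character (V : IsometricRep P K)
    (θ : P → (Fock K →L[ℂ] Fock K) →ₗ[ℂ] (Fock K' →L[ℂ] Fock K')) (x : P) : ℂ :=
  ⟪expVec 0, θ x (secondQuant (V x)) (expVec 0)⟫_ℂ

/-- The image of the vector `u` of degree one, normalized by the character. -/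
noncomputable def oneImage (V : IsometricRep P K)
    (θ : P → (Fock K →L[ℂ] Fock K) →ₗ[ℂ] (Fock K' →L[ℂ] Fock K')) (x : P) (u : K) : Fock K' :=
  (character V θ x)⁻¹ • θ x (oneMul (V x) u) (expVec 0)

variable [Module ℝ≥0 P] [ContinuousSMul ℝ≥0 P]

theorem map_secondQuant (h : IsProductSystemMap V V' θ) (hV' : V'.NoAdditiveCocycle) (x : P) :
    θ x (secondQuant (V x)) = character V θ x • secondQuant (V' x) :=
  h.isCCRUnit.eq_smul_secondQuant hV' x

theorem norm_character (h : IsProductSystemMap V V' θ) (hV' : V'.NoAdditiveCocycle) (x : P) :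
    ‖character V θ x‖ = 1 := by
  have h1 := h.isCCRUnit.norm_vacuum x
  rwa [h.map_secondQuant hV', smul_apply, norm_smul, norm_secondQuant,
    norm_expVec_zero, mul_one] at h1

theorem oneImage_kerPart (x : P) (u : K) :
    oneImage V θ x (kerPart (V x) u : K) = oneImage V θ x u := by
  rw [oneImage, oneMul_kerPart, oneImage]

theorem oneImage_add_vec (x : P) (u v : K) :
    oneImage V θ x (u + v) = oneImage V θ x u + oneImage V θ x v := by
  rw [oneImage, oneMul_add, map_add, add_apply, smul_add]
  rfl

theorem oneImage_smul (x : P) (c : ℂ) (u : K) :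
    oneImage V θ x (c • u) = c • oneImage V θ x u := by
  rw [oneImage, oneMul_smul, map_smul, smul_apply, smul_comm]
  rfl

theorem oneImage_add (h : IsProductSystemMap V V' θ) (hV' : V'.NoAdditiveCocycle) (x y : P)
    (u : K) : oneImage V θ (x + y) u
      = oneImage V θ x u + secondQuant (V' x) (oneImage V θ y (adj(V x) u)) := by
  have hx : character V θ x ≠ 0 := h.isCCRUnit.expectation_ne_zero x
  have hy : character V θ y ≠ 0 := h.isCCRUnit.expectation_ne_zero y
  have hxy : character V θ (x + y) = character V θ x * character V θ y :=
    h.isCCRUnit.expectation_add x y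
  rw [oneImage, oneImage, oneImage, V.oneMul_add_eq, map_add,
    h.map_mul x y _ _ (isIntertwiner_oneMul _ _), h.map_mul x y _ _ (isIntertwiner_secondQuant _),
    h.map_secondQuant hV', h.map_secondQuant hV', hxy, add_apply, mul_apply_eq_comp,
    mul_apply_eq_comp, smul_apply, smul_apply, secondQuant_expVec,
    map_zero, map_smul, map_smul, smul_add, smul_smul, smul_smul]
  congr 2
  · field_simp
  · field_simp

theorem norm_oneImage (h : IsProductSystemMap V V' θ) (hV' : V'.NoAdditiveCocycle) (x : P)
    (u : K) : ‖oneImage V θ x u‖ = ‖kerPart (V x) u‖ := by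
  obtain ⟨η, hη, h1⟩ := h.inner_vacuum
  rw [oneImage, norm_smul, norm_inv, h.norm_character hV', inv_one, one_mul,
    @norm_eq_sqrt_re_inner ℂ, h1, oneMul, inner_fockMul, inner_self_eq_norm_sq_to_K η, hη,
    LinearIsometry.inner_map_map, RCLike.ofReal_one, one_pow, mul_one, ← @norm_eq_sqrt_re_inner ℂ]

theorem inner_expVec_zero_oneImage (h : IsProductSystemMap V V' θ) (hV' : V'.NoAdditiveCocycle)
    (x : P) (u : K) : ⟪expVec 0, oneImage V θ x u⟫_ℂ = 0 := by
  obtain ⟨η, hη, h1⟩ := h.inner_vacuum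
  have hx : character V θ x ≠ 0 := h.isCCRUnit.expectation_ne_zero x
  have h2 : expVec 0 = (character V θ x)⁻¹ • θ x (secondQuant (V x)) (expVec 0) := by
    rw [h.map_secondQuant hV', smul_apply, secondQuant_expVec, map_zero,
      inv_smul_smul₀ hx]
  rw [oneImage, h2, inner_smul_left, inner_smul_right, ← h2, h1, secondQuant, oneMul,
    inner_fockMul, inner_expVec_oneParticle, inner_zero_left]
  simp

theorem inner_expRem_oneImage_add (h : IsProductSystemMap V V' θ) (hV' : V'.NoAdditiveCocycle)
    (x y : P) (u : K) (w : K') :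
    ⟪expRem w, oneImage V θ (x + y) u⟫_ℂ = ⟪expRem w, oneImage V θ x u⟫_ℂ
      + ⟪expRem (adj(V' x) w), oneImage V θ y (adj(V x) u)⟫_ℂ := by
  rw [h.oneImage_add hV', inner_add_right, inner_expRem_secondQuant]

theorem inner_expRem_oneImage_nsmul (h : IsProductSystemMap V V' θ)
    (hV' : V'.NoAdditiveCocycle) (x : P) (m : ℕ) (u : K) (w : K') :
    ⟪expRem w, oneImage V θ (m • x) u⟫_ℂ = ∑ j ∈ Finset.range m,
      ⟪expRem (V'.part x j w : K'), oneImage V θ x (V.part x j u : K)⟫_ℂ := by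
  induction m with
  | zero =>
    have h1 := h.inner_expRem_oneImage_add hV' 0 0 u w
    rw [add_zero, V.adj_zero, V'.adj_zero] at h1
    rw [zero_nsmul, Finset.sum_range_zero]
    exact left_eq_add.1 h1
  | succ m ih =>
    rw [succ_nsmul, h.inner_expRem_oneImage_add hV', ih, Finset.sum_range_succ,
      IsometricRep.part, IsometricRep.part, oneImage_kerPart]
    congr 1
    rw [oneImage, inner_smul_right, inner_smul_right,
      (h.intertwiner x _ (isIntertwiner_oneMul _ _)).inner_expRem_vacuum]

/-- The components of degree at least two of the image of a vector of degree one vanish, since the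
expansion of the image along a partition is a sum, not a product. -/
theorem inner_expRem_oneImage (h : IsProductSystemMap V V' θ) (hV : V.StrictlyContinuous)
    (hV' : V'.NoAdditiveCocycle) (x : P) (u : K) (w : K') :
    ⟪expRem w, oneImage V θ x u⟫_ℂ = 0 := by
  set C : ℝ := Real.exp (‖w‖ ^ 2) * ‖w‖ ^ 2 with hC
  have hC0 : 0 ≤ C := by positivity
  have key : ∀ ε : ℝ, 0 < ε → ‖⟪expRem w, oneImage V θ x u⟫_ℂ‖ ≤ C * ε := by
    intro ε hε
    obtain ⟨m, hm⟩ := (hV.eventually_norm_part_le x u hε).exists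
    rw [← succ_nsmul_mesh x m, h.inner_expRem_oneImage_nsmul hV']
    refine (norm_sum_le _ _).trans ?_
    calc ∑ j ∈ Finset.range (m + 1), ‖⟪expRem (V'.part (mesh x m) j w : K'),
            oneImage V θ (mesh x m) (V.part (mesh x m) j u : K)⟫_ℂ‖
        ≤ ∑ j ∈ Finset.range (m + 1),
            Real.exp (‖w‖ ^ 2) * ‖(V'.part (mesh x m) j w : K')‖ ^ 2 * ε := by
          refine Finset.sum_le_sum fun j hj => (norm_inner_le_norm _ _).trans ?_
          gcongr
          · exact norm_expRem_le (V'.norm_part_le _ _ _)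
          · rw [h.norm_oneImage hV', kerPart_coe, Submodule.coe_norm]
            exact hm j (Finset.mem_range.1 hj)
      _ ≤ C * ε := by
          rw [← Finset.sum_mul, ← Finset.mul_sum, hC]
          gcongr
          exact V'.sum_norm_part_sq_le _ _ _
  have h0 : ‖⟪expRem w, oneImage V θ x u⟫_ℂ‖ ≤ 0 := by
    refine le_of_forall_pos_le_add fun ε hε => ?_
    refine (key (ε / (C + 1)) (by positivity)).trans ?_
    rw [zero_add, mul_div_assoc', div_le_iff₀ (by positivity)]
    nlinarith
  exact norm_le_zero_iff.1 h0

/-- The restriction of a morphism of product systems to the vectors of degree one. -/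
noncomputable def oneMap (V : IsometricRep P K)
    (θ : P → (Fock K →L[ℂ] Fock K) →ₗ[ℂ] (Fock K' →L[ℂ] Fock K')) (x : P) (u : K) : K' :=
  ContinuousLinearMap.adjoint (oneParticle K').toContinuousLinearMap (oneImage V θ x u)

theorem inner_oneMap (x : P) (u : K) (w : K') :
    ⟪w, oneMap V θ x u⟫_ℂ = ⟪oneParticle K' w, oneImage V θ x u⟫_ℂ := by
  rw [oneMap, ContinuousLinearMap.adjoint_inner_right]
  rfl

theorem oneParticle_oneMap (h : IsProductSystemMap V V' θ) (hV : V.StrictlyContinuous)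
    (hV' : V'.NoAdditiveCocycle) (x : P) (u : K) :
    oneParticle K' (oneMap V θ x u) = oneImage V θ x u := by
  refine fock_ext fun w => ?_
  have h1 : expVec w = expVec 0 + oneParticle K' w + expRem w := by
    rw [expRem]
    abel
  rw [inner_expVec_oneParticle, inner_oneMap, h1, inner_add_left, inner_add_left,
    h.inner_expVec_zero_oneImage hV', h.inner_expRem_oneImage hV hV', zero_add, add_zero]

theorem norm_oneMap (h : IsProductSystemMap V V' θ) (hV : V.StrictlyContinuous)
    (hV' : V'.NoAdditiveCocycle) (x : P) (u : K) :
    ‖oneMap V θ x u‖ = ‖kerPart (V x) u‖ := by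
  rw [← (oneParticle K').norm_map, h.oneParticle_oneMap hV hV', h.norm_oneImage hV']

theorem oneMap_add (h : IsProductSystemMap V V' θ) (hV : V.StrictlyContinuous)
    (hV' : V'.NoAdditiveCocycle) (x y : P) (u : K) :
    oneMap V θ (x + y) u = oneMap V θ x u + V' x (oneMap V θ y (adj(V x) u)) := by
  apply (oneParticle K').injective
  rw [map_add, ← secondQuant_oneParticle, h.oneParticle_oneMap hV hV',
    h.oneParticle_oneMap hV hV', h.oneParticle_oneMap hV hV', h.oneImage_add hV']

theorem adj_oneMap (h : IsProductSystemMap V V' θ) (x : P) (u : K) :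
    adj(V' x) (oneMap V θ x u) = 0 := by
  refine ext_inner_left ℂ fun w => ?_
  rw [ContinuousLinearMap.adjoint_inner_right, inner_zero_right, inner_oneMap, oneImage,
    inner_smul_right,
    (h.intertwiner x _ (isIntertwiner_oneMul _ _)).inner_oneParticle_vacuum]
  have h3 : (kerPart (V' x) (V' x w) : K') = 0 := by
    change V' x w - V' x (adj(V' x) (V' x w)) = 0
    rw [adjoint_apply_self, sub_self]
  rw [LinearIsometry.coe_toContinuousLinearMap, h3, map_zero, inner_zero_left, mul_zero]

theorem oneMap_rep (h : IsProductSystemMap V V' θ) (hV : V.StrictlyContinuous)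
    (hV' : V'.NoAdditiveCocycle) (x y : P) (u : K) :
    oneMap V θ (x + y) (V x u) = V' x (oneMap V θ y u) := by
  have h1 : oneMap V θ x (V x u) = 0 := by
    rw [← norm_eq_zero, h.norm_oneMap hV hV', Submodule.coe_norm]
    change ‖V x u - V x (adj(V x) (V x u))‖ = 0
    rw [adjoint_apply_self, sub_self, norm_zero]
  rw [h.oneMap_add hV hV', h1, adjoint_apply_self, zero_add]

theorem adj_oneMap_add (h : IsProductSystemMap V V' θ) (hV : V.StrictlyContinuous)
    (hV' : V'.NoAdditiveCocycle) (x y : P) (u : K) :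
    adj(V' x) (oneMap V θ (x + y) u) = oneMap V θ y (adj(V x) u) := by
  rw [h.oneMap_add hV hV', map_add, h.adj_oneMap, adjoint_apply_self, zero_add]

end IsProductSystemMap

/-- The representation is pure along the direction `p`: the ranges of `V (n • p)` shrink to
zero. -/
def IsometricRep.IsPure (V : IsometricRep P K) (p : P) : Prop :=
  ∀ u, Filter.Tendsto (fun n : ℕ => adj(V (n • p)) u) Filter.atTop (nhds 0)

/-- If the CCR flows of `V` and `V'` are cocycle conjugate, then `V` is a direct summand of `V'`,
provided that `V` is pure and `V'` has no additive cocycles. The isometry is the limit of the maps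
between the one-particle spaces `ker V (n • p)*`. -/
theorem exists_intertwining_isometry [Module ℝ≥0 P] [ContinuousSMul ℝ≥0 P]
    {V : IsometricRep P K} {V' : IsometricRep P K'}
    {hV : V.StrictlyContinuous} {hV' : V'.StrictlyContinuous}
    (h : (ccrFlow V hV).CocycleConjugate (ccrFlow V' hV')) {p : P} (hp : V.IsPure p)
    (hc : V'.NoAdditiveCocycle) :
    ∃ T : K →ₗᵢ[ℂ] K', (∀ x u, T (V x u) = V' x (T u)) ∧
      ∀ x u, T (adj(V x) u) = adj(V' x) (T u) := by
  obtain ⟨θ, hθ⟩ := exists_isProductSystemMap h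
  set L : P → K → K' := IsProductSystemMap.oneMap V θ with hL
  have hadd : ∀ x y u, L (x + y) u = L x u + V' x (L y (adj(V x) u)) := hθ.oneMap_add hV hc
  have hle : ∀ x u, ‖L x u‖ ≤ ‖u‖ := fun x u =>
    (hθ.norm_oneMap hV hc x u).trans_le (norm_kerPart_le _ _)
  have hstep : ∀ (n : ℕ) y u, ‖L (n • p + y) u - L (n • p) u‖ ≤ ‖adj(V (n • p)) u‖ := fun n y u => by
    rw [hadd, add_sub_cancel_left, (V' _).norm_map]
    exact hle _ _
  have hp0 : ∀ u, Filter.Tendsto (fun n : ℕ => ‖adj(V (n • p)) u‖) Filter.atTop (nhds 0) :=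
    fun u => by simpa using (hp u).norm
  have hcauchy : ∀ u, CauchySeq fun n : ℕ => L (n • p) u := by
    intro u
    refine cauchySeq_of_le_tendsto_0' (fun n : ℕ => ‖adj(V (n • p)) u‖) (fun n m hnm => ?_) (hp0 u)
    obtain ⟨k, rfl⟩ := Nat.exists_eq_add_of_le hnm
    rw [dist_comm, dist_eq_norm, add_nsmul]
    exact hstep n _ u
  choose T hT using fun u => cauchySeq_tendsto_of_complete (hcauchy u)
  have hT' : ∀ y u, Filter.Tendsto (fun n : ℕ => L (y + n • p) u) Filter.atTop (nhds (T u)) := by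
    intro y u
    have h1 : Filter.Tendsto (fun n : ℕ => L (n • p + y) u - L (n • p) u) Filter.atTop (nhds 0) :=
      squeeze_zero_norm (fun n => hstep n y u) (hp0 u)
    have h2 := h1.add (hT u)
    rw [zero_add] at h2
    refine h2.congr fun n => ?_
    rw [sub_add_cancel, add_comm]
  have hnorm : ∀ u, ‖T u‖ = ‖u‖ := by
    intro u
    have h1 : Filter.Tendsto (fun n : ℕ => ‖L (n • p) u‖ ^ 2) Filter.atTop (nhds (‖u‖ ^ 2)) := by
      have h2 := ((hp0 u).pow 2).const_sub (‖u‖ ^ 2)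
      rw [zero_pow two_ne_zero, sub_zero] at h2
      refine h2.congr fun n => ?_
      rw [hθ.norm_oneMap hV hc, norm_kerPart_sq]
    have h2 := tendsto_nhds_unique ((hT u).norm.pow 2) h1
    exact (pow_left_inj₀ (norm_nonneg _) (norm_nonneg _) two_ne_zero).1 h2
  refine ⟨⟨⟨⟨T, fun u v => ?_⟩, fun c u => ?_⟩, hnorm⟩, fun x u => ?_, fun x u => ?_⟩
  · refine tendsto_nhds_unique (hT (u + v)) (((hT u).add (hT v)).congr fun n => ?_)
    rw [hL, IsProductSystemMap.oneMap, IsProductSystemMap.oneMap, IsProductSystemMap.oneMap,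
      IsProductSystemMap.oneImage_add_vec, map_add]
  · refine tendsto_nhds_unique (hT (c • u)) (((hT u).const_smul c).congr fun n => ?_)
    rw [hL, IsProductSystemMap.oneMap, IsProductSystemMap.oneMap,
      IsProductSystemMap.oneImage_smul, map_smul]
  · refine tendsto_nhds_unique (hT' x (V x u))
      ((((V' x).continuous.tendsto _).comp (hT u)).congr fun n => ?_)
    exact (hθ.oneMap_rep hV hc x _ u).symm
  · refine tendsto_nhds_unique (hT (adj(V x) u))
      (((((adj(V' x)).continuous).tendsto _).comp (hT' x u)).congr fun n => ?_)
    exact hθ.adj_oneMap_add hV hc x _ u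

end ProductSystem

/-! ### Translations of square integrable functions on the plane -/

section Plane

variable {k : Type u} [NormedAddCommGroup k] [InnerProductSpace ℂ k]

theorem coeFn_planeTranslate (x : ℝ × ℝ) (g : Lp k 2 (volume : Measure (ℝ × ℝ))) :
    planeTranslate k x g =ᵐ[volume] fun y => g (y - x) :=
  Lp.coeFn_compMeasurePreserving g (measurePreserving_sub x)

theorem ae_sub {p : ℝ × ℝ → Prop} (h : ∀ᵐ y, p y) (x : ℝ × ℝ) : ∀ᵐ y, p (y - x) :=
  (measurePreserving_sub x).quasiMeasurePreserving.ae h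

theorem inner_eq_zero_of_ae {f g : Lp k 2 (volume : Measure (ℝ × ℝ))}
    (h : ∀ᵐ y, f y = 0 ∨ g y = 0) : ⟪f, g⟫_ℂ = 0 := by
  rw [L2.inner_def]
  refine integral_eq_zero_of_ae ?_
  filter_upwards [h] with y hy
  rcases hy with hy | hy <;> simp [hy]

theorem Lp_eq_zero_of_ae {f : Lp k 2 (volume : Measure (ℝ × ℝ))} (h : ∀ᵐ y, f y = 0) : f = 0 :=
  (Lp.eq_zero_iff_ae_eq_zero).2 h

/-- A square integrable function `B` that agrees with its translate on a set that carries the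
translate is equal to the translate, since both have the same norm. -/
theorem eq_planeTranslate {B : Lp k 2 (volume : Measure (ℝ × ℝ))} {x : ℝ × ℝ}
    (h : ∀ᵐ y, B y = B (y - x) ∨ B (y - x) = 0) : planeTranslate k x B = B := by
  have h1 : ⟪B - planeTranslate k x B, planeTranslate k x B⟫_ℂ = 0 := by
    refine inner_eq_zero_of_ae ?_
    filter_upwards [h, coeFn_planeTranslate x B, Lp.coeFn_sub B (planeTranslate k x B)]
      with y hy h2 h3
    rw [h3, Pi.sub_apply, h2, sub_eq_zero]
    exact hy
  have h2 := norm_add_sq_eq_norm_sq_add_norm_sq_of_inner_eq_zero _ _ h1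
  rw [sub_add_cancel, (planeTranslate k x).norm_map, right_eq_add, mul_self_eq_zero,
    norm_eq_zero, sub_eq_zero] at h2
  exact h2.symm

/-- A square integrable function that is invariant under a translation, and vanishes on a half
plane, is zero: the half plane, on which it vanishes, can be moved. -/
theorem eq_zero_of_planeTranslate_eq {B : Lp k 2 (volume : Measure (ℝ × ℝ))} {x : ℝ × ℝ}
    (h : planeTranslate k x B = B) (l : ℝ × ℝ →+ ℝ) (hl : 0 < l x) {c : ℝ}
    (hB : ∀ᵐ y, l y < c → B y = 0) : B = 0 := by
  have h1 : ∀ n : ℕ, ∀ᵐ y, l y < c + n * l x → B y = 0 := by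
    intro n
    induction n with
    | zero => simpa using hB
    | succ n ih =>
      filter_upwards [ae_sub ih x, coeFn_planeTranslate x B] with y h2 h3 h4
      rw [h] at h3
      rw [h3]
      refine h2 ?_
      rw [map_sub]
      push_cast at h4
      linarith
  refine Lp_eq_zero_of_ae ?_
  filter_upwards [ae_all_iff.2 h1] with y hy
  obtain ⟨n, hn⟩ := exists_nat_gt ((l y - c) / l x)
  rw [div_lt_iff₀ hl] at hn
  exact hy n (by linarith)

/-! ### Shifts on the plane -/

variable {A : PlaneModule}

theorem extendZero_ae (f : A.L2 k) : ∀ᵐ y, y ∉ A.carrier → extendZeroₗᵢ A k f y = 0 := by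
  filter_upwards [coeFn_extendZero f] with y hy h
  exact hy.trans (Set.indicator_of_notMem h _)

theorem exists_extendZero_eq {g : Lp k 2 (volume : Measure (ℝ × ℝ))}
    (hg : ∀ᵐ y, y ∉ A.carrier → g y = 0) : ∃ f : A.L2 k, extendZeroₗᵢ A k f = g := by
  refine ⟨((Lp.memLp g).restrict A.carrier).toLp g, ?_⟩
  apply Lp.ext
  refine (coeFn_extendZero _).trans ?_
  have h1 : A.carrier.indicator (((Lp.memLp g).restrict A.carrier).toLp g) =ᵐ[volume]
      A.carrier.indicator g :=
    (ae_eq_restrict_iff_indicator_ae_eq A.isClosed.measurableSet).1 (MemLp.coeFn_toLp _)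
  refine h1.trans ?_
  filter_upwards [hg] with y hy
  by_cases h : y ∈ A.carrier
  · rw [Set.indicator_of_mem h]
  · rw [Set.indicator_of_notMem h, hy h]

/-- The translate `A + x`. -/
def PlaneModule.translate (A : PlaneModule) (x : ℝ≥0 × ℝ≥0) : Set (ℝ × ℝ) :=
  (fun y => y - toPlane x) ⁻¹' A.carrier

theorem PlaneModule.mem_translate {x : ℝ≥0 × ℝ≥0} {y : ℝ × ℝ} :
    y ∈ A.translate x ↔ y - toPlane x ∈ A.carrier := Iff.rfl

theorem PlaneModule.measurableSet_translate (x : ℝ≥0 × ℝ≥0) : MeasurableSet (A.translate x) :=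
  (measurePreserving_sub (toPlane x)).measurable A.isClosed.measurableSet

theorem extendZero_shift_ae (x : ℝ≥0 × ℝ≥0) (f : A.L2 k) :
    ∀ᵐ y, y ∉ A.translate x → extendZeroₗᵢ A k (shift A k x f) y = 0 := by
  rw [extendZeroₗᵢ_shift]
  filter_upwards [coeFn_planeTranslate (toPlane x) (extendZeroₗᵢ A k f),
    ae_sub (extendZero_ae f) (toPlane x)] with y h1 h2 h3
  rw [h1]
  exact h2 h3

variable [CompleteSpace k]

/-- The range projection of the shift by `x` is the multiplication by the indicator function of
`A + x`. -/
theorem extendZero_shift_adj (x : ℝ≥0 × ℝ≥0) (f : A.L2 k) :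
    extendZeroₗᵢ A k (shift A k x (adj(shift A k x) f)) =ᵐ[volume]
      (A.translate x).indicator (extendZeroₗᵢ A k f) := by
  set F := extendZeroₗᵢ A k f with hF
  have hm : MemLp ((A.translate x).indicator F) 2 volume :=
    (Lp.memLp F).indicator (PlaneModule.measurableSet_translate x)
  set G : Lp k 2 (volume : Measure (ℝ × ℝ)) := hm.toLp _ with hG
  have hG' : G =ᵐ[volume] (A.translate x).indicator F := hm.coeFn_toLp
  obtain ⟨h, hh⟩ : ∃ h : A.L2 k, extendZeroₗᵢ A k h = planeTranslate k (-toPlane x) G := by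
    refine exists_extendZero_eq ?_
    filter_upwards [coeFn_planeTranslate (-toPlane x) G, ae_sub hG' (-toPlane x)] with y h1 h2 h3
    rw [h1, h2, Set.indicator_of_notMem]
    rwa [PlaneModule.mem_translate, sub_neg_eq_add, add_sub_cancel_right]
  have hVh : extendZeroₗᵢ A k (shift A k x h) = G := by
    rw [extendZeroₗᵢ_shift, hh, ← planeTranslate_add, add_neg_cancel, planeTranslate_zero]
  have hadj : adj(shift A k x) f = h := by
    rw [← adjoint_apply_self (shift A k x) h, ← sub_eq_zero, ← map_sub]
    refine ext_inner_left ℂ fun w => ?_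
    rw [ContinuousLinearMap.adjoint_inner_right, inner_zero_right, ← (extendZeroₗᵢ A k).inner_map_map,
      map_sub, hVh]
    refine inner_eq_zero_of_ae ?_
    filter_upwards [extendZero_shift_ae x w, hG', Lp.coeFn_sub F G] with y h1 h2 h3
    by_cases hy : y ∈ A.translate x
    · right
      rw [h3, Pi.sub_apply, h2, Set.indicator_of_mem hy, sub_self]
    · exact Or.inl (h1 hy)
  rw [hadj, hVh]
  exact hG'

theorem shift_adj_eq_self_iff (x : ℝ≥0 × ℝ≥0) (f : A.L2 k) :
    shift A k x (adj(shift A k x) f) = f ↔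
      ∀ᵐ y, y ∉ A.translate x → extendZeroₗᵢ A k f y = 0 := by
  rw [← (extendZeroₗᵢ A k).injective.eq_iff, Lp.ext_iff]
  constructor
  · intro h
    filter_upwards [h, extendZero_shift_adj x f] with y h1 h2 h3
    rw [← h1, h2, Set.indicator_of_notMem h3]
  · intro h
    filter_upwards [h, extendZero_shift_adj x f] with y h1 h2
    rw [h2]
    by_cases hy : y ∈ A.translate x
    · rw [Set.indicator_of_mem hy]
    · rw [Set.indicator_of_notMem hy, h1 hy]

theorem adj_shift_eq_zero_iff (x : ℝ≥0 × ℝ≥0) (f : A.L2 k) :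
    adj(shift A k x) f = 0 ↔ ∀ᵐ y, y ∈ A.translate x → extendZeroₗᵢ A k f y = 0 := by
  rw [← (shift A k x).injective.eq_iff, map_zero, ← (extendZeroₗᵢ A k).injective.eq_iff, map_zero]
  constructor
  · intro h
    have h0 := Lp.eq_zero_iff_ae_eq_zero.1 h
    filter_upwards [h0, extendZero_shift_adj x f] with y h1 h2 h3
    rw [h1, Set.indicator_of_mem h3] at h2
    exact h2.symm
  · intro h
    refine Lp_eq_zero_of_ae ?_
    filter_upwards [h, extendZero_shift_adj x f] with y h1 h2
    rw [h2]
    by_cases hy : y ∈ A.translate x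
    · rw [Set.indicator_of_mem hy, h1 hy]
    · rw [Set.indicator_of_notMem hy]

end Plane

/-! ### The modules `[1, ∞) × [a, 0) ∪ [0, ∞) × [0, ∞)` -/

section Step

variable {k : Type u} [NormedAddCommGroup k] [InnerProductSpace ℂ k] [CompleteSpace k]

theorem mem_stepModule {a : ℝ} {y : ℝ × ℝ} :
    y ∈ (stepModule a).carrier ↔ (1 ≤ y.1 ∧ a ≤ y.2) ∨ (0 ≤ y.1 ∧ 0 ≤ y.2) := by
  simp only [stepModule, Set.mem_union, Set.mem_prod, Set.mem_Ici, Set.mem_Ico]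
  constructor
  · rintro (h | h)
    · exact Or.inl ⟨h.1, h.2.1⟩
    · exact Or.inr h
  · rintro (h | h)
    · by_cases hq : y.2 < 0
      · exact Or.inl ⟨h.1, h.2, hq⟩
      · exact Or.inr ⟨by linarith [h.1], by linarith⟩
    · exact Or.inr h

theorem mem_stepModule_translate {a : ℝ} {x : ℝ≥0 × ℝ≥0} {y : ℝ × ℝ} :
    y ∈ (stepModule a).translate x ↔
      (1 + (x.1 : ℝ) ≤ y.1 ∧ a + x.2 ≤ y.2) ∨ ((x.1 : ℝ) ≤ y.1 ∧ (x.2 : ℝ) ≤ y.2) := by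
  rw [PlaneModule.mem_translate, mem_stepModule]
  simp only [toPlane, Prod.fst_sub, Prod.snd_sub, le_sub_iff_add_le, zero_add]

theorem stepRep_isPure (a : ℝ) : (stepRep k a).IsPure (1, 1) := by
  intro f
  set F := extendZeroₗᵢ (stepModule a) k f with hF
  rw [tendsto_zero_iff_norm_tendsto_zero]
  have h1 : ∀ n : ℕ, ‖adj(stepRep k a (n • (1, 1))) f‖ ^ 2
      = ∫ y, ‖((stepModule a).translate (n • (1, 1))).indicator F y‖ ^ 2 := by
    intro n
    rw [← (shift (stepModule a) k (n • (1, 1))).norm_map,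
      ← (extendZeroₗᵢ (stepModule a) k).norm_map]
    have h2 : ∀ g : Lp k 2 (volume : Measure (ℝ × ℝ)), ‖g‖ ^ 2 = ∫ y, ‖g y‖ ^ 2 := by
      intro g
      have h3 := L2.inner_def (𝕜 := ℂ) g g
      simp only [inner_self_eq_norm_sq_to_K] at h3
      have h4 : ((‖g‖ ^ 2 : ℝ) : ℂ) = ((∫ y, ‖g y‖ ^ 2 : ℝ) : ℂ) := by
        rw [← integral_complex_ofReal]
        push_cast
        exact h3
      exact_mod_cast h4
    rw [h2]
    refine integral_congr_ae ?_
    filter_upwards [extendZero_shift_adj (n • (1, 1)) f] with y hy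
    exact congrArg (fun z : k => ‖z‖ ^ 2) hy
  have h2 : Filter.Tendsto (fun n : ℕ => ‖adj(stepRep k a (n • (1, 1))) f‖ ^ 2) Filter.atTop
      (nhds 0) := by
    simp only [h1]
    rw [← integral_zero (ℝ × ℝ) ℝ]
    refine tendsto_integral_of_dominated_convergence (fun y => ‖F y‖ ^ 2) (fun n => ?_) ?_
      (fun n => ?_) ?_
    · exact (((Lp.memLp F).indicator
        (PlaneModule.measurableSet_translate _)).aestronglyMeasurable.norm).pow 2
    · exact (memLp_two_iff_integrable_sq_norm (Lp.aestronglyMeasurable F)).1 (Lp.memLp F)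
    · refine Filter.Eventually.of_forall fun y => ?_
      rw [Real.norm_eq_abs, abs_of_nonneg (by positivity)]
      gcongr
      exact norm_indicator_le_norm_self _ _
    · refine Filter.Eventually.of_forall fun y => ?_
      refine tendsto_const_nhds.congr' ?_
      obtain ⟨N, hN⟩ := exists_nat_gt y.1
      filter_upwards [Filter.eventually_ge_atTop N] with n hn
      rw [Set.indicator_of_notMem, norm_zero, zero_pow two_ne_zero]
      rw [mem_stepModule_translate]
      have : (N : ℝ) ≤ n := by exact_mod_cast hn
      simp only [Prod.smul_mk, nsmul_eq_mul, mul_one, NNReal.coe_natCast]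
      rintro (h | h) <;> linarith [h.1]
  have h3 := (Real.continuous_sqrt.tendsto 0).comp h2
  rw [Real.sqrt_zero] at h3
  exact h3.congr fun n => by rw [Function.comp_apply, Real.sqrt_sq (norm_nonneg _)]

/-- On the part of the plane to the left of the line `y.1 = 1`, a horizontal additive cocycle is
invariant under vertical translations, hence vanishes; to the right of the line `y.1 = 2`, a
vertical one is then invariant under horizontal translations, so that all vertical ones vanish, and
the horizontal ones are invariant under vertical translations on the whole plane. -/
theorem stepRep_noAdditiveCocycle {a : ℝ} (ha : a < 0) : (stepRep k a).NoAdditiveCocycle := by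
  intro ξ hker hadd
  set J := extendZeroₗᵢ (stepModule a) k with hJ
  -- Horizontal and vertical cocycles, extended by zero to the plane.
  set b : ℝ≥0 → Lp k 2 (volume : Measure (ℝ × ℝ)) := fun s => J (ξ (s, 0)) with hb
  set c : ℝ≥0 → Lp k 2 (volume : Measure (ℝ × ℝ)) := fun t => J (ξ (0, t)) with hc
  have hb0 : ∀ s, ∀ᵐ y, y ∉ (stepModule a).carrier → b s y = 0 := fun s => extendZero_ae _
  have hc0 : ∀ t, ∀ᵐ y, y ∉ (stepModule a).carrier → c t y = 0 := fun t => extendZero_ae _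
  have hb1 : ∀ s, ∀ᵐ y, y ∈ (stepModule a).translate (s, 0) → b s y = 0 := fun s =>
    (adj_shift_eq_zero_iff _ _).1 (hker _)
  have hc1 : ∀ t, ∀ᵐ y, y ∈ (stepModule a).translate (0, t) → c t y = 0 := fun t =>
    (adj_shift_eq_zero_iff _ _).1 (hker _)
  have heq : ∀ s t : ℝ≥0, ∀ᵐ y : ℝ × ℝ,
      b s y + c t (y - ((s : ℝ), 0)) = c t y + b s (y - (0, (t : ℝ))) := by
    intro s t
    have h1 : ξ (s, 0) + shift (stepModule a) k (s, 0) (ξ (0, t))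
        = ξ (0, t) + shift (stepModule a) k (0, t) (ξ (s, 0)) := by
      have h2 := hadd (s, 0) (0, t)
      have h3 := hadd (0, t) (s, 0)
      rw [add_comm (0, t), h2] at h3
      exact h3
    have h2 := congrArg J h1
    rw [map_add, map_add, hJ, extendZeroₗᵢ_shift, extendZeroₗᵢ_shift, ← hJ] at h2
    have h3 := Lp.coeFn_add (b s) (planeTranslate k (toPlane (s, 0)) (c t))
    have h4 := Lp.coeFn_add (c t) (planeTranslate k (toPlane (0, t)) (b s))
    change b s + planeTranslate k (toPlane (s, 0)) (c t)
      = c t + planeTranslate k (toPlane (0, t)) (b s) at h2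
    rw [h2] at h3
    filter_upwards [h3, h4, coeFn_planeTranslate (toPlane (s, 0)) (c t),
      coeFn_planeTranslate (toPlane (0, t)) (b s)] with y h5 h6 h7 h8
    rw [h5, Pi.add_apply, Pi.add_apply, h7, h8] at h6
    simpa [toPlane] using h6
  -- The cocycle `b 1` vanishes on the half plane `y.1 < 1`.
  have hb2 : ∀ᵐ y : ℝ × ℝ, y.1 < 1 → b 1 y = 0 := by
    have hmeas : MeasurableSet {y : ℝ × ℝ | y.1 < 1} :=
      measurableSet_lt measurable_fst measurable_const
    have hm : MemLp ({y : ℝ × ℝ | y.1 < 1}.indicator (b 1)) 2 volume :=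
      (Lp.memLp (b 1)).indicator hmeas
    set B : Lp k 2 (volume : Measure (ℝ × ℝ)) := hm.toLp _ with hB
    have hB' : B =ᵐ[volume] {y : ℝ × ℝ | y.1 < 1}.indicator (b 1) := hm.coeFn_toLp
    have hB0 : ∀ᵐ y : ℝ × ℝ, y.2 < 0 → B y = 0 := by
      filter_upwards [hB', hb0 1] with y h1 h2 h3
      rw [h1]
      by_cases hy : y ∈ {y : ℝ × ℝ | y.1 < 1}
      · rw [Set.indicator_of_mem hy]
        refine h2 ?_
        rw [mem_stepModule]
        rintro (h | h)
        · exact absurd h.1 (not_le.2 hy)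
        · linarith [h.2]
      · rw [Set.indicator_of_notMem hy]
    have hinv : planeTranslate k (0, 1) B = B := by
      refine eq_planeTranslate ?_
      filter_upwards [hB', ae_sub hB' (0, 1), ae_sub hB0 (0, 1), heq 1 1,
        ae_sub (hc0 1) (1, 0), hc0 1, hc1 1] with y h1 h2 h3 h4 h5 h6 h7
      by_cases hy2 : y.2 < 1
      · right
        exact h3 (by simpa using hy2)
      left
      rw [h1, h2]
      by_cases hy : y.1 < 1
      · rw [Set.indicator_of_mem (s := {y : ℝ × ℝ | y.1 < 1}) hy,
          Set.indicator_of_mem (s := {y : ℝ × ℝ | y.1 < 1}) (by simpa using hy)]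
        have h8 : c 1 (y - (1, 0)) = 0 := by
          refine h5 ?_
          rw [mem_stepModule]
          rintro (h | h) <;> simp only [Prod.fst_sub] at h <;> linarith [h.1]
        have h9 : c 1 y = 0 := by
          by_cases h10 : y ∈ (stepModule a).carrier
          · refine h7 ?_
            rw [mem_stepModule] at h10
            rw [mem_stepModule_translate]
            right
            rcases h10 with h | h
            · linarith [h.1]
            · exact ⟨h.1, not_lt.1 hy2⟩
          · exact h6 h10
        simp only [NNReal.coe_one] at h4
        rwa [h8, h9, add_zero, zero_add] at h4
      · rw [Set.indicator_of_notMem (s := {y : ℝ × ℝ | y.1 < 1}) hy,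
          Set.indicator_of_notMem (s := {y : ℝ × ℝ | y.1 < 1}) (by simpa using hy)]
    have hBz := eq_zero_of_planeTranslate_eq hinv (AddMonoidHom.snd ℝ ℝ) (by simp) (c := 0) hB0
    have h0 := Lp.eq_zero_iff_ae_eq_zero.1 hBz
    filter_upwards [hB', h0] with y h1 h2 h3
    rw [h2, Set.indicator_of_mem (s := {y : ℝ × ℝ | y.1 < 1}) h3] at h1
    exact h1.symm
  -- The vertical cocycles vanish: they do so for `y.1 < 1`, and `b 1` drops out for `2 ≤ y.1`.
  have hcz : ∀ t, c t = 0 := by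
    intro t
    have hc2 : ∀ᵐ y : ℝ × ℝ, y.1 < 1 → c t y = 0 := by
      filter_upwards [heq 1 t, hb2, ae_sub hb2 (0, (t : ℝ)), ae_sub (hc0 t) (1, 0)]
        with y h1 h2 h3 h4 h5
      have h8 : c t (y - (1, 0)) = 0 := by
        refine h4 ?_
        rw [mem_stepModule]
        rintro (h | h) <;> simp only [Prod.fst_sub] at h <;> linarith [h.1]
      simp only [NNReal.coe_one] at h1
      rw [h2 h5, h3 (by simpa using h5), h8, add_zero, add_zero] at h1
      exact h1.symm
    have hb3 : ∀ᵐ y : ℝ × ℝ, 2 ≤ y.1 → b 1 y = 0 := by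
      filter_upwards [hb0 1, hb1 1] with y h1 h2 h3
      by_cases h10 : y ∈ (stepModule a).carrier
      · refine h2 ?_
        rw [mem_stepModule] at h10
        rw [mem_stepModule_translate]
        left
        simp only [NNReal.coe_one, NNReal.coe_zero]
        refine ⟨by linarith, ?_⟩
        rcases h10 with h | h <;> linarith [h.2]
      · exact h1 h10
    have hinv : planeTranslate k (1, 0) (c t) = c t := by
      refine eq_planeTranslate ?_
      filter_upwards [heq 1 t, hb3, ae_sub hb3 (0, (t : ℝ)), ae_sub hc2 (1, 0)] with y h1 h2 h3 h4
      by_cases hy : y.1 < 2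
      · right
        refine h4 ?_
        simp only [Prod.fst_sub]
        linarith
      · left
        simp only [NNReal.coe_one] at h1
        rw [h2 (not_lt.1 hy), h3 (by simpa using hy), add_zero, zero_add] at h1
        exact h1.symm
    exact eq_zero_of_planeTranslate_eq hinv (AddMonoidHom.fst ℝ ℝ) (by simp) (c := 1) hc2
  -- The horizontal cocycles are now invariant under vertical translations, and vanish as well.
  have hbz : ∀ s, b s = 0 := by
    intro s
    have h0 := Lp.eq_zero_iff_ae_eq_zero.1 (hcz 1)
    have hinv : planeTranslate k (0, 1) (b s) = b s := by
      refine eq_planeTranslate ?_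
      filter_upwards [heq s 1, h0, ae_sub h0 ((s : ℝ), 0)] with y h1 h2 h3
      left
      rw [h2, h3] at h1
      simpa using h1
    refine eq_zero_of_planeTranslate_eq hinv (AddMonoidHom.snd ℝ ℝ) (by simp) (c := a) ?_
    filter_upwards [hb0 s] with y h1 h2
    refine h1 ?_
    rw [mem_stepModule]
    have h2' : y.2 < a := h2
    rintro (h | h) <;> linarith [h.2]
  have hJ0 : ∀ f, J f = 0 → f = 0 := fun f hf => J.injective (by rw [hf, map_zero])
  intro x
  have h1 := hadd (x.1, 0) (0, x.2)
  rw [hJ0 _ (hbz x.1), hJ0 _ (hcz x.2), map_zero, add_zero] at h1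
  simpa using h1

end Step

/-! ### The depth of the step as an invariant -/

section Depth

variable {k : Type u} [NormedAddCommGroup k] [InnerProductSpace ℂ k] [CompleteSpace k]

/-- A vector of `ker V(1,0)*` that some vertical shift moves into the range of `V(1,0)` is
supported in `[1, 2) × [a, 0)`, so that the vertical shift by `-a` already moves it there. -/
theorem shift_mem_range_of_depth {a : ℝ} {d : ℝ≥0} (hd : -a = d)
    {f : (stepModule a).L2 k} (hf : adj(shift (stepModule a) k (1, 0)) f = 0) {t : ℝ≥0}
    (ht : shift (stepModule a) k (1, 0) (adj(shift (stepModule a) k (1, 0))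
      (shift (stepModule a) k (0, t) f)) = shift (stepModule a) k (0, t) f) :
    shift (stepModule a) k (1, 0) (adj(shift (stepModule a) k (1, 0))
      (shift (stepModule a) k (0, d) f)) = shift (stepModule a) k (0, d) f := by
  rw [shift_adj_eq_self_iff, extendZeroₗᵢ_shift] at ht ⊢
  rw [adj_shift_eq_zero_iff] at hf
  set F := extendZeroₗᵢ (stepModule a) k f with hF
  have h1 : ∀ᵐ y : ℝ × ℝ, y.2 + t ∉ Set.Iio (0 : ℝ) → y.1 < 1 → F y = 0 := by
    have h3 : ∀ᵐ y, y ∉ (stepModule a).translate (1, 0) → F (y - toPlane (0, t)) = 0 := by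
      filter_upwards [ht, coeFn_planeTranslate (toPlane (0, t)) F] with y h1 h2 h3
      rw [← h2, h1 h3]
    filter_upwards [ae_sub h3 (-toPlane (0, t))] with y h4 h5 h6
    rw [sub_neg_eq_add, add_sub_cancel_right] at h4
    refine h4 ?_
    rw [mem_stepModule_translate]
    simp only [toPlane, Prod.fst_add, Prod.snd_add, NNReal.coe_one, NNReal.coe_zero]
    rintro (h | h) <;> linarith [h.1]
  filter_upwards [ae_sub h1 (toPlane (0, d)), ae_sub hf (toPlane (0, d)),
    ae_sub (extendZero_ae f) (toPlane (0, d)), coeFn_planeTranslate (toPlane (0, d)) F]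
    with y h2 h3 h4 h5 h6
  rw [h5]
  by_cases hA : y - toPlane (0, d) ∈ (stepModule a).carrier
  · by_cases hT : y - toPlane (0, d) ∈ (stepModule a).translate (1, 0)
    · exact h3 hT
    · have hdc : (d : ℝ) = -a := hd.symm
      have ht0 : (0 : ℝ) ≤ t := t.2
      rw [mem_stepModule] at hA
      rw [mem_stepModule_translate] at h6 hT
      simp only [toPlane, Prod.fst_sub, Prod.snd_sub, NNReal.coe_one, NNReal.coe_zero, sub_zero,
        add_zero, Set.mem_Iio, not_lt, not_or, not_and] at hA h2 h6 hT
      rcases hA with hA | hA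
      · exact absurd (by linarith [hA.2] : (0 : ℝ) ≤ y.2) (h6.2 hA.1)
      · refine h2 (by linarith [hA.2]) ?_
        by_contra h7
        exact hT.2 (not_lt.1 h7) hA.2
  · exact h4 hA

/-- For `a < a'`, the property of `shift_mem_range_of_depth` fails with `-a'` in place of `-a`:
a witness is the indicator function of `[1, 2) × [a, a')`. -/
theorem exists_shift_notMem_range [Nontrivial k] {a a' : ℝ} (haa' : a < a') {d d' : ℝ≥0}
    (hd : -a = d) (hd' : -a' = d') :
    ∃ f : (stepModule a).L2 k, adj(shift (stepModule a) k (1, 0)) f = 0 ∧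
      shift (stepModule a) k (1, 0) (adj(shift (stepModule a) k (1, 0))
        (shift (stepModule a) k (0, d) f)) = shift (stepModule a) k (0, d) f ∧
      shift (stepModule a) k (1, 0) (adj(shift (stepModule a) k (1, 0))
        (shift (stepModule a) k (0, d') f)) ≠ shift (stepModule a) k (0, d') f := by
  obtain ⟨v, hv⟩ := exists_ne (0 : k)
  have hdc : (d : ℝ) = -a := hd.symm
  have hdc' : (d' : ℝ) = -a' := hd'.symm
  have hd0 : (0 : ℝ) ≤ d' := d'.2
  set S : Set (ℝ × ℝ) := Set.Ico 1 2 ×ˢ Set.Ico a a' with hS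
  have hSm : MeasurableSet S := measurableSet_Ico.prod measurableSet_Ico
  have hSv : volume S = ENNReal.ofReal 1 * ENNReal.ofReal (a' - a) := by
    rw [hS, Measure.volume_eq_prod, Measure.prod_prod, Real.volume_Ico, Real.volume_Ico]
    norm_num
  have hSt : volume S ≠ ∞ := by
    rw [hSv]
    exact ENNReal.mul_ne_top ENNReal.ofReal_ne_top ENNReal.ofReal_ne_top
  have hS0 : volume S ≠ 0 := by
    rw [hSv, ENNReal.ofReal_one, one_mul]
    exact (ENNReal.ofReal_pos.2 (by linarith)).ne'
  set G : Lp k 2 (volume : Measure (ℝ × ℝ)) := indicatorConstLp 2 hSm hSt v with hG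
  have hG' : G =ᵐ[volume] S.indicator fun _ => v := indicatorConstLp_coeFn
  have hG0 : ∀ᵐ y, y ∉ S → G y = 0 := by
    filter_upwards [hG'] with y h1 h2
    rw [h1, Set.indicator_of_notMem h2]
  have hmem : ∀ y, y ∈ S ↔ (1 ≤ y.1 ∧ y.1 < 2) ∧ a ≤ y.2 ∧ y.2 < a' := fun y => by
    simp [hS, Set.mem_prod]
  obtain ⟨f, hf⟩ : ∃ f : (stepModule a).L2 k, extendZeroₗᵢ (stepModule a) k f = G := by
    refine exists_extendZero_eq ?_
    filter_upwards [hG0] with y h1 h2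
    refine h1 fun h3 => h2 ?_
    rw [mem_stepModule]
    rw [hmem] at h3
    exact Or.inl ⟨h3.1.1, h3.2.1⟩
  refine ⟨f, ?_, ?_, ?_⟩
  · rw [adj_shift_eq_zero_iff, hf]
    filter_upwards [hG0] with y h1 h2
    refine h1 fun h3 => ?_
    rw [mem_stepModule_translate] at h2
    rw [hmem] at h3
    simp only [NNReal.coe_one, NNReal.coe_zero] at h2
    rcases h2 with h | h <;> linarith [h.1, h.2, h3.1.1, h3.1.2, h3.2.2]
  · rw [shift_adj_eq_self_iff, extendZeroₗᵢ_shift, hf]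
    filter_upwards [ae_sub hG0 (toPlane (0, d)), coeFn_planeTranslate (toPlane (0, d)) G]
      with y h1 h2 h3
    rw [h2]
    refine h1 fun h4 => h3 ?_
    rw [mem_stepModule_translate]
    rw [hmem] at h4
    simp only [toPlane, Prod.fst_sub, Prod.snd_sub, NNReal.coe_one, NNReal.coe_zero, sub_zero]
      at h4 ⊢
    exact Or.inr ⟨h4.1.1, by linarith [h4.2.1]⟩
  · rw [Ne, shift_adj_eq_self_iff, extendZeroₗᵢ_shift, hf]
    intro h
    have h1 : ∀ᵐ y, y ∉ S := by
      have h3 : ∀ᵐ y, y ∉ (stepModule a).translate (1, 0) → G (y - toPlane (0, d')) = 0 := by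
        filter_upwards [h, coeFn_planeTranslate (toPlane (0, d')) G] with y h1 h2 h3
        rw [← h2, h1 h3]
      filter_upwards [ae_sub h3 (-toPlane (0, d')), hG'] with y h4 h5 h6
      rw [sub_neg_eq_add, add_sub_cancel_right, h5, Set.indicator_of_mem h6] at h4
      refine hv (h4 ?_)
      rw [mem_stepModule_translate]
      rw [hmem] at h6
      simp only [toPlane, Prod.fst_add, Prod.snd_add, NNReal.coe_one, NNReal.coe_zero, add_zero]
      rintro (h | h) <;> linarith [h.1, h.2, h6.1.2, h6.2.2]
    refine hS0 ?_
    rw [ae_iff] at h1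
    simpa using h1

/-- An intertwining isometry can only exist if the target has at least the same depth. -/
theorem not_lt_of_intertwining {k' : Type v} [NormedAddCommGroup k'] [InnerProductSpace ℂ k']
    [CompleteSpace k'] [Nontrivial k] {a a' : ℝ} (ha' : a' < 0)
    (T : (stepModule a).L2 k →ₗᵢ[ℂ] (stepModule a').L2 k')
    (hT : ∀ x u, T (stepRep k a x u) = stepRep k' a' x (T u))
    (hT' : ∀ x u, T (adj(stepRep k a x) u) = adj(stepRep k' a' x) (T u)) : ¬ a < a' := by
  intro h
  obtain ⟨f, h1, h2, h3⟩ := exists_shift_notMem_range (k := k) h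
    (d := ⟨-a, by linarith⟩) (d' := ⟨-a', by linarith⟩) rfl rfl
  have hV : ∀ x u, T (shift (stepModule a) k x u) = shift (stepModule a') k' x (T u) := hT
  have hV' : ∀ x u, T (adj(shift (stepModule a) k x) u) = adj(shift (stepModule a') k' x) (T u) :=
    hT'
  have h4 := shift_mem_range_of_depth (d := ⟨-a', by linarith⟩) rfl (f := T f)
    (by rw [← hV', h1, map_zero]) (t := ⟨-a, by linarith⟩)
    (by rw [← hV, ← hV', ← hV]; exact congrArg T h2)
  rw [← hV, ← hV', ← hV] at h4
  exact h3 (T.injective h4)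

end Depth

/-! ### The multiplicity as an invariant -/

section Multiplicity

/-- An integrable function is determined on the quadrant `[1, ∞) × [0, ∞)` by its integrals over
translated quadrants. -/
theorem ae_eq_zero_of_integral_quadrant {h : ℝ × ℝ → ℂ} (hi : Integrable h)
    (H : ∀ p q : ℝ, 1 ≤ p → 0 ≤ q → ∫ y in Set.Ici p ×ˢ Set.Ici q, h y = 0) :
    ∀ᵐ y, y ∈ Set.Ici (1 : ℝ) ×ˢ Set.Ici (0 : ℝ) → h y = 0 := by
  set Q : Set (ℝ × ℝ) := Set.Ici (1 : ℝ) ×ˢ Set.Ici (0 : ℝ) with hQ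
  have hQm : MeasurableSet Q := measurableSet_Ici.prod measurableSet_Ici
  have hspan : IsCountablySpanning (Set.range (Set.Ici : ℝ → Set ℝ)) := by
    refine ⟨fun n : ℕ => Set.Ici (-(n : ℝ)), fun n => ⟨_, rfl⟩, ?_⟩
    refine Set.eq_univ_of_forall fun y => ?_
    obtain ⟨n, hn⟩ := exists_nat_gt (-y)
    exact Set.mem_iUnion.2 ⟨n, by simpa using (by linarith : -(n : ℝ) ≤ y)⟩
  have hgen : MeasurableSpace.generateFrom (Set.range (Set.Ici : ℝ → Set ℝ))
      = inferInstanceAs (MeasurableSpace ℝ) := by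
    rw [← borel_eq_generateFrom_Ici]
    exact (BorelSpace.measurable_eq (α := ℝ)).symm
  have hprod := generateFrom_eq_prod hgen hgen hspan hspan
  have hint : Integrable h (volume.restrict Q) := hi.restrict
  have huniv : ∫ y, h y ∂(volume.restrict Q) = 0 := H 1 0 le_rfl le_rfl
  have hz : ∀ s, MeasurableSet s → ∫ y in s, h y ∂(volume.restrict Q) = 0 := by
    refine MeasurableSpace.induction_on_inter hprod.symm
      ((isPiSystem_Ici (α := ℝ)).prod (isPiSystem_Ici (α := ℝ))) ?_ ?_ ?_ ?_
    · simp
    · rintro _ ⟨_, ⟨p, rfl⟩, _, ⟨q, rfl⟩, rfl⟩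
      rw [Measure.restrict_restrict (measurableSet_Ici.prod measurableSet_Ici), hQ,
        Set.prod_inter_prod, Set.Ici_inter_Ici, Set.Ici_inter_Ici]
      exact H _ _ le_sup_right le_sup_right
    · intro s hs h0
      have := integral_add_compl hs hint
      rw [h0, zero_add, huniv] at this
      exact this
    · intro s hd hs h0
      rw [integral_iUnion hs hd hint.integrableOn]
      simp [h0]
  have h0 := hint.ae_eq_zero_of_forall_setIntegral_eq_zero fun s hs _ => hz s hs
  rwa [Filter.EventuallyEq, ae_restrict_iff' hQm] at h0

variable {k : Type u} [NormedAddCommGroup k] [InnerProductSpace ℂ k] [CompleteSpace k]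
variable {k' : Type v} [NormedAddCommGroup k'] [InnerProductSpace ℂ k'] [CompleteSpace k']

theorem quadrant_eq_inter_translate {a : ℝ} {d : ℝ≥0} (hd : -a = d) (s t : ℝ≥0) :
    Set.Ici (1 + (s : ℝ)) ×ˢ Set.Ici (t : ℝ) = (stepModule a).translate (1 + s, t) ∩
      (stepModule a).translate (s, t + d) := by
  ext y
  have hs := s.2
  have hd0 := d.2
  simp only [Set.mem_inter_iff, mem_stepModule_translate, Set.mem_prod, Set.mem_Ici,
    NNReal.coe_add, NNReal.coe_one]
  constructor
  · rintro ⟨h1, h2⟩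
    exact ⟨Or.inr ⟨h1, h2⟩, Or.inl ⟨h1, by linarith⟩⟩
  · rintro ⟨h1 | h1, h2 | h2⟩ <;>
      exact ⟨by linarith [h1.1, h2.1, d.coe_nonneg], by linarith [h1.2, h2.2, d.coe_nonneg]⟩

theorem inner_extendZero_inter_translate {A : PlaneModule} (f g : A.L2 k) (x y : ℝ≥0 × ℝ≥0) :
    ⟪shift A k x (adj(shift A k x) f), shift A k y (adj(shift A k y) g)⟫_ℂ
      = ∫ z in A.translate x ∩ A.translate y,
          ⟪extendZeroₗᵢ A k f z, extendZeroₗᵢ A k g z⟫_ℂ := by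
  rw [← (extendZeroₗᵢ A k).inner_map_map, L2.inner_def, ← integral_indicator
    ((PlaneModule.measurableSet_translate x).inter (PlaneModule.measurableSet_translate y))]
  refine integral_congr_ae ?_
  filter_upwards [extendZero_shift_adj x f, extendZero_shift_adj y g] with z h1 h2
  rw [h1, h2]
  by_cases hx : z ∈ A.translate x
  · by_cases hy : z ∈ A.translate y
    · rw [Set.indicator_of_mem hx, Set.indicator_of_mem hy, Set.indicator_of_mem
        (s := A.translate x ∩ A.translate y) (Set.mem_inter hx hy)]
    · rw [Set.indicator_of_notMem hy, inner_zero_right,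
        Set.indicator_of_notMem (s := A.translate x ∩ A.translate y) fun h => hy h.2]
  · rw [Set.indicator_of_notMem hx, inner_zero_left,
      Set.indicator_of_notMem (s := A.translate x ∩ A.translate y) fun h => hx h.1]

/-- An isometry that intertwines the shifts and their adjoints preserves the inner products of
functions pointwise, since it commutes with the range projections of the shifts. -/
theorem inner_ae_eq_of_intertwining {a : ℝ} (ha : a < 0)
    (T : (stepModule a).L2 k →ₗᵢ[ℂ] (stepModule a).L2 k')
    (hT : ∀ x u, T (stepRep k a x u) = stepRep k' a x (T u))
    (hT' : ∀ x u, T (adj(stepRep k a x) u) = adj(stepRep k' a x) (T u))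
    (f g : (stepModule a).L2 k) :
    ∀ᵐ y : ℝ × ℝ, y ∈ Set.Ici (1 : ℝ) ×ˢ Set.Ici (0 : ℝ) →
      ⟪extendZeroₗᵢ (stepModule a) k' (T f) y, extendZeroₗᵢ (stepModule a) k' (T g) y⟫_ℂ
        = ⟪extendZeroₗᵢ (stepModule a) k f y, extendZeroₗᵢ (stepModule a) k g y⟫_ℂ := by
  have hV : ∀ x u, T (shift (stepModule a) k x (adj(shift (stepModule a) k x) u))
      = shift (stepModule a) k' x (adj(shift (stepModule a) k' x) (T u)) := fun x u =>
    (hT x _).trans (congrArg _ (hT' x u))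
  have hi := (L2.integrable_inner (𝕜 := ℂ) (extendZeroₗᵢ (stepModule a) k' (T f))
    (extendZeroₗᵢ (stepModule a) k' (T g)))
  have hi' := (L2.integrable_inner (𝕜 := ℂ) (extendZeroₗᵢ (stepModule a) k f)
    (extendZeroₗᵢ (stepModule a) k g))
  have key := ae_eq_zero_of_integral_quadrant (hi.sub hi') (fun p q hp hq => by
    obtain ⟨s, rfl⟩ : ∃ s : ℝ≥0, 1 + (s : ℝ) = p :=
      ⟨⟨p - 1, by linarith⟩, add_sub_cancel 1 p⟩
    lift q to ℝ≥0 using hq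
    rw [quadrant_eq_inter_translate (d := ⟨-a, by linarith⟩) rfl]
    simp only [Pi.sub_apply]
    rw [integral_sub hi.restrict hi'.restrict, ← inner_extendZero_inter_translate,
      ← inner_extendZero_inter_translate, ← hV, ← hV, T.inner_map_map, sub_self])
  filter_upwards [key] with y h1 h2
  exact sub_eq_zero.1 (h1 h2)

/-- Evaluation of the images of constant functions at a suitable point preserves orthonormality. -/
theorem exists_orthonormal_of_intertwining {a : ℝ} (ha : a < 0)
    (T : (stepModule a).L2 k →ₗᵢ[ℂ] (stepModule a).L2 k')
    (hT : ∀ x u, T (stepRep k a x u) = stepRep k' a x (T u))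
    (hT' : ∀ x u, T (adj(stepRep k a x) u) = adj(stepRep k' a x) (T u))
    {n : ℕ} {v : Fin n → k} (hv : Orthonormal ℂ v) : ∃ w : Fin n → k', Orthonormal ℂ w := by
  set S : Set (ℝ × ℝ) := Set.Ico 1 2 ×ˢ Set.Ico 0 1 with hS
  have hSm : MeasurableSet S := measurableSet_Ico.prod measurableSet_Ico
  have hSv : volume S = 1 := by
    rw [hS, Measure.volume_eq_prod, Measure.prod_prod, Real.volume_Ico, Real.volume_Ico]
    norm_num
  have hSt : volume S ≠ ∞ := by simp [hSv]
  have hG : ∀ i, ∃ f : (stepModule a).L2 k,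
      extendZeroₗᵢ (stepModule a) k f = indicatorConstLp 2 hSm hSt (v i) := by
    intro i
    refine exists_extendZero_eq ?_
    filter_upwards [indicatorConstLp_coeFn (p := 2) (hs := hSm) (hμs := hSt) (c := v i)]
      with y h1 h2
    rw [h1, Set.indicator_of_notMem]
    intro h3
    refine h2 ?_
    rw [mem_stepModule]
    simp only [hS, Set.mem_prod, Set.mem_Ico] at h3
    exact Or.inr ⟨by linarith [h3.1.1], h3.2.1⟩
  choose f hf using hG
  have h1 : ∀ᵐ y : ℝ × ℝ, ∀ i j, y ∈ Set.Ici (1 : ℝ) ×ˢ Set.Ici (0 : ℝ) →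
      ⟪extendZeroₗᵢ (stepModule a) k' (T (f i)) y, extendZeroₗᵢ (stepModule a) k' (T (f j)) y⟫_ℂ
        = ⟪extendZeroₗᵢ (stepModule a) k (f i) y, extendZeroₗᵢ (stepModule a) k (f j) y⟫_ℂ :=
    ae_all_iff.2 fun i => ae_all_iff.2 fun j =>
      inner_ae_eq_of_intertwining ha T hT hT' (f i) (f j)
  have h2 : ∀ᵐ y : ℝ × ℝ, ∀ i, extendZeroₗᵢ (stepModule a) k (f i) y
      = S.indicator (fun _ => v i) y :=
    ae_all_iff.2 fun i => by
      rw [hf]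
      exact indicatorConstLp_coeFn
  obtain ⟨y, hyS, h3, h4⟩ : ∃ y ∈ S, (∀ i j, y ∈ Set.Ici (1 : ℝ) ×ˢ Set.Ici (0 : ℝ) →
      ⟪extendZeroₗᵢ (stepModule a) k' (T (f i)) y, extendZeroₗᵢ (stepModule a) k' (T (f j)) y⟫_ℂ
        = ⟪extendZeroₗᵢ (stepModule a) k (f i) y, extendZeroₗᵢ (stepModule a) k (f j) y⟫_ℂ) ∧
      ∀ i, extendZeroₗᵢ (stepModule a) k (f i) y = S.indicator (fun _ => v i) y := by
    by_contra h0
    have h5 : ∀ᵐ y, y ∉ S := by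
      filter_upwards [h1, h2] with y h3 h4 h5
      exact h0 ⟨y, h5, h3, h4⟩
    rw [ae_iff] at h5
    have h6 : volume S = 0 := by simpa using h5
    rw [hSv] at h6
    exact one_ne_zero h6
  refine ⟨fun i => extendZeroₗᵢ (stepModule a) k' (T (f i)) y, ?_⟩
  rw [orthonormal_iff_ite] at hv ⊢
  intro i j
  have hyQ : y ∈ Set.Ici (1 : ℝ) ×ˢ Set.Ici (0 : ℝ) := ⟨hyS.1.1, hyS.2.1⟩
  rw [h3 i j hyQ, h4, h4, Set.indicator_of_mem hyS, Set.indicator_of_mem hyS, hv]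

theorem hilbertDim_le {H : Type u} {H' : Type v} [NormedAddCommGroup H] [InnerProductSpace ℂ H]
    [NormedAddCommGroup H'] [InnerProductSpace ℂ H']
    (h : ∀ (n : ℕ) (v : Fin n → H), Orthonormal ℂ v → ∃ w : Fin n → H', Orthonormal ℂ w) :
    hilbertDim H ≤ hilbertDim H' := by
  refine ENat.forall_natCast_le_iff_le.1 fun n hn => ?_
  rw [hilbertDim, Cardinal.natCast_le_toENat] at hn ⊢
  obtain ⟨v, hv⟩ := Module.le_rank_iff.1 hn
  obtain ⟨w, hw⟩ := h n _ (InnerProductSpace.gramSchmidtNormed_orthonormal (𝕜 := ℂ) hv)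
  exact Module.le_rank_iff.2 ⟨w, hw.linearIndependent⟩

end Multiplicity

/-! ### Conjugacy and cocycle conjugacy -/

section Conjugacy

variable {P : Type*} [AddMonoid P] [TopologicalSpace P]
variable {H : Type u} {H' : Type v} [NormedAddCommGroup H] [InnerProductSpace ℂ H]
  [CompleteSpace H] [NormedAddCommGroup H'] [InnerProductSpace ℂ H'] [CompleteSpace H']

theorem conjStarAlgEquiv_symm_apply (U : H ≃ₗᵢ[ℂ] H') (T : H →L[ℂ] H) :
    U.symm.conjStarAlgEquiv (U.conjStarAlgEquiv T) = T :=
  ContinuousLinearMap.ext fun η => by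
    simp [LinearIsometryEquiv.conjStarAlgEquiv_apply_apply]

theorem E0Semigroup.Conjugate.cocycleConjugate {α : E0Semigroup P H} {β : E0Semigroup P H'}
    (h : α.Conjugate β) : α.CocycleConjugate β := by
  obtain ⟨U, hU⟩ := h
  refine ⟨U, fun _ => 1, ⟨fun x => one_mem _, fun ξ => continuous_const, fun x y => ?_⟩,
    fun x T => ?_⟩
  · rw [map_one, one_mul]
  · rw [star_one, one_mul, mul_one, hU]

theorem E0Semigroup.CocycleConjugate.symm {α : E0Semigroup P H} {β : E0Semigroup P H'}
    (h : α.CocycleConjugate β) : β.CocycleConjugate α := by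
  obtain ⟨U, W, hW, hc⟩ := h
  have h1 : ∀ x, star (W x) * W x = 1 := fun x => Unitary.star_mul_self_of_mem (hW.mem_unitary x)
  have h2 : ∀ x, W x * star (W x) = 1 := fun x => Unitary.mul_star_self_of_mem (hW.mem_unitary x)
  have h3 : ∀ x T, U.conjStarAlgEquiv (α x T)
      = W x * β x (U.conjStarAlgEquiv T) * star (W x) := by
    intro x T
    rw [← hc, conjStarAlgEquiv_symm_apply]
  have h4 : ∀ S : H' →L[ℂ] H', U.conjStarAlgEquiv (U.symm.conjStarAlgEquiv S) = S := fun S =>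
    conjStarAlgEquiv_symm_apply U.symm S
  have hstar : ∀ ξ, Continuous fun x => star (W x) ξ := by
    intro ξ
    rw [continuous_iff_continuousAt]
    intro y
    rw [ContinuousAt, tendsto_iff_norm_sub_tendsto_zero]
    have h5 : Filter.Tendsto (fun x => ‖W x (star (W y) ξ) - ξ‖) (nhds y) (nhds 0) := by
      rw [← tendsto_iff_norm_sub_tendsto_zero]
      have h6 := (hW.continuous (star (W y) ξ)).tendsto y
      rwa [← mul_apply_eq_comp, h2, one_apply_eq_self] at h6
    refine h5.congr fun x => ?_
    have h6 : ∀ ζ, ‖W x ζ‖ = ‖ζ‖ := fun ζ =>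
      ContinuousLinearMap.norm_map_of_mem_unitary (hW.mem_unitary x) ζ
    rw [← h6 (star (W x) ξ - star (W y) ξ), map_sub, ← mul_apply_eq_comp (W x) (star (W x)), h2,
      one_apply_eq_self, norm_sub_rev]
  refine ⟨U.symm, fun x => U.symm.conjStarAlgEquiv (star (W x)), ⟨fun x => ?_, fun ξ => ?_,
    fun x y => ?_⟩, fun x T => ?_⟩
  · rw [Unitary.mem_iff, ← map_star, star_star, ← map_mul, ← map_mul, h1, h2, map_one]
    exact ⟨rfl, rfl⟩
  · simp only [LinearIsometryEquiv.conjStarAlgEquiv_apply_apply]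
    exact U.symm.continuous.comp (hstar _)
  · apply EquivLike.injective U.conjStarAlgEquiv
    rw [map_mul, h3, h4, h4, h4, ← hW.mul, star_mul, ← map_star, mul_assoc (W x),
      ← mul_assoc (star (W x)), h1, one_mul]
  · apply EquivLike.injective U.conjStarAlgEquiv
    rw [h4, map_mul, map_mul, h3, map_star, h4, star_star, ← mul_assoc, ← mul_assoc, h1, one_mul,
      mul_assoc, h1, mul_one]
    rfl

end Conjugacy

/-! ### Second quantization of unitary operators -/

section SecondQuantization

variable {K : Type u} [NormedAddCommGroup K] [InnerProductSpace ℂ K] [CompleteSpace K]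
variable {K' : Type v} [NormedAddCommGroup K'] [InnerProductSpace ℂ K'] [CompleteSpace K']

/-- The unitary `Γ(U)` with `Γ(U) e(u) = e(U u)`. -/
noncomputable def secondQuantUnitary (U : K ≃ₗᵢ[ℂ] K') : Fock K ≃ₗᵢ[ℂ] Fock K' :=
  gramUnitary expVec (fun u => expVec (U u)) expVec_total
    (by
      have h : Set.range (fun u => expVec (U u)) = Set.range (expVec : K' → Fock K') :=
        U.surjective.range_comp expVec
      rw [h, expVec_total])
    (fun u v => by rw [inner_expVec, inner_expVec, U.inner_map_map])

theorem secondQuantUnitary_expVec (U : K ≃ₗᵢ[ℂ] K') (u : K) :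
    secondQuantUnitary U (expVec u) = expVec (U u) :=
  gramUnitary_apply _ _ _ _ _ u

theorem secondQuantUnitary_symm_expVec (U : K ≃ₗᵢ[ℂ] K') (u : K') :
    (secondQuantUnitary U).symm (expVec u) = expVec (U.symm u) := by
  rw [LinearIsometryEquiv.symm_apply_eq, secondQuantUnitary_expVec,
    LinearIsometryEquiv.apply_symm_apply]

variable {P : Type*} [AddMonoid P] [TopologicalSpace P]

theorem IsometricRep.Conjugate.ccrFlow {V : IsometricRep P K} {V' : IsometricRep P K'}
    (h : V.Conjugate V') (hV : V.StrictlyContinuous) (hV' : V'.StrictlyContinuous) :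
    (_root_.ccrFlow V hV).Conjugate (_root_.ccrFlow V' hV') := by
  obtain ⟨U, hU⟩ := h
  refine ⟨secondQuantUnitary U, fun x T => fock_op_ext fun u w => ?_⟩
  have hadj : ∀ z, adj(V x) (U.symm z) = U.symm (adj(V' x) z) := by
    intro z
    refine ext_inner_left ℂ fun ζ => ?_
    rw [ContinuousLinearMap.adjoint_inner_right, ← U.inner_map_map,
      ← U.inner_map_map ζ, U.apply_symm_apply, U.apply_symm_apply,
      ContinuousLinearMap.adjoint_inner_right]
    exact congrArg (fun y => ⟪y, z⟫_ℂ) (hU x ζ)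
  have hmove : ∀ z, ⟪expVec u, secondQuantUnitary U z⟫_ℂ = ⟪expVec (U.symm u), z⟫_ℂ := by
    intro z
    rw [← secondQuantUnitary_symm_expVec, ← (secondQuantUnitary U).inner_map_map,
      LinearIsometryEquiv.apply_symm_apply]
  rw [LinearIsometryEquiv.conjStarAlgEquiv_apply_apply, secondQuantUnitary_symm_expVec, hmove]
  change ⟪expVec u, ccrEnd (V' x) T (expVec w)⟫_ℂ = ⟪_, ccrEnd (V x) _ (expVec _)⟫_ℂ
  rw [inner_ccrEnd, inner_ccrEnd, LinearIsometryEquiv.conjStarAlgEquiv_apply_apply, hadj, hadj,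
    LinearIsometryEquiv.symm_symm, secondQuantUnitary_expVec, LinearIsometryEquiv.inner_map_map,
    LinearIsometryEquiv.inner_map_map, LinearIsometryEquiv.apply_symm_apply,
    ← secondQuantUnitary_symm_expVec, LinearIsometryEquiv.inner_map_map]

end SecondQuantization

/-! ### Spaces of equal dimension -/

section Dimension

theorem hilbertDim_eq_card {k : Type u} [NormedAddCommGroup k] [InnerProductSpace ℂ k]
    [CompleteSpace k] {ι : Type*} (b : HilbertBasis ι ℂ k) : hilbertDim k = ENat.card ι := by
  rcases finite_or_infinite ι with hι | hι
  · have := Fintype.ofFinite ι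
    have h1 := rank_eq_card_basis b.toOrthonormalBasis.toBasis
    rw [hilbertDim, h1, ENat.card_eq_coe_fintype_card, map_natCast]
  · rw [ENat.card_eq_top_of_infinite, hilbertDim, Cardinal.toENat_eq_top]
    by_contra h
    have := Module.rank_lt_aleph0_iff.1 (not_le.1 h)
    exact not_finite_iff_infinite.2 hι b.orthonormal.linearIndependent.finite

theorem HilbertBasis.countable_index {k : Type u} [NormedAddCommGroup k] [InnerProductSpace ℂ k]
    [TopologicalSpace.SeparableSpace k] {ι : Type*} (b : HilbertBasis ι ℂ k) : Countable ι := by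
  refine Set.countable_univ_iff.1 ?_
  refine Set.PairwiseDisjoint.countable_of_isOpen (s := fun i => Metric.ball (b i) (1 / 2)) ?_
    (fun i _ => Metric.isOpen_ball) (fun i _ => ⟨b i, Metric.mem_ball_self (by norm_num)⟩)
  intro i _ j _ hij
  refine Metric.ball_disjoint_ball ?_
  have h1 : ‖b i - b j‖ ^ 2 = 2 := by
    rw [@norm_sub_sq ℂ, b.orthonormal.1, b.orthonormal.1, b.orthonormal.2 hij]
    norm_num
  rw [dist_eq_norm]
  nlinarith [norm_nonneg (b i - b j)]

theorem exists_linearIsometryEquiv_of_hilbertDim_eq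
    {k : Type u} [NormedAddCommGroup k] [InnerProductSpace ℂ k] [CompleteSpace k]
    [TopologicalSpace.SeparableSpace k]
    {k' : Type v} [NormedAddCommGroup k'] [InnerProductSpace ℂ k'] [CompleteSpace k']
    [TopologicalSpace.SeparableSpace k'] (h : hilbertDim k = hilbertDim k') :
    Nonempty (k ≃ₗᵢ[ℂ] k') := by
  obtain ⟨s, b, -⟩ := exists_hilbertBasis ℂ k
  obtain ⟨s', b', -⟩ := exists_hilbertBasis ℂ k'
  have hs := b.countable_index
  have hs' := b'.countable_index
  rw [hilbertDim_eq_card b, hilbertDim_eq_card b'] at h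
  obtain ⟨e⟩ : Nonempty (s ≃ s') := by
    rcases finite_or_infinite s with hf | hf
    · have hf' : Finite s' := by
        rw [← ENat.card_lt_top, ← h]
        exact ENat.card_lt_top.2 hf
      rw [ENat.card_eq_coe_natCard, ENat.card_eq_coe_natCard] at h
      exact Finite.card_eq.1 (by exact_mod_cast h)
    · have hf' : Infinite s' := by
        rw [← not_finite_iff_infinite, ← ENat.card_lt_top, ← h, ENat.card_eq_top_of_infinite]
        exact lt_irrefl _
      exact nonempty_equiv_of_countable
  refine ⟨gramUnitary b (fun i => b' (e i)) b.dense_span ?_ fun i j => ?_⟩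
  · have h1 : Set.range (fun i => b' (e i)) = Set.range b' := e.surjective.range_comp b'
    rw [h1, b'.dense_span]
  · classical
    rw [orthonormal_iff_ite.1 b.orthonormal, orthonormal_iff_ite.1 b'.orthonormal]
    simp only [e.injective.eq_iff]

variable {k : Type u} [NormedAddCommGroup k] [InnerProductSpace ℂ k]
variable {k' : Type v} [NormedAddCommGroup k'] [InnerProductSpace ℂ k']

/-- The unitary operator between `L²` spaces induced by a unitary operator on the values. -/
noncomputable def PlaneModule.mapL2 (A : PlaneModule) (U : k ≃ₗᵢ[ℂ] k') :
    A.L2 k ≃ₗᵢ[ℂ] A.L2 k' where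
  toFun f := U.toContinuousLinearEquiv.toContinuousLinearMap.compLpL 2 (volume.restrict A.carrier) f
  invFun f :=
    U.symm.toContinuousLinearEquiv.toContinuousLinearMap.compLpL 2 (volume.restrict A.carrier) f
  map_add' f g := map_add _ f g
  map_smul' c f := map_smul _ c f
  left_inv f := by
    apply Lp.ext
    filter_upwards [ContinuousLinearMap.coeFn_compLpL (p := 2) (μ := volume.restrict A.carrier)
      U.symm.toContinuousLinearEquiv.toContinuousLinearMap
        (U.toContinuousLinearEquiv.toContinuousLinearMap.compLpL 2 (volume.restrict A.carrier) f),
      ContinuousLinearMap.coeFn_compLpL (p := 2) (μ := volume.restrict A.carrier)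
      U.toContinuousLinearEquiv.toContinuousLinearMap f] with y h1 h2
    rw [h1, h2]
    exact U.symm_apply_apply _
  right_inv f := by
    apply Lp.ext
    filter_upwards [ContinuousLinearMap.coeFn_compLpL (p := 2) (μ := volume.restrict A.carrier)
      U.toContinuousLinearEquiv.toContinuousLinearMap
        (U.symm.toContinuousLinearEquiv.toContinuousLinearMap.compLpL 2
          (volume.restrict A.carrier) f),
      ContinuousLinearMap.coeFn_compLpL (p := 2) (μ := volume.restrict A.carrier)
      U.symm.toContinuousLinearEquiv.toContinuousLinearMap f] with y h1 h2
    rw [h1, h2]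
    exact U.apply_symm_apply _
  norm_map' f := by
    change ‖U.toContinuousLinearEquiv.toContinuousLinearMap.compLpL 2
      (volume.restrict A.carrier) f‖ = ‖f‖
    rw [Lp.norm_def, Lp.norm_def]
    congr 1
    refine eLpNorm_congr_norm_ae ?_
    filter_upwards [ContinuousLinearMap.coeFn_compLpL (p := 2) (μ := volume.restrict A.carrier)
      U.toContinuousLinearEquiv.toContinuousLinearMap f] with y h1
    rw [h1]
    exact U.norm_map _

theorem extendZero_mapL2 {A : PlaneModule} (U : k ≃ₗᵢ[ℂ] k') (f : A.L2 k) :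
    extendZeroₗᵢ A k' (A.mapL2 U f) =ᵐ[volume] fun y => U (extendZeroₗᵢ A k f y) := by
  have h1 : A.mapL2 U f =ᵐ[volume.restrict A.carrier] fun y => U (f y) :=
    ContinuousLinearMap.coeFn_compLpL (p := 2) (μ := volume.restrict A.carrier)
      U.toContinuousLinearEquiv.toContinuousLinearMap f
  have h2 := (ae_eq_restrict_iff_indicator_ae_eq A.isClosed.measurableSet).1 h1
  filter_upwards [h2, coeFn_extendZero (A.mapL2 U f), coeFn_extendZero f] with y h3 h4 h5
  refine h4.trans (h3.trans ?_)
  refine Eq.trans ?_ (congrArg U h5).symm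
  by_cases hy : y ∈ A.carrier
  · rw [Set.indicator_of_mem hy, Set.indicator_of_mem hy]
  · rw [Set.indicator_of_notMem hy, Set.indicator_of_notMem hy, map_zero]

theorem stepRep_conjugate (U : k ≃ₗᵢ[ℂ] k') (a : ℝ) :
    (stepRep k a).Conjugate (stepRep k' a) := by
  refine ⟨(stepModule a).mapL2 U, fun x f => ?_⟩
  change (stepModule a).mapL2 U (shift (stepModule a) k x f)
    = shift (stepModule a) k' x ((stepModule a).mapL2 U f)
  apply (extendZeroₗᵢ (stepModule a) k').injective
  apply Lp.ext
  have h1 := extendZero_mapL2 U (shift (stepModule a) k x f)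
  rw [extendZeroₗᵢ_shift] at h1 ⊢
  filter_upwards [h1, coeFn_planeTranslate (toPlane x) (extendZeroₗᵢ (stepModule a) k f),
    coeFn_planeTranslate (toPlane x)
      (extendZeroₗᵢ (stepModule a) k' ((stepModule a).mapL2 U f)),
    ae_sub (extendZero_mapL2 U f) (toPlane x)] with y h2 h3 h4 h5
  rw [h2, h3, h4, h5]

end Dimension

/-! ### Classification of the flows -/

/-- Cocycle conjugacy determines the multiplicity and the depth, as it yields intertwining
isometries in both directions. -/
theorem hilbertDim_eq_and_eq_of_cocycleConjugate
    {k₁ : Type u} [NormedAddCommGroup k₁] [InnerProductSpace ℂ k₁] [CompleteSpace k₁]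
    [Nontrivial k₁]
    {k₂ : Type v} [NormedAddCommGroup k₂] [InnerProductSpace ℂ k₂] [CompleteSpace k₂]
    [Nontrivial k₂] {a₁ a₂ : ℝ} (ha₁ : a₁ < 0) (ha₂ : a₂ < 0)
    (h : (stepFlow k₁ a₁).CocycleConjugate (stepFlow k₂ a₂)) :
    hilbertDim k₁ = hilbertDim k₂ ∧ a₁ = a₂ := by
  obtain ⟨T, hT, hT'⟩ := exists_intertwining_isometry h (stepRep_isPure a₁)
    (stepRep_noAdditiveCocycle ha₂)
  obtain ⟨S, hS, hS'⟩ := exists_intertwining_isometry h.symm (stepRep_isPure a₂)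
    (stepRep_noAdditiveCocycle ha₁)
  obtain rfl : a₁ = a₂ := le_antisymm (not_lt.1 (not_lt_of_intertwining ha₁ S hS hS'))
    (not_lt.1 (not_lt_of_intertwining ha₂ T hT hT'))
  exact ⟨le_antisymm
    (hilbertDim_le fun n v hv => exists_orthonormal_of_intertwining ha₁ T hT hT' hv)
    (hilbertDim_le fun n v hv => exists_orthonormal_of_intertwining ha₁ S hS hS' hv), rfl⟩

theorem mainTheorem1
    {k₁ : Type*} [NormedAddCommGroup k₁] [InnerProductSpace ℂ k₁] [CompleteSpace k₁]
    [TopologicalSpace.SeparableSpace k₁] [Nontrivial k₁]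
    {k₂ : Type*} [NormedAddCommGroup k₂] [InnerProductSpace ℂ k₂] [CompleteSpace k₂]
    [TopologicalSpace.SeparableSpace k₂] [Nontrivial k₂]
    (a₁ a₂ : ℝ) (ha₁ : a₁ < 0) (ha₂ : a₂ < 0) :
    List.TFAE
      [(stepRep k₁ a₁).Conjugate (stepRep k₂ a₂),
        (stepFlow k₁ a₁).Conjugate (stepFlow k₂ a₂),
        (stepFlow k₁ a₁).CocycleConjugate (stepFlow k₂ a₂),
        hilbertDim k₁ = hilbertDim k₂ ∧ a₁ = a₂] ∧
    (¬ (Set.Iio (0 : ℝ)).Countable ∧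
      (Set.Iio (0 : ℝ)).Pairwise fun a b => ¬ (stepFlow k₁ a).CocycleConjugate (stepFlow k₁ b)) := by
  refine ⟨?_, fun h => (Cardinal.aleph0_lt_continuum.trans_eq
    (Cardinal.mk_Iio_real 0).symm).not_ge h.le_aleph0, fun a ha b hb hab h =>
    hab (hilbertDim_eq_and_eq_of_cocycleConjugate ha hb h).2⟩
  tfae_have 1 → 2 := fun h => h.ccrFlow _ _
  tfae_have 2 → 3 := fun h => h.cocycleConjugate
  tfae_have 3 → 4 := hilbertDim_eq_and_eq_of_cocycleConjugate ha₁ ha₂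
  tfae_have 4 → 1 := by
    rintro ⟨h, rfl⟩
    obtain ⟨U⟩ := exists_linearIsometryEquiv_of_hilbertDim_eq h
    exact stepRep_conjugate U a₁
  tfae_finish
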